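/- Let $n\ge 1$, let $\Omega\subseteq\mathbb R^n$ be a nonempty open set, $s\in\mathbb R$, $1<p<\infty$ and $\frac1p+\frac1{p'}=1$. All functions and distributions are real-valued. **Spaces.** For $\sigma=k+\theta\ge 0$ with $k\in\mathbb N_0$, $\theta\in[0,1)$ and $1<q<\infty$, $W^{\sigma,q}(\Omega)$ is the space of all $u\in L^q(\Omega)$ with $$\|u\|_{W^{\sigma,q}(\Omega)}=\sum_{|\nu|\le k}\|\partial^\nu u\|_{L^q(\Omega)}+\sum_{|\nu|=k}\Big(\iint_{\Omega\times\Omega}\frac{|\partial^\nu u(x)-\partial^\nu u(y)|^q}{|x-y|^{n+\theta q}}\,dx\,dy\Big)^{1/q}<\infty ,$$ where the derivatives are weak derivatives and the second sum is present only if $\theta\neq 0$. For every real $\sigma$, $W^{\sigma,q}_0(\Omega)$ is the closure of $C_c^\infty(\Omega)$ in $W^{\sigma,q}(\Omega)$, where for $\sigma<0$ the space $W^{\sigma,q}(\Omega)=(W^{-\sigma,q'}_0(\Omega))^*$, $\frac1q+\frac1{q'}=1$, carries the dual norm and its elements are identified with distributions on $\Omega$ by restriction to $C_c^\infty(\Omega)$.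 The triple $(\sigma,q,\Omega)$ is a *smooth multiplication triple* if for every $\varphi\in C_c^\infty(\Omega)$ the map $u\mapsto\varphi u$ is well defined and bounded from $W^{\sigma,q}(\Omega)$ to $W^{\sigma,q}(\Omega)$. For compact $K\subset\Omega$ let $W^{s,p}_K(\Omega)=\{u\in W^{s,p}(\Omega):\operatorname{supp}u\subseteq K\}$ with the norm of $W^{s,p}(\Omega)$, and let $W^{s,p}_{comp}(\Omega)=\bigcup_K W^{s,p}_K(\Omega)$ with the locally convex inductive limit topology. Let $W^{-s,p'}_{loc}(\Omega)$ be the space of all $u\in D'(\Omega)$ such that $\varphi u\in W^{-s,p'}(\Omega)$ for all $\varphi\in C_c^\infty(\Omega)$, with the topology defined by the seminorms $u\mapsto\|\varphi u\|_{W^{-s,p'}(\Omega)}$, $\varphi\in C_c^\infty(\Omega)$. Let $\langle\cdot,\cdot\rangle$ be the duality pairing of $W^{-s,p'}_0(\Omega)$ and $W^{s,p}_0(\Omega)$: $\langle v,f\rangle$ is the value at $f$ of the functional on $W^{s,p}_0(\Omega)$ that extends the distribution $v$ if $s\ge 0$, and the value at $v$ of the functional on $W^{-s,p'}_0(\Omega)$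 that extends the distribution $f$ if $s<0$. **Theorem.** Suppose that $(s,p,\Omega)$ and $(-s,p',\Omega)$ are smooth multiplication triples. Then every $f\in W^{s,p}_{comp}(\Omega)$ belongs to $W^{s,p}_0(\Omega)$, $\psi u\in W^{-s,p'}_0(\Omega)$ for all $u\in W^{-s,p'}_{loc}(\Omega)$ and $\psi\in C_c^\infty(\Omega)$, and for every $f\in W^{s,p}_{comp}(\Omega)$ there is a function $\psi_f\in C_c^\infty(\Omega)$ that is equal to $1$ on a neighborhood of the support of $f$. For $u\in W^{-s,p'}_{loc}(\Omega)$ and $f\in W^{s,p}_{comp}(\Omega)$ put $$[T(u)](f)=\langle\psi_f u,f\rangle .$$ Then: 1. $[T(u)](f)$ does not depend on the choice of $\psi_f$. 2. For every $u\in W^{-s,p'}_{loc}(\Omega)$, $T(u)$ is a continuous linear functional on $W^{s,p}_{comp}(\Omega)$. 3. $T: W^{-s,p'}_{loc}(\Omega)\to[W^{s,p}_{comp}(\Omega)]^*$ is linear and bijective. 4. If $[W^{s,p}_{comp}(\Omega)]^*$ is equipped with the strong topology (uniform convergence on bounded sets), then $T$ is a topological isomorphism, that is, $T$ and its inverse are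 continuous. -/

import Mathlib

open TopologicalSpace MeasureTheory
open scoped Distributions ENNReal

noncomputable section

namespace SobolevSlobodeckij

/-- `ℝⁿ` with the Euclidean norm. -/
abbrev Rn (n : ℕ) : Type := EuclideanSpace ℝ (Fin n)

/-- Integrability exponents `1 < p < ∞`. -/
abbrev Exponent : Type := {p : ℝ // 1 < p}

/-- The conjugate exponent `p' = p / (p - 1)`, that is `1 / p + 1 / p' = 1`. -/
def Exponent.conj (p : Exponent) : Exponent :=
  ⟨p.1.conjExponent, (Real.HolderConjugate.conjExponent p.2).symm.lt⟩

variable {n : ℕ} {Ω : Opens (Rn n)}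

/-! ### Operations on distributions

`𝓓(Ω, ℝ)` is Mathlib's space of test functions with its LF topology, `𝓓'(Ω, ℝ)` is the space of
distributions on `Ω`, and `Distribution.dsupport` is the support of a distribution. -/

/-- Multiplication by `φ ∈ C_c^∞(Ω)` on test functions. -/
def mulTest (φ : 𝓓(Ω, ℝ)) : 𝓓(Ω, ℝ) →L[ℝ] 𝓓(Ω, ℝ) :=
  TestFunction.limitCLM ℝ
    (fun f => ⟨fun x => f x * φ x, f.contDiff.mul φ.contDiff, f.hasCompactSupport.mul_right,
      (tsupport_mul_subset_left).trans f.tsupport_subset⟩)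
    (fun _ hK => TestFunction.ofSupportedInCLM ℝ hK ∘L
      ContDiffMapSupportedIn.bilinLeftCLM (ContinuousLinearMap.mul ℝ ℝ) φ.contDiff)
    (fun _ _ _ => by ext; rfl)

/-- The product `φ u` of a test function and a distribution: `(φ u)(ψ) = u(φ ψ)`. -/
def mulDist (φ : 𝓓(Ω, ℝ)) : 𝓓'(Ω, ℝ) →L[ℝ] 𝓓'(Ω, ℝ) :=
  (mulTest φ).precompCompactConvergenceCLM ℝ

/-- The distribution `ψ ↦ ∫_Ω g ψ` defined by a locally integrable function `g` on `Ω`. -/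
def ofFun (Ω : Opens (Rn n)) (g : Rn n → ℝ) : 𝓓'(Ω, ℝ) :=
  (TestFunction.integralAgainstBilinCLM (ContinuousLinearMap.mul ℝ ℝ) volume g :
    𝓓(Ω, ℝ) →L[ℝ] ℝ)

/-- `u` is the distribution defined by the locally integrable function `g`. -/
def Represents (g : Rn n → ℝ) (u : 𝓓'(Ω, ℝ)) : Prop :=
  LocallyIntegrableOn g Ω ∧ u = ofFun Ω g

/-- `∂_1^{ν_1} ⋯ ∂_n^{ν_n}` on distributions. -/
def deriv (ν : Fin n → ℕ) : 𝓓'(Ω, ℝ) →ₗ[ℝ] 𝓓'(Ω, ℝ) :=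
  (List.ofFn fun i =>
    ((Distribution.lineDerivCLM (EuclideanSpace.single i (1 : ℝ)) :
      𝓓'(Ω, ℝ) →L[ℝ] 𝓓'(Ω, ℝ)).toLinearMap : Module.End ℝ 𝓓'(Ω, ℝ)) ^ ν i).prod

lemma mulTest_apply (φ ψ : 𝓓(Ω, ℝ)) (x : Rn n) : mulTest φ ψ x = ψ x * φ x := rfl

lemma mulDist_apply (φ ψ : 𝓓(Ω, ℝ)) (u : 𝓓'(Ω, ℝ)) : mulDist φ u ψ = u (mulTest φ ψ) := rfl

lemma ofFun_apply {g : Rn n → ℝ} (hg : LocallyIntegrableOn g Ω) (ψ : 𝓓(Ω, ℝ)) :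
    ofFun Ω g ψ = ∫ x, ψ x * g x :=
  TestFunction.integralAgainstBilinCLM_eq_integral hg

lemma Represents.zero : Represents 0 (0 : 𝓓'(Ω, ℝ)) := by
  have h : LocallyIntegrableOn (0 : Rn n → ℝ) Ω := locallyIntegrableOn_zero
  refine ⟨h, ?_⟩
  ext ψ
  simp [ofFun_apply h]

lemma Represents.add {f g : Rn n → ℝ} {u v : 𝓓'(Ω, ℝ)} (hf : Represents f u)
    (hg : Represents g v) : Represents (f + g) (u + v) := by
  refine ⟨hf.1.add hg.1, ?_⟩
  ext ψ
  have h1 := ψ.integrable_bilin (ContinuousLinearMap.mul ℝ ℝ) hf.1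
  have h2 := ψ.integrable_bilin (ContinuousLinearMap.mul ℝ ℝ) hg.1
  simp only [ContinuousLinearMap.mul_apply'] at h1 h2
  rw [hf.2, hg.2, ofFun_apply (hf.1.add hg.1)]
  change ofFun Ω f ψ + ofFun Ω g ψ = _
  rw [ofFun_apply hf.1, ofFun_apply hg.1, ← integral_add h1 h2]
  simp [mul_add]

lemma Represents.smul {g : Rn n → ℝ} {u : 𝓓'(Ω, ℝ)} (hg : Represents g u) (c : ℝ) :
    Represents (c • g) (c • u) := by
  refine ⟨hg.1.smul c, ?_⟩
  ext ψ
  rw [hg.2, ofFun_apply (hg.1.smul c)]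
  change c • ofFun Ω g ψ = _
  rw [ofFun_apply hg.1, smul_eq_mul, ← integral_const_mul]
  congr 1
  ext x
  simp; ring

/-! ### Extended norms on distributions and the spaces they define -/

/-- A norm on `𝓓'(Ω)` with values in `[0, ∞]`. -/
structure ExtNorm (Ω : Opens (Rn n)) where
  toFun : 𝓓'(Ω, ℝ) → ℝ≥0∞
  add_le' : ∀ u v, toFun (u + v) ≤ toFun u + toFun v
  smul_le' : ∀ (c : ℝ) u, toFun (c • u) ≤ ‖c‖ₑ * toFun u

namespace ExtNorm

variable (N : ExtNorm Ω)

/-- The distributions of finite norm. -/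
def finite : Submodule ℝ 𝓓'(Ω, ℝ) where
  carrier := {u | N.toFun u < ∞}
  add_mem' {u v} hu hv := (N.add_le' u v).trans_lt (ENNReal.add_lt_top.2 ⟨hu, hv⟩)
  zero_mem' := by
    have h := N.smul_le' 0 0
    simp only [zero_smul, enorm_zero, zero_mul] at h
    exact h.trans_lt ENNReal.zero_lt_top
  smul_mem' c u hu := (N.smul_le' c u).trans_lt (ENNReal.mul_lt_top (by simp) hu)

/-- The space of all distributions of finite norm, normed by `N`. This is a copy of `N.finite`
that does not carry the topology of `𝓓'(Ω)`. -/
def Space : Type := N.finite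

/-- The distribution underlying an element of `N.Space`. -/
def Space.dist {N : ExtNorm Ω} (u : N.Space) : 𝓓'(Ω, ℝ) := Subtype.val u

instance : AddCommGroup N.Space := inferInstanceAs (AddCommGroup N.finite)
instance : Module ℝ N.Space := inferInstanceAs (Module ℝ N.finite)

lemma smul_eq (c : ℝ) (u : 𝓓'(Ω, ℝ)) : N.toFun (c • u) = ‖c‖ₑ * N.toFun u := by
  refine le_antisymm (N.smul_le' c u) ?_
  rcases eq_or_ne c 0 with rfl | hc
  · simp
  have h := N.smul_le' c⁻¹ (c • u)
  rw [inv_smul_smul₀ hc, enorm_inv hc] at h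
  calc ‖c‖ₑ * N.toFun u ≤ ‖c‖ₑ * (‖c‖ₑ⁻¹ * N.toFun (c • u)) := by gcongr
    _ = N.toFun (c • u) := by
      rw [← mul_assoc, ENNReal.mul_inv_cancel (by simpa using hc) (by simp), one_mul]

/-- The norm of `N.Space`. -/
def seminorm : Seminorm ℝ N.Space :=
  Seminorm.of (fun u => (N.toFun u.dist).toReal)
    (fun u v => by
      have hu : N.toFun u.dist < ∞ := u.2
      have hv : N.toFun v.dist < ∞ := v.2
      rw [← ENNReal.toReal_add hu.ne hv.ne]
      exact ENNReal.toReal_mono (ENNReal.add_lt_top.2 ⟨hu, hv⟩).ne (N.add_le' _ _))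
    (fun c u => by
      change (N.toFun (c • u.dist)).toReal = _
      rw [N.smul_eq, ENNReal.toReal_mul, toReal_enorm])

instance : SeminormedAddCommGroup N.Space := N.seminorm.toAddGroupSeminorm.toSeminormedAddCommGroup

instance : NormedSpace ℝ N.Space where
  norm_smul_le c u := (map_smul_eq_mul N.seminorm c u).le

lemma norm_def (u : N.Space) : ‖u‖ = (N.toFun u.dist).toReal := rfl

/-- The closure of `C_c^∞(Ω)` in `N.Space`. -/
def closureTest : Submodule ℝ N.Space :=
  Submodule.topologicalClosure (Submodule.span ℝ {u | ∃ φ : 𝓓(Ω, ℝ), u.dist = ofFun Ω φ})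

/-- `N.closureTest` as a normed space, with the norm of `N.Space`. -/
def Space0 : Type := N.closureTest

/-- The inclusion of `N.Space0` in `N.Space`. -/
def Space0.toSpace {N : ExtNorm Ω} (f : N.Space0) : N.Space := Subtype.val f

instance : SeminormedAddCommGroup N.Space0 :=
  inferInstanceAs (SeminormedAddCommGroup N.closureTest)

instance : NormedSpace ℝ N.Space0 := inferInstanceAs (NormedSpace ℝ N.closureTest)

/-- The functional `F` on the closure of `C_c^∞(Ω)` restricts to the distribution `u`. -/
def Extends (F : StrongDual ℝ N.Space0) (u : 𝓓'(Ω, ℝ)) : Prop :=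
  ∀ (f : N.Space0) (φ : 𝓓(Ω, ℝ)), f.toSpace.dist = ofFun Ω φ → F f = u φ

/-- The norm of the topological dual of the closure of `C_c^∞(Ω)`, where a functional `F` is
identified with the distribution to which it restricts. By density a distribution `u` is the
restriction of at most one `F`; then `dual u` is the operator norm of `F`,
and `dual u = ∞` if there is no such `F`. -/
def dual : ExtNorm Ω where
  toFun u := ⨅ (F : StrongDual ℝ N.Space0) (_ : N.Extends F u), ‖F‖ₑ
  add_le' u v := by
    simp_rw [ENNReal.iInf_add, ENNReal.add_iInf]
    refine le_iInf₂ fun F hF => le_iInf₂ fun G hG => ?_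
    refine (iInf₂_le (F + G) fun f φ h => ?_).trans ?_
    · change F f + G f = u φ + v φ
      rw [hF f φ h, hG f φ h]
    · rw [← ofReal_norm F, ← ofReal_norm G, ← ofReal_norm (F + G),
        ← ENNReal.ofReal_add (norm_nonneg _) (norm_nonneg _)]
      exact ENNReal.ofReal_le_ofReal (norm_add_le F G)
  smul_le' c u := by
    rcases eq_or_ne c 0 with rfl | hc
    · refine (iInf₂_le 0 fun f φ h => ?_).trans ?_
      · rw [zero_smul]
        rfl
      · rw [← ofReal_norm (0 : StrongDual ℝ N.Space0), norm_zero, ENNReal.ofReal_zero]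
        exact bot_le
    have hc' : ‖c‖ₑ ≠ 0 := by simpa using hc
    rw [ENNReal.mul_iInf_of_ne hc' (by simp)]
    refine le_iInf fun F => ?_
    rw [ENNReal.mul_iInf_of_ne hc' (by simp)]
    refine le_iInf fun hF => (iInf₂_le (c • F) fun f φ h => ?_).trans (enorm_smul c F).le
    change c • F f = c • u φ
    rw [hF f φ h]

open Classical in
/-- The unique functional on the closure of `C_c^∞(Ω)` that restricts to the distribution `u`
(and `0` if there is none). -/
def functional (u : 𝓓'(Ω, ℝ)) : StrongDual ℝ N.Space0 :=
  if h : ∃ F, N.Extends F u then h.choose else 0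

end ExtNorm

/-! ### Sobolev-Slobodeckij norms -/

/-- The `L^p(Ω)` norm of a distribution: `‖g‖_{L^p(Ω)}` if `u` is given by a locally integrable
function `g` (which is unique almost everywhere in `Ω`), and `∞` otherwise. -/
def lpNorm (p : Exponent) (u : 𝓓'(Ω, ℝ)) : ℝ≥0∞ :=
  ⨅ (g : Rn n → ℝ) (_ : Represents g u),
    eLpNorm g (ENNReal.ofReal p) (volume.restrict (Ω : Set (Rn n)))

/-- `(∬_{Ω × Ω} |g(x) - g(y)|^p / |x - y|^{n + θ p} dx dy)^{1/p}`. -/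
def gagliardo (Ω : Opens (Rn n)) (θ : ℝ) (p : Exponent) (g : Rn n → ℝ) : ℝ≥0∞ :=
  (∫⁻ z, ‖g z.1 - g z.2‖ₑ ^ (p : ℝ) / ‖z.1 - z.2‖ₑ ^ ((n : ℝ) + θ * p)
    ∂((volume.restrict (Ω : Set (Rn n))).prod (volume.restrict (Ω : Set (Rn n))))) ^ (1 / (p : ℝ))

/-- The Slobodeckij seminorm of order `θ` of a distribution (`∞` if it is not given by a locally
integrable function). -/
def slobodeckij (θ : ℝ) (p : Exponent) (u : 𝓓'(Ω, ℝ)) : ℝ≥0∞ :=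
  ⨅ (g : Rn n → ℝ) (_ : Represents g u), gagliardo Ω θ p g

/-- For `s = k + θ ≥ 0` with `k ∈ ℕ₀` and `θ ∈ [0, 1)`, the norm
`∑_{|ν| ≤ k} ‖∂^ν u‖_{L^p} + ∑_{|ν| = k} |∂^ν u|_{W^{θ,p}}`,
where the second sum is present only if `θ ≠ 0`. -/
def nonnegNorm (s : ℝ) (p : Exponent) (u : 𝓓'(Ω, ℝ)) : ℝ≥0∞ :=
  (∑ j ∈ Finset.range (⌊s⌋₊ + 1), ∑ ν ∈ Finset.univ.piAntidiag j, lpNorm p (deriv ν u)) +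
    if Int.fract s = 0 then 0
    else ∑ ν ∈ Finset.univ.piAntidiag ⌊s⌋₊, slobodeckij (Int.fract s) p (deriv ν u)

/-- An infimum over representing functions of a functional that is subadditive on them. -/
lemma iInf_represents_add_le (G : (Rn n → ℝ) → ℝ≥0∞)
    (hG : ∀ f g, LocallyIntegrableOn f Ω → LocallyIntegrableOn g Ω → G (f + g) ≤ G f + G g)
    (u v : 𝓓'(Ω, ℝ)) :
    (⨅ (g : Rn n → ℝ) (_ : Represents g (u + v)), G g) ≤
      (⨅ (g : Rn n → ℝ) (_ : Represents g u), G g) +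
        ⨅ (g : Rn n → ℝ) (_ : Represents g v), G g := by
  simp_rw [ENNReal.iInf_add, ENNReal.add_iInf]
  exact le_iInf₂ fun f hf => le_iInf₂ fun g hg =>
    (iInf₂_le (f + g) (hf.add hg)).trans (hG f g hf.1 hg.1)

lemma iInf_represents_smul_le (G : (Rn n → ℝ) → ℝ≥0∞)
    (hG : ∀ (c : ℝ) g, G (c • g) ≤ ‖c‖ₑ * G g) (c : ℝ) (u : 𝓓'(Ω, ℝ)) :
    (⨅ (g : Rn n → ℝ) (_ : Represents g (c • u)), G g) ≤
      ‖c‖ₑ * ⨅ (g : Rn n → ℝ) (_ : Represents g u), G g := by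
  rcases eq_or_ne c 0 with rfl | hc
  · rw [zero_smul]
    refine (iInf₂_le (0 : Rn n → ℝ) Represents.zero).trans ?_
    have h := hG 0 0
    rw [zero_smul, enorm_zero, zero_mul] at h
    rw [enorm_zero, zero_mul]
    exact h
  rw [ENNReal.mul_iInf_of_ne (by simpa using hc) (by simp)]
  refine le_iInf fun g => ?_
  rw [ENNReal.mul_iInf_of_ne (by simpa using hc) (by simp)]
  refine le_iInf fun hg => (iInf₂_le (c • g) (hg.smul c)).trans (hG c g)

lemma aestronglyMeasurable_of_locallyIntegrableOn {g : Rn n → ℝ}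
    (hg : LocallyIntegrableOn g Ω) :
    AEStronglyMeasurable g (volume.restrict (Ω : Set (Rn n))) :=
  hg.aestronglyMeasurable

lemma lpNorm_add_le (p : Exponent) (u v : 𝓓'(Ω, ℝ)) :
    lpNorm p (u + v) ≤ lpNorm p u + lpNorm p v :=
  iInf_represents_add_le (fun g => eLpNorm g (ENNReal.ofReal p) (volume.restrict (Ω : Set (Rn n))))
    (fun _ _ hf hg => eLpNorm_add_le
    (aestronglyMeasurable_of_locallyIntegrableOn hf)
    (aestronglyMeasurable_of_locallyIntegrableOn hg)
    (ENNReal.one_le_ofReal.2 p.2.le)) u v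

lemma lpNorm_smul_le (p : Exponent) (c : ℝ) (u : 𝓓'(Ω, ℝ)) :
    lpNorm p (c • u) ≤ ‖c‖ₑ * lpNorm p u :=
  iInf_represents_smul_le (fun g => eLpNorm g (ENNReal.ofReal p) (volume.restrict (Ω : Set (Rn n))))
    (fun c g => (eLpNorm_const_smul c g _ _).le) c u

lemma gagliardo_add_le (θ : ℝ) (p : Exponent) (f g : Rn n → ℝ)
    (hf : LocallyIntegrableOn f Ω) (hg : LocallyIntegrableOn g Ω) :
    gagliardo Ω θ p (f + g) ≤ gagliardo Ω θ p f + gagliardo Ω θ p g := by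
  have hp : (0 : ℝ) < p := one_pos.trans p.2
  set e : ℝ := ((n : ℝ) + θ * p) / p with he
  let w : (Rn n → ℝ) → Rn n × Rn n → ℝ≥0∞ := fun h z => ‖h z.1 - h z.2‖ₑ / ‖z.1 - z.2‖ₑ ^ e
  have hw : ∀ h : Rn n → ℝ, gagliardo Ω θ p h =
      (∫⁻ z, w h z ^ (p : ℝ) ∂((volume.restrict (Ω : Set (Rn n))).prod
        (volume.restrict (Ω : Set (Rn n))))) ^ (1 / (p : ℝ)) := by
    intro h
    simp only [w, gagliardo, ENNReal.div_rpow_of_nonneg _ _ hp.le, ← ENNReal.rpow_mul, he,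
      div_mul_cancel₀ _ hp.ne']
  have hm : ∀ h : Rn n → ℝ, LocallyIntegrableOn h Ω →
      AEMeasurable (w h) ((volume.restrict (Ω : Set (Rn n))).prod
        (volume.restrict (Ω : Set (Rn n)))) := by
    intro h hh
    have h0 := aestronglyMeasurable_of_locallyIntegrableOn hh
    have h1 : AEMeasurable (fun z : Rn n × Rn n => ‖h z.1 - h z.2‖ₑ)
        ((volume.restrict (Ω : Set (Rn n))).prod (volume.restrict (Ω : Set (Rn n)))) :=
      (h0.comp_fst.sub h0.comp_snd).enorm
    exact h1.div (by fun_prop)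
  rw [hw, hw, hw]
  refine le_trans ?_ (ENNReal.lintegral_Lp_add_le (hm f hf) (hm g hg) p.2.le)
  gcongr with z
  simp only [w, Pi.add_apply, ← ENNReal.add_div]
  gcongr
  rw [add_sub_add_comm]
  exact enorm_add_le _ _

lemma gagliardo_smul_le (θ : ℝ) (p : Exponent) (c : ℝ) (g : Rn n → ℝ) :
    gagliardo Ω θ p (c • g) ≤ ‖c‖ₑ * gagliardo Ω θ p g := by
  have hp : (0 : ℝ) < p := one_pos.trans p.2
  simp only [gagliardo, Pi.smul_apply, ← smul_sub, enorm_smul, ENNReal.mul_rpow_of_nonneg _ _ hp.le,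
    mul_div_assoc]
  rw [lintegral_const_mul' _ _ (ENNReal.rpow_ne_top_of_nonneg hp.le (by simp)),
    ENNReal.mul_rpow_of_nonneg _ _ (by positivity), ← ENNReal.rpow_mul,
    mul_one_div_cancel hp.ne', ENNReal.rpow_one]

lemma slobodeckij_add_le (θ : ℝ) (p : Exponent) (u v : 𝓓'(Ω, ℝ)) :
    slobodeckij θ p (u + v) ≤ slobodeckij θ p u + slobodeckij θ p v :=
  iInf_represents_add_le (gagliardo Ω θ p) (gagliardo_add_le θ p) u v

lemma slobodeckij_smul_le (θ : ℝ) (p : Exponent) (c : ℝ) (u : 𝓓'(Ω, ℝ)) :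
    slobodeckij θ p (c • u) ≤ ‖c‖ₑ * slobodeckij θ p u :=
  iInf_represents_smul_le (gagliardo Ω θ p) (gagliardo_smul_le θ p) c u

/-- The norm of `W^{s,p}(Ω)` for `s ≥ 0`. -/
def nonneg (Ω : Opens (Rn n)) (s : ℝ) (p : Exponent) : ExtNorm Ω where
  toFun := nonnegNorm s p
  add_le' u v := by
    unfold nonnegNorm
    simp only [map_add]
    rw [add_add_add_comm]
    gcongr
    · simp only [← Finset.sum_add_distrib]
      gcongr
      exact lpNorm_add_le p _ _
    · split_ifs
      · simp
      · simp only [← Finset.sum_add_distrib]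
        gcongr
        exact slobodeckij_add_le _ p _ _
  smul_le' c u := by
    unfold nonnegNorm
    simp only [map_smul]
    rw [mul_add]
    gcongr
    · simp only [Finset.mul_sum]
      gcongr
      exact lpNorm_smul_le p _ _
    · split_ifs
      · simp
      · simp only [Finset.mul_sum]
        gcongr
        exact slobodeckij_smul_le _ p _ _

/-- The norm of `W^{s,p}(Ω)` for arbitrary real `s`; for `s < 0` it is the norm of the dual of
`W^{-s,p'}_0(Ω)`. -/
def sobolev (Ω : Opens (Rn n)) (s : ℝ) (p : Exponent) : ExtNorm Ω :=
  if 0 ≤ s then nonneg Ω s p else (nonneg Ω (-s) p.conj).dual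

/-! ### The spaces -/

/-- `W^{s,p}(Ω)`. -/
abbrev W (s : ℝ) (p : Exponent) (Ω : Opens (Rn n)) : Type := (sobolev Ω s p).Space

/-- `W^{s,p}_0(Ω)`, the closure of `C_c^∞(Ω)` in `W^{s,p}(Ω)`, with the norm of `W^{s,p}(Ω)`. -/
abbrev W0 (s : ℝ) (p : Exponent) (Ω : Opens (Rn n)) : Type := (sobolev Ω s p).Space0

/-- `u ∈ W^{s,p}(Ω)` belongs to `W^{s,p}_0(Ω)`. -/
def MemW0 {s : ℝ} {p : Exponent} (u : W s p Ω) : Prop := u ∈ (sobolev Ω s p).closureTest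

/-- An element of `W^{s,p}(Ω)` that belongs to `W^{s,p}_0(Ω)`, as an element of the latter. -/
def MemW0.toW0 {s : ℝ} {p : Exponent} {u : W s p Ω} (hu : MemW0 u) : W0 s p Ω := ⟨u, hu⟩

/-- `(s, p, Ω)` is a smooth multiplication triple: for every `φ ∈ C_c^∞(Ω)` the map `u ↦ φ u` is
well defined and bounded from `W^{s,p}(Ω)` to itself. -/
def IsSmoothMultiplicationTriple (s : ℝ) (p : Exponent) (Ω : Opens (Rn n)) : Prop :=
  ∀ φ : 𝓓(Ω, ℝ), ∃ m : W s p Ω →L[ℝ] W s p Ω, ∀ u, (m u).dist = mulDist φ u.dist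

lemma dsupport_add_subset {u v : 𝓓'(Ω, ℝ)} {K : Set (Rn n)} (hu : Distribution.dsupport u ⊆ K)
    (hv : Distribution.dsupport v ⊆ K) : Distribution.dsupport (u + v) ⊆ K := by
  intro x hx
  by_contra hxK
  obtain ⟨a, ha, hao, hxa⟩ := (Distribution.notMem_dsupport_iff x).1 fun h => hxK (hu h)
  obtain ⟨b, hb, hbo, hxb⟩ := (Distribution.notMem_dsupport_iff x).1 fun h => hxK (hv h)
  refine (Distribution.notMem_dsupport_iff x).2 ⟨a ∩ b, fun ψ hψ => ?_, hao.inter hbo, hxa, hxb⟩ hx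
  change u ψ + v ψ = 0
  rw [ha ψ (hψ.trans Set.inter_subset_left), hb ψ (hψ.trans Set.inter_subset_right), add_zero]

lemma dsupport_smul_subset (c : ℝ) (u : 𝓓'(Ω, ℝ)) :
    Distribution.dsupport (c • u) ⊆ Distribution.dsupport u := by
  refine Distribution.dsupport_subset_dsupport fun a _ ha ψ hψ => ?_
  change c • u ψ = 0
  rw [ha ψ hψ, smul_zero]

lemma dsupport_zero_subset (K : Set (Rn n)) :
    Distribution.dsupport (0 : 𝓓'(Ω, ℝ)) ⊆ K := by
  intro x hx
  refine absurd hx ((Distribution.notMem_dsupport_iff x).2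
    ⟨Set.univ, fun _ _ => rfl, isOpen_univ, trivial⟩)

/-- `W^{s,p}_K(Ω)`, the subspace of elements supported in `K`. -/
def WK (s : ℝ) (p : Exponent) (Ω : Opens (Rn n)) (K : Compacts (Rn n)) :
    Submodule ℝ (W s p Ω) where
  carrier := {u | Distribution.dsupport u.dist ⊆ K}
  add_mem' hu hv := dsupport_add_subset hu hv
  zero_mem' := dsupport_zero_subset _
  smul_mem' c u hu := (dsupport_smul_subset c u.dist).trans hu

/-- The subspace `⋃_K W^{s,p}_K(Ω)` of `W^{s,p}(Ω)`, over the compact subsets `K` of `Ω`. -/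
def compactSupport (s : ℝ) (p : Exponent) (Ω : Opens (Rn n)) : Submodule ℝ (W s p Ω) where
  carrier := {u | ∃ K : Compacts (Rn n), (K : Set (Rn n)) ⊆ Ω ∧ u ∈ WK s p Ω K}
  add_mem' := by
    rintro u v ⟨K, hK, hu⟩ ⟨L, hL, hv⟩
    exact ⟨K ⊔ L, Set.union_subset hK hL,
      dsupport_add_subset (hu.trans Set.subset_union_left) (hv.trans Set.subset_union_right)⟩
  zero_mem' := ⟨⊥, Set.empty_subset _, (WK s p Ω ⊥).zero_mem⟩
  smul_mem' := by
    rintro c u ⟨K, hK, hu⟩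
    exact ⟨K, hK, (WK s p Ω K).smul_mem c hu⟩

/-- `W^{s,p}_comp(Ω)`: the space of compactly supported elements of `W^{s,p}(Ω)`. It carries the
inductive limit topology below, not the one induced by `W^{s,p}(Ω)`. -/
def WComp (s : ℝ) (p : Exponent) (Ω : Opens (Rn n)) : Type := compactSupport s p Ω

namespace WComp

variable {s : ℝ} {p : Exponent}

instance : AddCommGroup (WComp s p Ω) := inferInstanceAs (AddCommGroup (compactSupport s p Ω))
instance : Module ℝ (WComp s p Ω) := inferInstanceAs (Module ℝ (compactSupport s p Ω))

/-- The inclusion of `W^{s,p}_comp(Ω)` in `W^{s,p}(Ω)`. -/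
def toW (f : WComp s p Ω) : W s p Ω := Subtype.val f

/-- The inclusion of `W^{s,p}_K(Ω)` in `W^{s,p}_comp(Ω)`. -/
def ofWK {K : Compacts (Rn n)} (hK : (K : Set (Rn n)) ⊆ Ω) (u : WK s p Ω K) : WComp s p Ω :=
  ⟨u.1, K, hK, u.2⟩

/-- The locally convex inductive limit topology: the finest locally convex vector space topology
for which all the inclusions of the normed spaces `W^{s,p}_K(Ω)`, `K ⊆ Ω` compact,
are continuous. -/
instance : TopologicalSpace (WComp s p Ω) :=
  sInf {t | (∀ (K : Compacts (Rn n)) (hK : (K : Set (Rn n)) ⊆ Ω),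
      @Continuous (WK s p Ω K) (WComp s p Ω) inferInstance t (ofWK hK)) ∧
    @IsTopologicalAddGroup (WComp s p Ω) t _ ∧
    @ContinuousSMul ℝ (WComp s p Ω) _ _ t ∧
    @LocallyConvexSpace ℝ (WComp s p Ω) _ _ _ _ t}

instance : IsTopologicalAddGroup (WComp s p Ω) :=
  topologicalAddGroup_sInf fun _ ht => ht.2.1

instance : ContinuousSMul ℝ (WComp s p Ω) :=
  continuousSMul_sInf fun _ ht => ht.2.2.1

instance : LocallyConvexSpace ℝ (WComp s p Ω) :=
  .sInf fun _ ht => ht.2.2.2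

end WComp

/-- The subspace of those distributions `u` with `φ u ∈ W^{s,p}(Ω)` for all `φ ∈ C_c^∞(Ω)`. -/
def locally (s : ℝ) (p : Exponent) (Ω : Opens (Rn n)) : Submodule ℝ 𝓓'(Ω, ℝ) where
  carrier := {u | ∀ φ : 𝓓(Ω, ℝ), mulDist φ u ∈ (sobolev Ω s p).finite}
  add_mem' hu hv φ := by
    rw [map_add]
    exact add_mem (hu φ) (hv φ)
  zero_mem' φ := by
    rw [map_zero]
    exact zero_mem _
  smul_mem' c u hu φ := by
    rw [map_smul]
    exact Submodule.smul_mem _ c (hu φ)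

/-- `W^{s,p}_loc(Ω)`. It carries the topology below, not the one induced by `𝓓'(Ω)`. -/
def WLoc (s : ℝ) (p : Exponent) (Ω : Opens (Rn n)) : Type := locally s p Ω

namespace WLoc

variable {s : ℝ} {p : Exponent}

instance : AddCommGroup (WLoc s p Ω) := inferInstanceAs (AddCommGroup (locally s p Ω))
instance : Module ℝ (WLoc s p Ω) := inferInstanceAs (Module ℝ (locally s p Ω))

/-- The distribution underlying an element of `W^{s,p}_loc(Ω)`. -/
def dist (u : WLoc s p Ω) : 𝓓'(Ω, ℝ) := Subtype.val u

/-- The product `φ u ∈ W^{s,p}(Ω)` of `u ∈ W^{s,p}_loc(Ω)` and `φ ∈ C_c^∞(Ω)`. -/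
def mul (u : WLoc s p Ω) (φ : 𝓓(Ω, ℝ)) : W s p Ω := ⟨mulDist φ u.dist, u.2 φ⟩

/-- The map `u ↦ φ u` from `W^{s,p}_loc(Ω)` to `W^{s,p}(Ω)`. -/
def mulL (φ : 𝓓(Ω, ℝ)) : WLoc s p Ω →ₗ[ℝ] W s p Ω where
  toFun u := u.mul φ
  map_add' u v := Subtype.ext (map_add (mulDist φ) u.dist v.dist)
  map_smul' c u := Subtype.ext (map_smul (mulDist φ) c u.dist)

/-- The seminorms `|u|_φ = ‖φ u‖_{W^{s,p}(Ω)}`, `φ ∈ C_c^∞(Ω)`. -/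
def seminorms : SeminormFamily ℝ (WLoc s p Ω) 𝓓(Ω, ℝ) :=
  fun φ => (normSeminorm ℝ (W s p Ω)).comp (mulL φ)

/-- The locally convex topology defined by the seminorms `|u|_φ`. -/
instance : TopologicalSpace (WLoc s p Ω) := seminorms.moduleFilterBasis.topology

lemma withSeminorms : WithSeminorms (seminorms : SeminormFamily ℝ (WLoc s p Ω) 𝓓(Ω, ℝ)) := ⟨rfl⟩

end WLoc

/-- The duality pairing of `W^{-s,p'}_0(Ω)` and `W^{s,p}_0(Ω)`. If `s ≥ 0`, it is the value at `f`
of the functional on `W^{s,p}_0(Ω)` given by `u`; if `s < 0`, it is the value at `u` of the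
functional on `W^{-s,p'}_0(Ω)` given by `f`. -/
def pairing {s : ℝ} {p : Exponent} (u : W0 (-s) p.conj Ω) (f : W0 s p Ω) : ℝ :=
  if 0 ≤ s then (sobolev Ω s p).functional u.toSpace.dist f
  else (sobolev Ω (-s) p.conj).functional f.toSpace.dist u

/-- `ψ ∈ C_c^∞(Ω)` is equal to `1` on a neighborhood of the support of `u`. -/
def IsCutoff (ψ : 𝓓(Ω, ℝ)) (u : 𝓓'(Ω, ℝ)) : Prop :=
  ∃ U : Set (Rn n), IsOpen U ∧ Distribution.dsupport u ⊆ U ∧ ∀ x ∈ U, ψ x = 1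

end SobolevSlobodeckij

end

/-! The theorem rests on one global fact: the pairing that extends `∫ f v` identifies each of
`W^{s,p}_0(Ω)` and `W^{-s,p'}_0(Ω)` with the dual of the other. The smooth multiplication hypotheses
then localize this fact with cutoff functions.

Global duality (`DualPair`, `exists_dualPair`). For `s ≥ 0` the space `W^{s,p}(Ω)` embeds as a
closed subspace in a finite product of `L^p` spaces by its derivatives and their difference
quotients. It is therefore reflexive, once the Riesz representation theorem for `L^p` is known
(`Lp.exists_conjPairing_eq`), and so is `W^{s,p}_0(Ω)`. Reflexivity gives three things. Functionals
on the dual of `W^{s,p}_0(Ω)` are evaluations. Test functions are dense in that dual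
(`mem_closureTest_dual`). A bounded sequence in `W^{s,p}_0(Ω)` that converges as distributions has
its limit in `W^{s,p}_0(Ω)`. Mollifications of a compactly supported element form such a sequence,
hence compactly supported elements lie in `W^{s,p}_0(Ω)` (`mem_closureTest_nonneg`). For `s < 0` the
two spaces exchange roles. For `s = 0` the norm of `L^{p'}` is the dual norm of `L^p`
(`nonneg_zero_conj`).

Localization (`LocalDuality`). Multiplication by a test function is bounded, and self-adjoint for
the pairing (`pair_mulLeft`). If `ψ` is a cutoff for `f` and `η = 1` on the support of `ψ`, then `⟨ψ
u, f⟩ = ⟨ψ η u, f⟩ = ⟨η u, ψ f⟩ = ⟨η u, f⟩`, so the cutoff does not matter. On elements supported in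
`K` a single cutoff works, whence `T(u)` is continuous. `T(u)` restricts to `u` on test functions,
whence `T` is injective. Given a functional `L`, its restriction to test functions is a distribution
`u`. The functional `f ↦ L(ψ f)` on `W^{s,p}_0(Ω)` is represented by `ψ u`, with `‖ψ u‖` at most its
norm. This yields both surjectivity and continuity of the inverse. Continuity of `T` for the strong
topology holds because a bounded subset of `W^{s,p}_comp(Ω)` is bounded in `W^{s,p}(Ω)` and
supported in one compact set (`exists_compact_of_isVonNBounded`), so again one cutoff suffices. -/

noncomputable section

/-! ### Reflexive spaces -/

/-- Every functional on the dual is the evaluation at a vector. -/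
def BidualSurjective (E : Type*) [SeminormedAddCommGroup E] [NormedSpace ℝ E] : Prop :=
  ∀ ξ : StrongDual ℝ (StrongDual ℝ E), ∃ x : E, ∀ F : StrongDual ℝ E, ξ F = F x

/-- Hahn-Banach: a point outside of a closed subspace is separated from it by a functional that
vanishes on the subspace. -/
lemma exists_dual_eq_zero_of_notMem {E : Type*} [SeminormedAddCommGroup E] [NormedSpace ℝ E]
    (S : Submodule ℝ E) (hS : IsClosed (S : Set E)) {x : E} (hx : x ∉ S) :
    ∃ F : StrongDual ℝ E, (∀ y ∈ S, F y = 0) ∧ F x ≠ 0 := by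
  obtain ⟨F, u, h1, h2⟩ := geometric_hahn_banach_closed_point (S.convex) hS hx
  have h0 : 0 < u := by simpa using h1 0 S.zero_mem
  refine ⟨F, fun y hy => ?_, fun h => ?_⟩
  -- A functional bounded above on a subspace vanishes there: otherwise some multiple of `y` has
  -- value exactly `u`, against the strict bound.
  · by_contra hne
    have := h1 ((u / F y) • y) (S.smul_mem _ hy)
    rw [map_smul, smul_eq_mul, div_mul_cancel₀ _ hne] at this
    exact this.false
  · rw [h] at h2
    exact h0.not_gt h2

/-- Hahn-Banach: functionals extend along embeddings. -/
lemma exists_dual_comp_eq {X E : Type*} [SeminormedAddCommGroup X] [NormedSpace ℝ X]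
    [SeminormedAddCommGroup E] [NormedSpace ℝ E] (T : X →L[ℝ] E) (hT : Function.Injective T)
    {C : ℝ} (hC0 : 0 ≤ C) (hC : ∀ x, ‖x‖ ≤ C * ‖T x‖) (F : StrongDual ℝ X) :
    ∃ G : StrongDual ℝ E, G ∘L T = F ∧ ‖G‖ ≤ ‖F‖ * C := by
  let e : X ≃ₗ[ℝ] T.range := LinearEquiv.ofInjective T.toLinearMap hT
  -- `F` is transported to the range of `T`, where the lower bound on `T` makes it bounded by `‖F‖ *
  -- C`; the norm-preserving extension keeps this bound.
  let F' : StrongDual ℝ T.range :=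
    (F.toLinearMap ∘ₗ e.symm.toLinearMap).mkContinuous (‖F‖ * C) (fun y => by
      obtain ⟨z, rfl⟩ := e.surjective y
      simp only [LinearMap.comp_apply, LinearEquiv.coe_coe, LinearEquiv.symm_apply_apply]
      calc ‖F z‖ ≤ ‖F‖ * ‖z‖ := F.le_opNorm z
        _ ≤ ‖F‖ * (C * ‖T z‖) := by gcongr; exact hC z
        _ = _ := by rw [mul_assoc]; rfl)
  obtain ⟨G, hG, hGn⟩ := exists_extension_norm_eq T.range F'
  refine ⟨G, ?_, hGn.trans_le (LinearMap.mkContinuous_norm_le _ (by positivity) _)⟩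
  ext z
  change G (T z) = F z
  have h1 := hG (e z)
  have h2 : F' (e z) = F z := by
    change F (e.symm (e z)) = F z
    rw [e.symm_apply_apply]
  rw [← h2, ← h1]
  rfl

/-- A space that is embedded as a closed subspace in a reflexive space is reflexive. -/
lemma BidualSurjective.of_closed_range {X E : Type*} [SeminormedAddCommGroup X] [NormedSpace ℝ X]
    [SeminormedAddCommGroup E] [NormedSpace ℝ E] (hE : BidualSurjective E) (T : X →L[ℝ] E)
    (hT : Function.Injective T) (C : ℝ) (hC : ∀ x, ‖x‖ ≤ C * ‖T x‖)
    (hr : IsClosed (Set.range T)) : BidualSurjective X := by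
  intro ξ
  obtain ⟨e, he⟩ := hE (ξ ∘L (ContinuousLinearMap.precomp ℝ T))
  have he' : ∀ F : StrongDual ℝ E, ξ (F ∘L T) = F e := he
  -- A functional `F` that separates `e` from the range satisfies `F ∘ T = 0`, hence `F e = ξ 0 =
  -- 0`.
  have hmem : e ∈ T.range := by
    by_contra hne
    obtain ⟨F, hF, hFe⟩ := exists_dual_eq_zero_of_notMem T.range hr hne
    apply hFe
    have h0 : F ∘L T = 0 := by
      ext x
      exact hF _ ⟨x, rfl⟩
    rw [← he' F, h0, map_zero]
  obtain ⟨x, rfl⟩ := hmem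
  refine ⟨x, fun F => ?_⟩
  obtain ⟨G, rfl, -⟩ := exists_dual_comp_eq T hT (le_max_right C 0) (fun x => (hC x).trans
    (mul_le_mul_of_nonneg_right (le_max_left C 0) (norm_nonneg _))) F
  exact he' G

/-- A functional on a finite product is the sum of its restrictions to the factors, so the
representing vector can be found componentwise. -/
lemma BidualSurjective.pi {ι : Type*} [Fintype ι] {E : ι → Type*}
    [∀ i, SeminormedAddCommGroup (E i)] [∀ i, NormedSpace ℝ (E i)]
    (h : ∀ i, BidualSurjective (E i)) : BidualSurjective (∀ i, E i) := by
  classical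
  intro ξ
  have := fun i => h i (ξ ∘L (ContinuousLinearMap.precomp ℝ
    (ContinuousLinearMap.proj i : (∀ i, E i) →L[ℝ] E i)))
  choose x hx using this
  refine ⟨x, fun F => ?_⟩
  have hF : F = ∑ i, (F ∘L ContinuousLinearMap.single ℝ E i) ∘L
      (ContinuousLinearMap.proj i : (∀ i, E i) →L[ℝ] E i) := by
    ext y
    simp only [sum_apply, ContinuousLinearMap.comp_apply,
      ContinuousLinearMap.proj_apply, ← map_sum]
    congr 1
    exact (Finset.univ_sum_single y).symm
  conv_lhs => rw [hF]
  rw [map_sum]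
  conv_rhs => rw [← Finset.univ_sum_single x, map_sum]
  exact Finset.sum_congr rfl fun i _ => hx i _

lemma BidualSurjective.prod {E F : Type*} [SeminormedAddCommGroup E] [NormedSpace ℝ E]
    [SeminormedAddCommGroup F] [NormedSpace ℝ F] (hE : BidualSurjective E)
    (hF : BidualSurjective F) : BidualSurjective (E × F) := by
  intro ξ
  obtain ⟨x, hx⟩ := hE (ξ ∘L (ContinuousLinearMap.precomp ℝ (ContinuousLinearMap.fst ℝ E F)))
  obtain ⟨y, hy⟩ := hF (ξ ∘L (ContinuousLinearMap.precomp ℝ (ContinuousLinearMap.snd ℝ E F)))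
  refine ⟨(x, y), fun G => ?_⟩
  have hG : G = (G ∘L ContinuousLinearMap.inl ℝ E F) ∘L ContinuousLinearMap.fst ℝ E F +
      (G ∘L ContinuousLinearMap.inr ℝ E F) ∘L ContinuousLinearMap.snd ℝ E F := by
    ext z <;> simp [show ((0 : E), (0 : F)) = 0 from rfl]
  conv_lhs => rw [hG]
  rw [map_add]
  have h1 := hx (G ∘L ContinuousLinearMap.inl ℝ E F)
  have h2 := hy (G ∘L ContinuousLinearMap.inr ℝ E F)
  calc _ = G (x, 0) + G (0, y) := congrArg₂ (· + ·) h1 h2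
    _ = G (x, y) := by rw [← map_add]; simp

end

noncomputable section

/-! ### The dual of `L^p` -/

namespace MeasureTheory.Lp

open scoped NNReal Topology

variable {α : Type*} {m : MeasurableSpace α} {μ : Measure α} {p q : ℝ≥0∞}

/-- The functional `f ↦ ∫ f G` on `L^q` for `G ∈ L^p`. -/
abbrev conjPairing (μ : Measure α) (p q : ℝ≥0∞) [Fact (1 ≤ p)] [Fact (1 ≤ q)]
    [p.HolderConjugate q] : Lp ℝ p μ →L[ℝ] StrongDual ℝ (Lp ℝ q μ) :=
  (ContinuousLinearMap.mul ℝ ℝ).lpPairing μ p q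

lemma conjPairing_apply [Fact (1 ≤ p)] [Fact (1 ≤ q)] [p.HolderConjugate q] (f : Lp ℝ p μ)
    (g : Lp ℝ q μ) : conjPairing μ p q f g = ∫ x, f x * g x ∂μ :=
  ContinuousLinearMap.lpPairing_eq_integral _ f g

lemma norm_conjPairing_apply_le [Fact (1 ≤ p)] [Fact (1 ≤ q)] [p.HolderConjugate q] (f : Lp ℝ p μ)
    (g : Lp ℝ q μ) : ‖conjPairing μ p q f g‖ ≤ ‖f‖ * ‖g‖ := by
  have h1 := (ContinuousLinearMap.mul ℝ ℝ).norm_holder_apply_apply_le (r := 1) f g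
  rw [ContinuousLinearMap.opNorm_mul, one_mul] at h1
  refine le_trans (le_of_eq ?_) ((L1.norm_integral_le _).trans h1)
  rw [L1.integral_eq]
  rfl

/-- Multiplication by the indicator function of a measurable set, as a linear map. -/
def indicatorₗ (μ : Measure α) (p : ℝ≥0∞) {s : Set α} (hs : MeasurableSet s) :
    Lp ℝ p μ →ₗ[ℝ] Lp ℝ p μ where
  toFun f := ((Lp.memLp f).indicator hs).toLp
  map_add' f g := by
    rw [← MemLp.toLp_add]
    refine MemLp.toLp_congr _ _ ?_
    filter_upwards [Lp.coeFn_add f g] with x hx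
    by_cases h : x ∈ s
    · simpa only [Set.indicator_of_mem h, Pi.add_apply] using hx
    · simp [h]
  map_smul' c f := by
    rw [← MemLp.toLp_const_smul]
    refine MemLp.toLp_congr _ _ ?_
    filter_upwards [Lp.coeFn_smul c f] with x hx
    by_cases h : x ∈ s
    · simpa only [Set.indicator_of_mem h, Pi.smul_apply, RingHom.id_apply] using hx
    · simp [h]

lemma norm_indicatorₗ_le {s : Set α} (hs : MeasurableSet s) (f : Lp ℝ p μ) :
    ‖indicatorₗ μ p hs f‖ ≤ 1 * ‖f‖ := by
  have h : indicatorₗ μ p hs f = MemLp.toLp (s.indicator f) ((Lp.memLp f).indicator hs) := rfl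
  rw [one_mul, h, Lp.norm_toLp, Lp.norm_def]
  exact ENNReal.toReal_mono (Lp.eLpNorm_ne_top f) (eLpNorm_indicator_le _)

/-- Multiplication by the indicator function of a measurable set. -/
def indicatorL (μ : Measure α) (p : ℝ≥0∞) [Fact (1 ≤ p)] {s : Set α} (hs : MeasurableSet s) :
    Lp ℝ p μ →L[ℝ] Lp ℝ p μ :=
  (indicatorₗ μ p hs).mkContinuous 1 (norm_indicatorₗ_le hs)

lemma indicatorL_coeFn [Fact (1 ≤ p)] {s : Set α} (hs : MeasurableSet s) (f : Lp ℝ p μ) :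
    indicatorL μ p hs f =ᵐ[μ] s.indicator f := by
  have h : indicatorL μ p hs f = MemLp.toLp (s.indicator f) ((Lp.memLp f).indicator hs) := rfl
  rw [h]
  exact MemLp.coeFn_toLp _

lemma norm_indicatorL_le [Fact (1 ≤ p)] {s : Set α} (hs : MeasurableSet s) :
    ‖indicatorL μ p hs‖ ≤ 1 :=
  LinearMap.mkContinuous_norm_le _ zero_le_one _

/-- For `p ≠ ∞` the indicator functions of sets of finite measure span a dense subspace. -/
lemma strongDual_ext [Fact (1 ≤ p)] (hp : p ≠ ∞) {F F' : StrongDual ℝ (Lp ℝ p μ)}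
    (h : ∀ s (hs : MeasurableSet s) (hμs : μ s ≠ ∞),
      F (indicatorConstLp p hs hμs 1) = F' (indicatorConstLp p hs hμs 1)) : F = F' := by
  ext f
  refine Lp.induction hp (fun f => F f = F' f) ?_ ?_ ?_ f
  · intro c s hs hμs
    rw [Lp.simpleFunc.coe_indicatorConst]
    have : indicatorConstLp p hs hμs.ne c = c • indicatorConstLp p hs hμs.ne (1 : ℝ) := by
      ext1
      filter_upwards [indicatorConstLp_coeFn (p := p) (hs := hs) (hμs := hμs.ne) (c := c),
        Lp.coeFn_smul c (indicatorConstLp p hs hμs.ne (1 : ℝ)),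
        indicatorConstLp_coeFn (p := p) (hs := hs) (hμs := hμs.ne) (c := (1 : ℝ))] with x h1 h2 h3
      rw [h1, h2, Pi.smul_apply, h3]
      by_cases h : x ∈ s <;> simp [h]
    rw [this, map_smul, map_smul, h]
  · intro f g hf hg _ h1 h2
    rw [map_add, map_add, h1, h2]
  · exact isClosed_eq F.continuous F'.continuous

/-- The equality case of Hölder's inequality: `f₀ = sign(G) |G|^{q-1}` satisfies `|f₀|^p = |G|^q =
f₀ G`. With `I = ∫ |G|^q` the bound `|F f₀| ≤ ‖F‖ ‖f₀‖` becomes `I ≤ ‖F‖ I^{1/p}`, and dividing by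
`I^{1/p}` leaves `‖G‖ = I^{1/q} ≤ ‖F‖`. -/
lemma norm_le_norm_of_forall_eq [Fact (1 ≤ p)] [Fact (1 ≤ q)]
    (hpq : p.toReal.HolderConjugate q.toReal) (F : StrongDual ℝ (Lp ℝ p μ)) (G : Lp ℝ q μ)
    (h : ∀ f : Lp ℝ p μ, F f = ∫ x, f x * G x ∂μ) : ‖G‖ ≤ ‖F‖ := by
  have hr := hpq.pos
  have hr' := hpq.symm.pos
  have hp := ENNReal.toReal_pos_iff.1 hr
  have hq := ENNReal.toReal_pos_iff.1 hr'
  let f₀ : α → ℝ := fun x => SignType.sign (G x) * |G x| ^ (q.toReal - 1)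
  have hsgn : Measurable fun y : ℝ => ((SignType.sign y : SignType) : ℝ) := by
    have : (fun y : ℝ => ((SignType.sign y : SignType) : ℝ)) =
        fun y => if 0 < y then 1 else if y < 0 then -1 else 0 := by
      ext y
      rcases lt_trichotomy y 0 with hy | hy | hy
      · simp [hy, hy.le.not_gt]
      · simp [hy]
      · simp [hy]
    rw [this]
    exact Measurable.ite measurableSet_Ioi measurable_const
      (Measurable.ite measurableSet_Iio measurable_const measurable_const)
  have hf₀m : AEStronglyMeasurable f₀ μ := by
    have hG := (Lp.aestronglyMeasurable G).aemeasurable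
    exact ((hsgn.comp_aemeasurable hG).mul
      ((measurable_abs.comp_aemeasurable hG).pow_const _)).aestronglyMeasurable
  have hf₀ : ∀ x, ‖f₀ x‖ₑ ^ p.toReal = ‖G x‖ₑ ^ q.toReal := by
    intro x
    rcases eq_or_ne (G x) 0 with h0 | h0
    · simp [f₀, h0, hr, hr']
    · have habs : 0 < |G x| := abs_pos.2 h0
      have h1 : ‖f₀ x‖ = |G x| ^ (q.toReal - 1) := by
        rw [Real.norm_eq_abs, abs_mul, abs_of_nonneg (Real.rpow_nonneg habs.le _)]
        rcases h0.lt_or_gt with h0 | h0 <;> simp [h0]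
      rw [← ofReal_norm, h1, ENNReal.ofReal_rpow_of_nonneg (by positivity) hr.le,
        ← Real.rpow_mul habs.le, hpq.symm.sub_one_mul_conj, ← ofReal_norm, Real.norm_eq_abs,
        ENNReal.ofReal_rpow_of_nonneg habs.le hr'.le]
  have hGlt : ∫⁻ x, ‖G x‖ₑ ^ q.toReal ∂μ < ∞ :=
    (eLpNorm_lt_top_iff_lintegral_rpow_enorm_lt_top hq.1.ne' hq.2.ne).1 (Lp.eLpNorm_lt_top G)
  have hmem : MemLp f₀ p μ := by
    refine ⟨hf₀m, (eLpNorm_lt_top_iff_lintegral_rpow_enorm_lt_top hp.1.ne' hp.2.ne).2 ?_⟩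
    simpa only [hf₀] using hGlt
  set I : ℝ := (∫⁻ x, ‖G x‖ₑ ^ q.toReal ∂μ).toReal with hI
  have hG1 : ‖G‖ = I ^ (1 / q.toReal) := by
    rw [Lp.norm_def, eLpNorm_eq_lintegral_rpow_enorm_toReal hq.1.ne' hq.2.ne, hI,
      ENNReal.toReal_rpow]
  have hf1 : ‖hmem.toLp f₀‖ = I ^ (1 / p.toReal) := by
    rw [Lp.norm_toLp, eLpNorm_eq_lintegral_rpow_enorm_toReal hp.1.ne' hp.2.ne, hI,
      ENNReal.toReal_rpow]
    simp only [hf₀]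
  have hF : F (hmem.toLp f₀) = I := by
    rw [h, hI]
    have hint : ∀ x, (‖G x‖ₑ ^ q.toReal).toReal = f₀ x * G x := by
      intro x
      rw [← ENNReal.toReal_rpow, toReal_enorm, Real.norm_eq_abs]
      rcases eq_or_ne (G x) 0 with h0 | h0
      · simp [f₀, h0, hr'.ne']
      · have habs : 0 < |G x| := abs_pos.2 h0
        rw [mul_right_comm, sign_mul_self, ← Real.rpow_one_add' habs.le (by simpa using hr'.ne')]
        simp
    rw [← integral_toReal]
    · refine integral_congr_ae ?_
      filter_upwards [hmem.coeFn_toLp] with x hx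
      rw [hx, hint]
    · exact ((Lp.aestronglyMeasurable G).enorm).pow_const _
    · exact Filter.Eventually.of_forall fun x => ENNReal.rpow_lt_top_of_nonneg hr'.le (by simp)
  have hI0 : 0 ≤ I := ENNReal.toReal_nonneg
  rcases hI0.eq_or_lt with h0 | h0
  · rw [hG1, ← h0, Real.zero_rpow (by positivity)]
    exact norm_nonneg _
  · have hle := F.le_opNorm (hmem.toLp f₀)
    rw [hF, hf1, Real.norm_of_nonneg hI0] at hle
    have hpow : 0 < I ^ (1 / p.toReal) := Real.rpow_pos_of_pos h0 _
    refine le_of_mul_le_mul_right ?_ hpow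
    refine le_trans (le_of_eq ?_) hle
    rw [hG1, ← Real.rpow_add h0]
    have := hpq.symm.inv_add_inv_eq_one
    rw [one_div, one_div, this, Real.rpow_one]

/-! ### Riesz representation for finite measures -/

/-- A functional on `L^p` of a finite measure defines a signed measure. -/
def signedMeasureOfDual [IsFiniteMeasure μ] [Fact (1 ≤ p)] (hp : p ≠ ∞)
    (F : StrongDual ℝ (Lp ℝ p μ)) : SignedMeasure α := by
  classical
  exact
  { measureOf' := fun s =>
      if hs : MeasurableSet s then F (indicatorConstLp p hs (measure_ne_top μ s) 1) else 0
    empty' := by simp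
    not_measurable' := fun s hs => by simp [hs]
    m_iUnion' := fun f hf hd => by
      have hU : MeasurableSet (⋃ i, f i) := MeasurableSet.iUnion hf
      simp only [hf, hU, dif_pos]
      have hB : ∀ s : Finset ℕ, MeasurableSet (⋃ i ∈ s, f i) := fun s =>
        Finset.measurableSet_biUnion s fun i _ => hf i
      have hsum : ∀ s : Finset ℕ, indicatorConstLp p (hB s) (measure_ne_top μ _) (1 : ℝ) =
          ∑ i ∈ s, indicatorConstLp p (hf i) (measure_ne_top μ _) 1 := by
        intro s
        induction s using Finset.induction_on with
        | empty => simp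
        | insert a s ha ih =>
          rw [Finset.sum_insert ha, ← ih, ← indicatorConstLp_disjoint_union]
          · simp
          · rw [Set.disjoint_iUnion₂_right]
            exact fun i hi => hd fun h => ha (h ▸ hi)
      -- Countable additivity: the measure of what the finite unions miss tends to zero, so their
      -- indicators converge in `L^p`, and `F` is continuous.
      have hlim : Filter.Tendsto
          (fun s : Finset ℕ => indicatorConstLp p (hB s) (measure_ne_top μ _) (1 : ℝ)) Filter.atTop
          (𝓝 (indicatorConstLp p hU (measure_ne_top μ _) 1)) := by
        refine tendsto_indicatorConstLp_set hp ?_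
        have hsub : ∀ s : Finset ℕ, (⋃ i ∈ s, f i) ⊆ ⋃ i, f i := fun s =>
          Set.iUnion₂_subset fun i _ => Set.subset_iUnion f i
        have heq : ∀ s : Finset ℕ, μ (symmDiff (⋃ i ∈ s, f i) (⋃ i, f i)) =
            μ (⋃ i, f i) - ∑ i ∈ s, μ (f i) := by
          intro s
          rw [Set.symmDiff_def, Set.sdiff_eq_empty.2 (hsub s), Set.empty_union,
            measure_sdiff (hsub s) (hB s).nullMeasurableSet (measure_ne_top μ _),
            measure_biUnion_finset (fun i _ j _ hij => hd hij) (fun i _ => hf i)]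
        simp only [heq]
        have h1 : Filter.Tendsto (fun s : Finset ℕ => ∑ i ∈ s, μ (f i)) Filter.atTop
            (𝓝 (μ (⋃ i, f i))) := by
          rw [measure_iUnion hd hf]
          exact ENNReal.summable.hasSum
        have h2 := ENNReal.Tendsto.sub (tendsto_const_nhds (x := μ (⋃ i, f i))) h1
          (Or.inl (measure_ne_top μ _))
        rwa [tsub_self] at h2
      have := (F.continuous.tendsto _).comp hlim
      refine this.congr fun s => ?_
      simp only [Function.comp_apply, hsum, map_sum] }

lemma signedMeasureOfDual_apply [IsFiniteMeasure μ] [Fact (1 ≤ p)] (hp : p ≠ ∞)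
    (F : StrongDual ℝ (Lp ℝ p μ)) {s : Set α} (hs : MeasurableSet s) :
    signedMeasureOfDual hp F s = F (indicatorConstLp p hs (measure_ne_top μ s) 1) :=
  dif_pos hs

/-- By Radon-Nikodym the signed measure `A ↦ F(1_A)` has an integrable density `g`. The truncations
of `g` to `{|g| ≤ N}` are bounded and represent `F` composed with multiplication by an indicator, so
their `L^q` norms are at most `‖F‖`. Fatou's lemma then puts `g` itself in `L^q`. -/
lemma exists_eq_integral_of_isFiniteMeasure [IsFiniteMeasure μ] [Fact (1 ≤ p)] [Fact (1 ≤ q)]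
    [p.HolderConjugate q] [q.HolderConjugate p]
    (hpq : p.toReal.HolderConjugate q.toReal) (F : StrongDual ℝ (Lp ℝ p μ)) :
    ∃ G : Lp ℝ q μ, conjPairing μ q p G = F := by
  have hp := ENNReal.toReal_pos_iff.1 hpq.pos
  have hq := ENNReal.toReal_pos_iff.1 hpq.symm.pos
  set σ := signedMeasureOfDual hp.2.ne F with hσ
  set g := σ.rnDeriv μ with hg
  have hgi : Integrable g μ := SignedMeasure.integrable_rnDeriv _ _
  have hgm : Measurable g := SignedMeasure.measurable_rnDeriv _ _
  have hFg : ∀ s (hs : MeasurableSet s),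
      F (indicatorConstLp p hs (measure_ne_top μ s) 1) = ∫ x in s, g x ∂μ := by
    intro s hs
    rw [← withDensityᵥ_apply hgi hs, (SignedMeasure.absolutelyContinuous_iff_withDensityᵥ_rnDeriv_eq
      σ μ).1 ?_, hσ, signedMeasureOfDual_apply _ _ hs]
    refine VectorMeasure.AbsolutelyContinuous.mk fun t ht h0 => ?_
    rw [Measure.toENNRealVectorMeasure_apply_measurable ht] at h0
    rw [hσ, signedMeasureOfDual_apply _ _ ht]
    have : indicatorConstLp p ht (measure_ne_top μ t) (1 : ℝ) = 0 := by
      rw [← norm_eq_zero, norm_indicatorConstLp hp.1.ne' hp.2.ne, measureReal_def, h0]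
      simp [Real.zero_rpow (inv_pos.2 hpq.pos).ne']
    rw [this, map_zero]
  -- Stated for general `F'` and `g'`, since it serves for the truncations first and for `g` at the
  -- end.
  have key : ∀ (F' : StrongDual ℝ (Lp ℝ p μ)) (g' : α → ℝ) (hg' : MemLp g' q μ),
      (∀ s (hs : MeasurableSet s),
        F' (indicatorConstLp p hs (measure_ne_top μ s) 1) = ∫ x in s, g' x ∂μ) →
      conjPairing μ q p (hg'.toLp g') = F' := by
    intro F' g' hg' h
    refine strongDual_ext hp.2.ne fun s hs hμs => ?_
    rw [h s hs, conjPairing_apply, ← integral_indicator hs]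
    refine integral_congr_ae ?_
    filter_upwards [hg'.coeFn_toLp, indicatorConstLp_coeFn (p := p) (hs := hs) (hμs := hμs)
      (c := (1 : ℝ))] with x h1 h2
    rw [h1, h2]
    by_cases hx : x ∈ s <;> simp [hx]
  let E : ℕ → Set α := fun N => {x | |g x| ≤ N}
  have hE : ∀ N, MeasurableSet (E N) := fun N => hgm.abs measurableSet_Iic
  have hgN : ∀ N, MemLp ((E N).indicator g) q μ := by
    intro N
    refine MemLp.of_bound (hgm.indicator (hE N)).aestronglyMeasurable (N : ℝ)
      (Filter.Eventually.of_forall fun x => ?_)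
    by_cases hx : x ∈ E N
    · rw [Set.indicator_of_mem hx, Real.norm_eq_abs]
      exact hx
    · simp [hx]
  have hFN : ∀ N, ‖(hgN N).toLp‖ ≤ ‖F‖ := by
    intro N
    have h1 := key (F ∘L indicatorL μ p (hE N)) _ (hgN N) (fun s hs => by
      have : indicatorL μ p (hE N) (indicatorConstLp p hs (measure_ne_top μ s) 1) =
          indicatorConstLp p (hs.inter (hE N)) (measure_ne_top μ _) 1 := by
        ext1
        filter_upwards [indicatorL_coeFn (hE N) (indicatorConstLp p hs (measure_ne_top μ s) 1),
          indicatorConstLp_coeFn (p := p) (hs := hs) (hμs := measure_ne_top μ s) (c := (1 : ℝ)),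
          indicatorConstLp_coeFn (p := p) (hs := hs.inter (hE N)) (hμs := measure_ne_top μ _)
            (c := (1 : ℝ))] with x h1 h2 h3
        rw [h1, h3]
        by_cases hx : x ∈ E N
        · rw [Set.indicator_of_mem hx, h2]
          by_cases hx' : x ∈ s <;> simp [hx, hx']
        · simp [hx]
      rw [ContinuousLinearMap.comp_apply, this, hFg, setIntegral_indicator (hE N)])
    have h2 : ‖(hgN N).toLp‖ ≤ ‖F ∘L indicatorL μ p (hE N)‖ :=
      norm_le_norm_of_forall_eq hpq _ _ fun f => by
        rw [← h1, conjPairing_apply]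
        simp only [mul_comm]
    refine h2.trans ((ContinuousLinearMap.opNorm_comp_le _ _).trans ?_)
    exact mul_le_of_le_one_right (norm_nonneg _) (norm_indicatorL_le _)
  have hgq : MemLp g q μ := by
    refine ⟨hgm.aestronglyMeasurable, lt_of_le_of_lt ?_ (ENNReal.ofReal_lt_top (r := ‖F‖))⟩
    -- Fatou: at each point the truncations are eventually equal to `g`.
    refine (Lp.eLpNorm_lim_le_liminf_eLpNorm (fun N => (hgN N).1) g
      (Filter.Eventually.of_forall fun x => ?_)).trans ?_
    · refine tendsto_const_nhds.congr' ?_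
      filter_upwards [Filter.eventually_ge_atTop ⌈|g x|⌉₊] with N hN
      have : x ∈ E N := (Nat.le_ceil _).trans (Nat.cast_le.2 hN)
      rw [Set.indicator_of_mem this]
    · refine Filter.liminf_le_of_le (by isBoundedDefault) fun b hb => ?_
      obtain ⟨N, hN⟩ := hb.exists
      refine hN.trans ?_
      have := hFN N
      rw [Lp.norm_toLp] at this
      exact (ENNReal.le_ofReal_iff_toReal_le (hgN N).2.ne (norm_nonneg _)).2 this
  exact ⟨hgq.toLp, key F g hgq hFg⟩

/-! ### Changing the density of a measure -/

section Weight

variable {g : α → ℝ≥0}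

lemma ae_withDensity_iff_of_pos (hg : Measurable g) (hpos : ∀ x, 0 < g x) {P : α → Prop} :
    (∀ᵐ x ∂μ.withDensity fun x => (g x : ℝ≥0∞), P x) ↔ ∀ᵐ x ∂μ, P x := by
  rw [ae_withDensity_iff hg.coe_nnreal_ennreal]
  simp [(hpos _).ne']

lemma eLpNorm_weight_mul (hg : Measurable g) (hpq : 0 < p.toReal) {f : α → ℝ}
    (hf : AEStronglyMeasurable f μ) :
    eLpNorm (fun x => (g x : ℝ) ^ (1 / p.toReal) * f x) p μ =
      eLpNorm f p (μ.withDensity fun x => (g x : ℝ≥0∞)) := by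
  have hp := ENNReal.toReal_pos_iff.1 hpq
  rw [eLpNorm_eq_lintegral_rpow_enorm_toReal hp.1.ne' hp.2.ne,
    eLpNorm_eq_lintegral_rpow_enorm_toReal hp.1.ne' hp.2.ne,
    lintegral_withDensity_eq_lintegral_mul₀ hg.coe_nnreal_ennreal.aemeasurable
      (hf.enorm.pow_const _)]
  congr 1
  refine lintegral_congr fun x => ?_
  rw [Pi.mul_apply, enorm_mul, ENNReal.mul_rpow_of_nonneg _ _ hpq.le]
  congr 1
  rw [← ofReal_norm, Real.norm_of_nonneg (by positivity),
    ENNReal.ofReal_rpow_of_nonneg (by positivity) hpq.le, ← Real.rpow_mul (by positivity),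
    one_div_mul_cancel hpq.ne', Real.rpow_one, ENNReal.ofReal_coe_nnreal]

lemma memLp_weight_mul_iff (hg : Measurable g) (hpos : ∀ x, 0 < g x) (hpq : 0 < p.toReal)
    {f : α → ℝ} :
    MemLp (fun x => (g x : ℝ) ^ (1 / p.toReal) * f x) p μ ↔
      MemLp f p (μ.withDensity fun x => (g x : ℝ≥0∞)) := by
  have hw : Measurable fun x => (g x : ℝ) ^ (1 / p.toReal) := hg.coe_nnreal_real.pow_const _
  have h0 : AEStronglyMeasurable (fun x => (g x : ℝ) ^ (1 / p.toReal) * f x) μ ↔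
      AEStronglyMeasurable f μ := by
    refine ⟨fun h => ?_, fun h => hw.aestronglyMeasurable.mul h⟩
    refine (hw.inv.aestronglyMeasurable.mul h).congr (Filter.Eventually.of_forall fun x => ?_)
    have : (0 : ℝ) < (g x : ℝ) ^ (1 / p.toReal) := Real.rpow_pos_of_pos (by exact_mod_cast hpos x) _
    simp only [Pi.mul_apply, Pi.inv_apply]
    rw [inv_mul_cancel_left₀ this.ne']
  have h1 : AEStronglyMeasurable f (μ.withDensity fun x => (g x : ℝ≥0∞)) ↔
      AEStronglyMeasurable f μ := by
    constructor
    · rintro ⟨f', hf', hff'⟩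
      exact ⟨f', hf', (ae_withDensity_iff_of_pos hg hpos).1 hff'⟩
    · exact fun h => h.mono_ac (withDensity_absolutelyContinuous _ _)
  constructor
  · rintro ⟨hm, hlt⟩
    exact ⟨h1.2 (h0.1 hm), by rwa [← eLpNorm_weight_mul hg hpq (h0.1 hm)]⟩
  · rintro ⟨hm, hlt⟩
    exact ⟨h0.2 (h1.1 hm), by rwa [eLpNorm_weight_mul hg hpq (h1.1 hm)]⟩

/-- Multiplication by `g^{1/p}` maps `L^p(g μ)` isometrically to `L^p(μ)`. -/
def weightₗ (μ : Measure α) (p : ℝ≥0∞) (hg : Measurable g) (hpos : ∀ x, 0 < g x)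
    (hpq : 0 < p.toReal) :
    Lp ℝ p (μ.withDensity fun x => (g x : ℝ≥0∞)) →ₗ[ℝ] Lp ℝ p μ where
  toFun f := ((memLp_weight_mul_iff hg hpos hpq).2 (Lp.memLp f)).toLp
  map_add' f h := by
    rw [← MemLp.toLp_add]
    refine MemLp.toLp_congr _ _ ?_
    filter_upwards [(ae_withDensity_iff_of_pos hg hpos).1 (Lp.coeFn_add f h)] with x hx
    rw [Pi.add_apply, hx, Pi.add_apply, mul_add]
  map_smul' c f := by
    rw [← MemLp.toLp_const_smul]
    refine MemLp.toLp_congr _ _ ?_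
    filter_upwards [(ae_withDensity_iff_of_pos hg hpos).1 (Lp.coeFn_smul c f)] with x hx
    rw [hx]
    simp only [Pi.smul_apply, smul_eq_mul, RingHom.id_apply]
    ring

lemma weightₗ_coeFn (hg : Measurable g) (hpos : ∀ x, 0 < g x) (hpq : 0 < p.toReal)
    (f : Lp ℝ p (μ.withDensity fun x => (g x : ℝ≥0∞))) :
    weightₗ μ p hg hpos hpq f =ᵐ[μ] fun x => (g x : ℝ) ^ (1 / p.toReal) * f x :=
  MemLp.coeFn_toLp ((memLp_weight_mul_iff hg hpos hpq).2 (Lp.memLp f))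

lemma norm_weightₗ (hg : Measurable g) (hpos : ∀ x, 0 < g x) (hpq : 0 < p.toReal)
    (f : Lp ℝ p (μ.withDensity fun x => (g x : ℝ≥0∞))) :
    ‖weightₗ μ p hg hpos hpq f‖ = ‖f‖ := by
  have hf : AEStronglyMeasurable f μ := by
    obtain ⟨f', hf', hff'⟩ := Lp.aestronglyMeasurable f
    exact ⟨f', hf', (ae_withDensity_iff_of_pos hg hpos).1 hff'⟩
  refine (Lp.norm_toLp _ ((memLp_weight_mul_iff hg hpos hpq).2 (Lp.memLp f))).trans ?_
  rw [eLpNorm_weight_mul hg hpq hf, Lp.norm_def]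

lemma weightₗ_surjective (hg : Measurable g) (hpos : ∀ x, 0 < g x) (hpq : 0 < p.toReal) :
    Function.Surjective (weightₗ μ p hg hpos hpq) := by
  intro h
  have hw : ∀ x, (g x : ℝ) ^ (1 / p.toReal) ≠ 0 := fun x =>
    (Real.rpow_pos_of_pos (by exact_mod_cast hpos x) _).ne'
  have hmem : MemLp (fun x => ((g x : ℝ) ^ (1 / p.toReal))⁻¹ * h x) p
      (μ.withDensity fun x => (g x : ℝ≥0∞)) := by
    refine (memLp_weight_mul_iff hg hpos hpq).1 ?_
    simp only [mul_inv_cancel_left₀ (hw _)]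
    exact Lp.memLp h
  refine ⟨hmem.toLp, ?_⟩
  ext1
  filter_upwards [weightₗ_coeFn hg hpos hpq hmem.toLp,
    (ae_withDensity_iff_of_pos hg hpos).1 hmem.coeFn_toLp] with x h1 h2
  rw [h1, h2, mul_inv_cancel_left₀ (hw _)]

end Weight

/-- The Riesz representation theorem for the dual of `L^p`, `1 < p < ∞`. -/
theorem exists_conjPairing_eq [SigmaFinite μ] [Fact (1 ≤ p)] [Fact (1 ≤ q)]
    [p.HolderConjugate q] [q.HolderConjugate p]
    (hpq : p.toReal.HolderConjugate q.toReal) (F : StrongDual ℝ (Lp ℝ p μ)) :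
    ∃ G : Lp ℝ q μ, conjPairing μ q p G = F ∧ ‖G‖ ≤ ‖F‖ := by
  suffices h : ∃ G : Lp ℝ q μ, conjPairing μ q p G = F by
    obtain ⟨G, hG⟩ := h
    refine ⟨G, hG, norm_le_norm_of_forall_eq hpq F G fun f => ?_⟩
    rw [← hG, conjPairing_apply]
    simp only [mul_comm]
  -- Reduction to a finite measure: with `g` positive and integrable, multiplication by `g^{1/p}`
  -- and `g^{1/q}` carries `L^p(g μ)` and `L^q(g μ)` isometrically onto `L^p(μ)` and `L^q(μ)`. The
  -- pairing is preserved because `g^{1/p} g^{1/q} = g`.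
  obtain ⟨g, hpos, hg, hlt⟩ := exists_pos_lintegral_lt_of_sigmaFinite μ one_ne_zero
  have hfin : IsFiniteMeasure (μ.withDensity fun x => (g x : ℝ≥0∞)) :=
    isFiniteMeasure_withDensity (hlt.trans ENNReal.one_lt_top).ne
  let U : Lp ℝ p (μ.withDensity fun x => (g x : ℝ≥0∞)) →L[ℝ] Lp ℝ p μ :=
    (weightₗ μ p hg hpos hpq.pos).mkContinuous 1 fun f => by rw [norm_weightₗ, one_mul]
  obtain ⟨G₀, hG₀⟩ := exists_eq_integral_of_isFiniteMeasure hpq (F ∘L U)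
  refine ⟨weightₗ μ q hg hpos hpq.symm.pos G₀, ?_⟩
  ext h
  obtain ⟨f, rfl⟩ := weightₗ_surjective hg hpos hpq.pos h
  have h1 : F (weightₗ μ p hg hpos hpq.pos f) = conjPairing _ q p G₀ f := by rw [hG₀]; rfl
  rw [h1, conjPairing_apply, conjPairing_apply, integral_withDensity_eq_integral_smul hg]
  refine integral_congr_ae ?_
  filter_upwards [weightₗ_coeFn hg hpos hpq.pos f, weightₗ_coeFn hg hpos hpq.symm.pos G₀]
    with x h1 h2
  rw [h1, h2, NNReal.smul_def, smul_eq_mul]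
  have h3 : (g x : ℝ) ^ (1 / q.toReal) * (g x : ℝ) ^ (1 / p.toReal) = g x := by
    have h4 := hpq.symm.inv_add_inv_eq_one
    rw [← Real.rpow_add (by exact_mod_cast hpos x), one_div, one_div, h4, Real.rpow_one]
  linear_combination (G₀ x * f x) * h3

/-- The Riesz theorem is applied twice: `ξ` pulled back to `L^q` is given by some `f ∈ L^p`, and
every functional on `L^p` is given by some `G ∈ L^q`, so `ξ` is evaluation at `f`. -/
lemma bidualSurjective [SigmaFinite μ] [Fact (1 ≤ p)] [Fact (1 ≤ q)]
    [p.HolderConjugate q] [q.HolderConjugate p]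
    (hpq : p.toReal.HolderConjugate q.toReal) : BidualSurjective (Lp ℝ p μ) := by
  intro ξ
  obtain ⟨f, hf, -⟩ := exists_conjPairing_eq (μ := μ) hpq.symm (ξ ∘L conjPairing μ q p)
  refine ⟨f, fun F => ?_⟩
  obtain ⟨G, rfl, -⟩ := exists_conjPairing_eq hpq F
  have h := congrArg (fun Φ => Φ G) hf
  rw [show ξ (conjPairing μ q p G) = conjPairing μ p q f G from h.symm, conjPairing_apply,
    conjPairing_apply]
  simp only [mul_comm]

end MeasureTheory.Lp
end

noncomputable section

namespace SobolevSlobodeckij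

variable {n : ℕ} {Ω : Opens (Rn n)}

/-! ### Supports and cutoff functions -/

/-- A test function that is `1` near a compact subset of `Ω`. -/
lemma exists_cutoff {K : Set (Rn n)} (hK : IsCompact K) (hKΩ : K ⊆ Ω) :
    ∃ (ψ : 𝓓(Ω, ℝ)) (U : Set (Rn n)), IsOpen U ∧ K ⊆ U ∧ U ⊆ Ω ∧ ∀ x ∈ U, ψ x = 1 := by
  obtain ⟨L, hL, hKL, hLΩ⟩ := exists_compact_between hK Ω.isOpen hKΩ
  obtain ⟨f, hf1, hf0, -⟩ := exists_contMDiffMap_one_nhds_of_subset_interior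
    (n := ⊤) (modelWithCornersSelf ℝ (Rn n)) hK.isClosed hKL
  have hsupp : tsupport f ⊆ L :=
    closure_minimal (fun x hx => by_contra fun h => hx (hf0 x h)) hL.isClosed
  let ψ : 𝓓(Ω, ℝ) := ⟨f, f.contMDiff.contDiff, hL.of_isClosed_subset (isClosed_tsupport _) hsupp,
    hsupp.trans hLΩ⟩
  obtain ⟨U, hU, hKU, hU1⟩ := mem_nhdsSet_iff_exists.1 hf1
  exact ⟨ψ, U ∩ Ω, hU.inter Ω.isOpen, Set.subset_inter hKU hKΩ, Set.inter_subset_right,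
    fun x hx => hU1 hx.1⟩

lemma mulTest_comm (φ ψ : 𝓓(Ω, ℝ)) : mulTest φ ψ = mulTest ψ φ := by
  ext x
  rw [mulTest_apply, mulTest_apply, mul_comm]

/-- A distribution vanishes on test functions supported off its support. -/
lemma apply_eq_zero_of_disjoint (u : 𝓓'(Ω, ℝ)) (φ : 𝓓(Ω, ℝ))
    (h : Disjoint (tsupport φ) (Distribution.dsupport u)) : u φ = 0 := by
  classical
  have hx : ∀ x : tsupport φ, ∃ s : Set (Rn n), Distribution.IsVanishingOn u s ∧ IsOpen s ∧
      (x : Rn n) ∈ s := fun x =>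
    (Distribution.notMem_dsupport_iff (x : Rn n)).1 (Set.disjoint_left.1 h x.2)
  choose s hs hso hxs using hx
  have hφc : IsCompact (tsupport φ) := φ.hasCompactSupport
  obtain ⟨t, ht⟩ := hφc.elim_finite_subcover s hso
    (fun x hx => Set.mem_iUnion.2 ⟨⟨x, hx⟩, hxs _⟩)
  -- A partition of unity on the support of `φ` writes `φ` as a finite sum of test functions, each
  -- supported in an open set on which `u` vanishes.
  obtain ⟨f, hf⟩ := SmoothPartitionOfUnity.exists_isSubordinate
    (modelWithCornersSelf ℝ (Rn n)) (isClosed_tsupport φ) (fun i : t => s i) (fun i => hso i)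
    (by simpa [Set.iUnion_subtype] using ht)
  let g : t → 𝓓(Ω, ℝ) := fun i => ⟨fun x => φ x * f i x,
    φ.contDiff.mul (f i).contMDiff.contDiff, φ.hasCompactSupport.mul_right,
    tsupport_mul_subset_left.trans φ.tsupport_subset⟩
  have hsum : φ = ∑ i, g i := by
    ext x
    have h1 : (∑ i, g i) x = ∑ i, φ x * f i x := by
      rw [sum_apply]
      rfl
    rw [h1, ← Finset.mul_sum]
    by_cases hx : x ∈ tsupport φ
    · have := f.sum_eq_one hx
      rw [finsum_eq_sum_of_fintype] at this
      rw [this, mul_one]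
    · rw [image_eq_zero_of_notMem_tsupport hx, zero_mul]
  rw [hsum, map_sum]
  exact Finset.sum_eq_zero fun i _ => hs i (g i) (tsupport_mul_subset_right.trans (hf i))

/-- Test functions that agree near the support of a distribution have the same value. -/
lemma apply_eq_of_eqOn {u : 𝓓'(Ω, ℝ)} {φ ψ : 𝓓(Ω, ℝ)} {U : Set (Rn n)} (hU : IsOpen U)
    (hu : Distribution.dsupport u ⊆ U) (h : ∀ x ∈ U, φ x = ψ x) : u φ = u ψ := by
  rw [← sub_eq_zero, ← map_sub]
  refine apply_eq_zero_of_disjoint u _ (Disjoint.mono_right hu (Set.disjoint_left.2 ?_))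
  have hsub : tsupport (φ - ψ : 𝓓(Ω, ℝ)) ⊆ Uᶜ := by
    refine closure_minimal (fun x hx hxU => hx ?_) hU.isClosed_compl
    rw [sub_apply, h x hxU, sub_self]
  exact hsub

lemma dsupport_mulDist_subset (ψ : 𝓓(Ω, ℝ)) (u : 𝓓'(Ω, ℝ)) :
    Distribution.dsupport (mulDist ψ u) ⊆ tsupport ψ := by
  intro x hx
  by_contra hxψ
  refine (Distribution.notMem_dsupport_iff x).2 ⟨(tsupport ψ)ᶜ, fun φ hφ => ?_,
    (isClosed_tsupport ψ).isOpen_compl, hxψ⟩ hx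
  rw [mulDist_apply]
  convert map_zero u
  ext y
  rw [mulTest_apply]
  by_cases hy : y ∈ tsupport ψ
  · rw [image_eq_zero_of_notMem_tsupport fun h => hφ h hy, zero_mul]
    rfl
  · rw [image_eq_zero_of_notMem_tsupport hy, mul_zero]
    rfl

lemma mulDist_eq_self {u : 𝓓'(Ω, ℝ)} {ψ : 𝓓(Ω, ℝ)} (h : IsCutoff ψ u) : mulDist ψ u = u := by
  obtain ⟨U, hU, hu, h1⟩ := h
  ext φ
  rw [mulDist_apply]
  exact apply_eq_of_eqOn hU hu fun x hx => by rw [mulTest_apply, h1 x hx, mul_one]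

lemma mulDist_mulDist (φ ψ : 𝓓(Ω, ℝ)) (u : 𝓓'(Ω, ℝ)) :
    mulDist φ (mulDist ψ u) = mulDist (mulTest φ ψ) u := by
  ext χ
  simp only [mulDist_apply]
  congr 1
  ext x
  simp only [mulTest_apply]
  ring

lemma mulTest_eq_self {φ ψ : 𝓓(Ω, ℝ)} (h : ∀ x ∈ tsupport φ, ψ x = 1) : mulTest ψ φ = φ := by
  ext x
  rw [mulTest_apply]
  by_cases hx : x ∈ tsupport φ
  · rw [h x hx, mul_one]
  · rw [image_eq_zero_of_notMem_tsupport hx, zero_mul]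

/-! ### Functions as distributions -/

lemma represents_test (φ : 𝓓(Ω, ℝ)) : Represents φ (ofFun Ω φ) :=
  ⟨φ.continuous.locallyIntegrable.locallyIntegrableOn _, rfl⟩

lemma ofFun_test_apply (φ ψ : 𝓓(Ω, ℝ)) : ofFun Ω φ ψ = ∫ x, ψ x * φ x :=
  ofFun_apply (represents_test φ).1 ψ

lemma ofFun_test_comm (φ ψ : 𝓓(Ω, ℝ)) : ofFun Ω φ ψ = ofFun Ω ψ φ := by
  rw [ofFun_test_apply, ofFun_test_apply]
  simp only [mul_comm]

lemma mulDist_ofFun (φ ψ : 𝓓(Ω, ℝ)) : mulDist φ (ofFun Ω ψ) = ofFun Ω (mulTest φ ψ) := by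
  ext χ
  rw [mulDist_apply, ofFun_test_apply, ofFun_test_apply]
  congr 1
  ext x
  simp only [mulTest_apply]
  ring

/-- The linear map `φ ↦ (ψ ↦ ∫ φ ψ)`. -/
def ofTest (Ω : Opens (Rn n)) : 𝓓(Ω, ℝ) →ₗ[ℝ] 𝓓'(Ω, ℝ) where
  toFun φ := ofFun Ω φ
  map_add' φ ψ := ((represents_test φ).add (represents_test ψ)).2.symm
  map_smul' c φ := ((represents_test φ).smul c).2.symm

lemma dsupport_ofFun_subset (φ : 𝓓(Ω, ℝ)) :
    Distribution.dsupport (ofFun Ω φ) ⊆ tsupport φ := by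
  intro x hx
  by_contra hxφ
  refine (Distribution.notMem_dsupport_iff x).2 ⟨(tsupport φ)ᶜ, fun ψ hψ => ?_,
    (isClosed_tsupport φ).isOpen_compl, hxφ⟩ hx
  rw [ofFun_test_apply]
  refine (integral_congr_ae (Filter.Eventually.of_forall fun y => ?_)).trans
    (integral_zero (Rn n) ℝ)
  change ψ y * φ y = 0
  by_cases hy : y ∈ tsupport φ
  · rw [image_eq_zero_of_notMem_tsupport fun h => hψ h hy, zero_mul]
  · rw [image_eq_zero_of_notMem_tsupport hy, mul_zero]

/-- The fundamental lemma of the calculus of variations on the open set `Ω \ K`. -/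
lemma Represents.ae_eq_zero {g : Rn n → ℝ} {u : 𝓓'(Ω, ℝ)} (h : Represents g u)
    {K : Set (Rn n)} (hK : IsClosed K) (hu : Distribution.dsupport u ⊆ K) :
    ∀ᵐ x, x ∈ (Ω : Set (Rn n)) \ K → g x = 0 := by
  refine (Ω.isOpen.sdiff hK).ae_eq_zero_of_integral_contDiff_smul_eq_zero
    (h.1.mono_set Set.sdiff_subset) fun φ hφ hφc hφs => ?_
  let ψ : 𝓓(Ω, ℝ) := ⟨φ, hφ, hφc, hφs.trans Set.sdiff_subset⟩
  have h0 : u ψ = 0 := apply_eq_zero_of_disjoint u ψ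
    (Set.disjoint_left.2 fun x hx hxu => (hφs hx).2 (hu hxu))
  rw [h.2, ofFun_apply h.1] at h0
  exact h0

/-- The difference represents the zero distribution. Consequently the infima in `lpNorm` and
`slobodeckij` are attained at every representing function. -/
lemma Represents.ae_eq {g g' : Rn n → ℝ} {u : 𝓓'(Ω, ℝ)} (h : Represents g u)
    (h' : Represents g' u) : g =ᵐ[volume.restrict (Ω : Set (Rn n))] g' := by
  have h0 := h.add (h'.smul (-1))
  rw [show u + (-1 : ℝ) • u = 0 by rw [neg_smul, one_smul, add_neg_cancel]] at h0
  have h1 := h0.ae_eq_zero isClosed_empty (dsupport_zero_subset _)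
  refine (ae_restrict_iff' Ω.isOpen.measurableSet).2 ?_
  filter_upwards [h1] with x hx hxΩ
  have := hx ⟨hxΩ, Set.notMem_empty _⟩
  simp only [Pi.add_apply, Pi.smul_apply, smul_eq_mul] at this
  linarith

lemma Represents.congr_ae {g g' : Rn n → ℝ} {u : 𝓓'(Ω, ℝ)} (h : Represents g u)
    (h' : g =ᵐ[volume.restrict (Ω : Set (Rn n))] g') : Represents g' u := by
  have hli : LocallyIntegrableOn g' Ω := by
    intro x hx
    obtain ⟨t, ht, hgt⟩ := h.1 x hx
    refine ⟨t ∩ Ω, Filter.inter_mem ht self_mem_nhdsWithin, ?_⟩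
    exact (hgt.mono_set Set.inter_subset_left).congr
      (ae_mono (Measure.restrict_mono_set _ Set.inter_subset_right) h')
  refine ⟨hli, ?_⟩
  ext ψ
  rw [h.2, ofFun_apply h.1, ofFun_apply hli]
  refine integral_congr_ae ?_
  filter_upwards [(ae_restrict_iff' Ω.isOpen.measurableSet).1 h'] with x hx
  by_cases hxψ : x ∈ tsupport ψ
  · rw [hx (ψ.tsupport_subset hxψ)]
  · rw [image_eq_zero_of_notMem_tsupport hxψ, zero_mul, zero_mul]

/-! ### Derivatives of distributions -/

/-- The derivative `∂_i` of distributions as an endomorphism. -/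
abbrev partialDeriv (Ω : Opens (Rn n)) (i : Fin n) : Module.End ℝ 𝓓'(Ω, ℝ) :=
  ((Distribution.lineDerivCLM (EuclideanSpace.single i (1 : ℝ)) :
      𝓓'(Ω, ℝ) →L[ℝ] 𝓓'(Ω, ℝ)).toLinearMap : Module.End ℝ 𝓓'(Ω, ℝ))

/-- The derivative `∂_i` of test functions. -/
abbrev testPartialDeriv (Ω : Opens (Rn n)) (i : Fin n) : 𝓓(Ω, ℝ) →L[ℝ] 𝓓(Ω, ℝ) :=
  TestFunction.lineDerivCLM ℝ (EuclideanSpace.single i (1 : ℝ))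

lemma partialDeriv_apply (i : Fin n) (u : 𝓓'(Ω, ℝ)) (φ : 𝓓(Ω, ℝ)) :
    partialDeriv Ω i u φ = -u (testPartialDeriv Ω i φ) := rfl

lemma testPartialDeriv_apply (i : Fin n) (φ : 𝓓(Ω, ℝ)) (x : Rn n) :
    testPartialDeriv Ω i φ x = fderiv ℝ φ x (EuclideanSpace.single i (1 : ℝ)) := by
  rw [testPartialDeriv, TestFunction.lineDerivCLM_eq_fderivCLM,
    TestFunction.fderivCLM_apply_of_le _ (by simp)]

/-- `deriv ν` is a product of powers of the `∂_i`, so a property that is stable under composition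
need only be checked for a single `∂_i`. -/
lemma deriv_induction (P : Module.End ℝ 𝓓'(Ω, ℝ) → Prop) (one : P 1)
    (mul : ∀ S T, P S → P T → P (S * T)) (base : ∀ i, P (partialDeriv Ω i)) (ν : Fin n → ℕ) :
    P (deriv ν) := by
  refine List.prod_induction P mul one fun T hT => ?_
  obtain ⟨i, rfl⟩ := (List.mem_ofFn' _ _).1 hT
  change P (partialDeriv Ω i ^ ν i)
  induction ν i with
  | zero => exact one
  | succ k ih =>
    rw [pow_succ]
    exact mul _ _ ih (base i)

lemma exists_deriv_adjoint (ν : Fin n → ℕ) :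
    ∃ A : 𝓓(Ω, ℝ) →L[ℝ] 𝓓(Ω, ℝ), ∀ (u : 𝓓'(Ω, ℝ)) (φ : 𝓓(Ω, ℝ)), deriv ν u φ = u (A φ) := by
  refine deriv_induction (fun T => ∃ A : 𝓓(Ω, ℝ) →L[ℝ] 𝓓(Ω, ℝ),
    ∀ (u : 𝓓'(Ω, ℝ)) (φ : 𝓓(Ω, ℝ)), T u φ = u (A φ)) ⟨.id ℝ _, fun _ _ => rfl⟩ ?_ ?_ ν
  · rintro S T ⟨A, hA⟩ ⟨B, hB⟩
    exact ⟨B ∘L A, fun u φ => by rw [Module.End.mul_apply, hA, hB]; rfl⟩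
  · exact fun i => ⟨-testPartialDeriv Ω i, fun u φ => by
      rw [partialDeriv_apply, neg_apply, map_neg]⟩

lemma partialDeriv_ofFun (i : Fin n) (φ : 𝓓(Ω, ℝ)) :
    partialDeriv Ω i (ofFun Ω φ) = ofFun Ω (testPartialDeriv Ω i φ) := by
  ext ψ
  rw [partialDeriv_apply, ofFun_test_apply, ofFun_test_apply]
  simp only [testPartialDeriv_apply]
  have hd : ∀ χ : 𝓓(Ω, ℝ), Differentiable ℝ χ := fun χ => χ.contDiff.differentiable (by simp)
  have hc : ∀ χ η : 𝓓(Ω, ℝ), Integrable (fun x => χ x * η x) := fun χ η =>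
    (χ.continuous.mul η.continuous).integrable_of_hasCompactSupport χ.hasCompactSupport.mul_right
  have := integral_mul_fderiv_eq_neg_fderiv_mul_of_integrable (μ := volume) (f := ψ) (g := φ)
    (v := EuclideanSpace.single i (1 : ℝ))
    (by simpa only [testPartialDeriv_apply] using hc (testPartialDeriv Ω i ψ) φ)
    (by simpa only [testPartialDeriv_apply] using hc ψ (testPartialDeriv Ω i φ))
    (hc ψ φ) (fun x _ => hd ψ x) (fun x _ => hd φ x)
  rw [this]

lemma tsupport_testPartialDeriv_subset (i : Fin n) (φ : 𝓓(Ω, ℝ)) :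
    tsupport (testPartialDeriv Ω i φ) ⊆ tsupport φ := by
  have : (testPartialDeriv Ω i φ : Rn n → ℝ) =
      fun x => fderiv ℝ φ x (EuclideanSpace.single i (1 : ℝ)) := by
    ext x
    exact testPartialDeriv_apply i φ x
  rw [this]
  exact tsupport_fderiv_apply_subset ℝ _

lemma exists_deriv_ofFun (ν : Fin n → ℕ) :
    ∃ A : 𝓓(Ω, ℝ) →L[ℝ] 𝓓(Ω, ℝ), ∀ φ : 𝓓(Ω, ℝ),
      deriv ν (ofFun Ω φ) = ofFun Ω (A φ) ∧ tsupport (A φ) ⊆ tsupport φ := by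
  refine deriv_induction (fun T => ∃ A : 𝓓(Ω, ℝ) →L[ℝ] 𝓓(Ω, ℝ),
    ∀ φ : 𝓓(Ω, ℝ), T (ofFun Ω φ) = ofFun Ω (A φ) ∧ tsupport (A φ) ⊆ tsupport φ)
    ⟨.id ℝ _, fun _ => ⟨rfl, subset_rfl⟩⟩ ?_ ?_ ν
  · rintro S T ⟨A, hA⟩ ⟨B, hB⟩
    exact ⟨A ∘L B, fun φ => ⟨by rw [Module.End.mul_apply, (hB φ).1, (hA _).1]; rfl,
      (hA _).2.trans (hB φ).2⟩⟩
  · exact fun i => ⟨testPartialDeriv Ω i, fun φ =>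
      ⟨partialDeriv_ofFun i φ, tsupport_testPartialDeriv_subset i φ⟩⟩

lemma dsupport_partialDeriv_subset (i : Fin n) (u : 𝓓'(Ω, ℝ)) :
    Distribution.dsupport (partialDeriv Ω i u) ⊆ Distribution.dsupport u := by
  refine Distribution.dsupport_subset_dsupport fun s _ hs φ hφ => ?_
  rw [partialDeriv_apply, hs _ ((tsupport_testPartialDeriv_subset i φ).trans hφ), neg_zero]

lemma dsupport_deriv_subset (ν : Fin n → ℕ) (u : 𝓓'(Ω, ℝ)) :
    Distribution.dsupport (deriv ν u) ⊆ Distribution.dsupport u :=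
  deriv_induction (fun T => ∀ u : 𝓓'(Ω, ℝ), Distribution.dsupport (T u) ⊆
    Distribution.dsupport u) (fun _ => subset_rfl)
    (fun _ T hS hT u => (hS (T u)).trans (hT u)) (fun i u => dsupport_partialDeriv_subset i u) ν u

end SobolevSlobodeckij
end

noncomputable section

namespace SobolevSlobodeckij

variable {n : ℕ} {Ω : Opens (Rn n)}

/-! ### Exponents -/

lemma Exponent.pos (p : Exponent) : (0 : ℝ) < p := one_pos.trans p.2

lemma Exponent.holderConjugate (p : Exponent) : (p : ℝ).HolderConjugate p.conj :=
  Real.HolderConjugate.conjExponent p.2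

lemma Exponent.conj_conj (p : Exponent) : p.conj.conj = p :=
  Subtype.ext p.holderConjugate.symm.conjugate_eq.symm

instance (p : Exponent) : Fact (1 ≤ ENNReal.ofReal p) := ⟨ENNReal.one_le_ofReal.2 p.2.le⟩

instance (p : Exponent) : (ENNReal.ofReal p).HolderConjugate (ENNReal.ofReal p.conj) :=
  p.holderConjugate.ennrealOfReal

instance (p : Exponent) : (ENNReal.ofReal p.conj).HolderConjugate (ENNReal.ofReal p) :=
  p.holderConjugate.symm.ennrealOfReal

lemma Exponent.toReal_ofReal (p : Exponent) : (ENNReal.ofReal p).toReal = p :=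
  ENNReal.toReal_ofReal p.pos.le

lemma Exponent.toReal_holderConjugate (p : Exponent) :
    (ENNReal.ofReal p).toReal.HolderConjugate (ENNReal.ofReal p.conj).toReal := by
  rw [p.toReal_ofReal, p.conj.toReal_ofReal]
  exact p.holderConjugate

lemma Exponent.ofReal_ne_zero (p : Exponent) : ENNReal.ofReal p ≠ 0 :=
  (ENNReal.ofReal_pos.2 p.pos).ne'

lemma bidualSurjective_Lp {α : Type*} {m : MeasurableSpace α} (μ : Measure α) [SigmaFinite μ]
    (p : Exponent) : BidualSurjective (Lp ℝ (ENNReal.ofReal p) μ) :=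
  Lp.bidualSurjective p.toReal_holderConjugate

/-! ### The Slobodeckij kernel -/

/-- In polar coordinates the integrand is `r^{p(1-θ)-1}` for `r < 1`, integrable because `θ < 1`,
and `r^{-1-θp}` for `r > 1`, integrable because `θ > 0`. -/
lemma lintegral_min_kernel_lt_top (hn : 0 < n) {θ : ℝ} (h0 : 0 < θ) (h1 : θ < 1) (p : Exponent) :
    ∫⁻ z : Rn n, min 1 ‖z‖ₑ ^ (p : ℝ) / ‖z‖ₑ ^ ((n : ℝ) + θ * p) < ∞ := by
  have hp := p.pos
  have : NeZero n := ⟨hn.ne'⟩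
  let f : ℝ → ℝ := fun y => min 1 y ^ (p : ℝ) * y ^ (-((n : ℝ) + θ * p))
  have hint : Integrable (fun z : Rn n => f ‖z‖) := by
    rw [integrable_fun_norm_addHaar]
    simp only [finrank_euclideanSpace, Fintype.card_fin, smul_eq_mul]
    have hnr : ((n - 1 : ℕ) : ℝ) = n - 1 := by rw [Nat.cast_sub hn, Nat.cast_one]
    rw [← Set.Ioc_union_Ioi_eq_Ioi zero_le_one, integrableOn_union]
    constructor
    · rw [integrableOn_Ioc_iff_integrableOn_Ioo]
      have h2 : -1 < (p : ℝ) * (1 - θ) - 1 := by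
        have := mul_pos hp (sub_pos.2 h1)
        linarith
      refine ((intervalIntegral.integrableOn_Ioo_rpow_iff one_pos).2 h2).congr_fun
        (fun y hy => ?_) measurableSet_Ioo
      simp only [f]
      rw [min_eq_right hy.2.le, ← Real.rpow_natCast, ← Real.rpow_add hy.1, ← Real.rpow_add hy.1,
        hnr]
      congr 1
      ring
    · have h2 : -1 - θ * p < -1 := by
        have := mul_pos h0 hp
        linarith
      refine (integrableOn_Ioi_rpow_of_lt h2 one_pos).congr_fun (fun y hy => ?_) measurableSet_Ioi
      have hy' : (0 : ℝ) < y := one_pos.trans hy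
      simp only [f]
      rw [min_eq_left (le_of_lt hy), Real.one_rpow, one_mul, ← Real.rpow_natCast,
        ← Real.rpow_add hy', hnr]
      congr 1
      ring
  refine lt_of_eq_of_lt (lintegral_congr fun z => ?_) hint.2
  rcases eq_or_ne z 0 with rfl | hz
  · simp [f, hp, hp.ne']
  · have hz' : 0 < ‖z‖ := norm_pos_iff.2 hz
    have hm : (min 1 ‖z‖ₑ) = ENNReal.ofReal (min 1 ‖z‖) := by
      rw [ENNReal.ofReal_min, ENNReal.ofReal_one, ofReal_norm]
    rw [← ofReal_norm (f ‖z‖), Real.norm_of_nonneg (by positivity), hm, ← ofReal_norm z,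
      ENNReal.ofReal_rpow_of_nonneg (by positivity) hp.le, ENNReal.ofReal_rpow_of_pos hz',
      ← ENNReal.ofReal_div_of_pos (by positivity)]
    simp only [f]
    rw [Real.rpow_neg hz'.le, div_eq_mul_inv]

/-- Tonelli: in each summand the variable that does not occur in `f` is integrated first, and the
inner integral equals `∫ h` by invariance of the volume under translations and reflections. -/
lemma lintegral_fst_add_snd_mul {f h : Rn n → ℝ≥0∞} (hf : Measurable f) (hh : Measurable h) :
    ∫⁻ z : Rn n × Rn n, (f z.1 + f z.2) * h (z.1 - z.2) = 2 * (∫⁻ x, f x) * ∫⁻ z, h z := by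
  have hm1 : Measurable fun z : Rn n × Rn n => f z.1 * h (z.1 - z.2) := by fun_prop
  have hm2 : Measurable fun z : Rn n × Rn n => f z.2 * h (z.1 - z.2) := by fun_prop
  simp only [add_mul]
  rw [lintegral_add_left hm1, Measure.volume_eq_prod, lintegral_prod _ hm1.aemeasurable,
    lintegral_prod_symm _ hm2.aemeasurable]
  have e1 : ∀ x : Rn n, ∫⁻ y, f x * h (x - y) = f x * ∫⁻ z, h z := by
    intro x
    rw [lintegral_const_mul _ (by fun_prop), lintegral_sub_left_eq_self h x]
  have e2 : ∀ y : Rn n, ∫⁻ x, f y * h (x - y) = f y * ∫⁻ z, h z := by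
    intro x
    rw [lintegral_const_mul _ (by fun_prop), lintegral_sub_right_eq_self h x]
  simp only [e1, e2]
  rw [lintegral_mul_const _ hf]
  ring

/-- An integral over pairs of points one of which lies in `K`. -/
lemma lintegral_indicator_add_mul (K : Set (Rn n)) (hK : MeasurableSet K) {h : Rn n → ℝ≥0∞}
    (hh : Measurable h) :
    ∫⁻ z : Rn n × Rn n, (K.indicator 1 z.1 + K.indicator 1 z.2) * h (z.1 - z.2) =
      2 * volume K * ∫⁻ z, h z := by
  rw [lintegral_fst_add_snd_mul (measurable_one.indicator hK) hh, lintegral_indicator_one hK]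

/-! ### The norms in terms of representing functions -/

lemma lpNorm_eq {g : Rn n → ℝ} {u : 𝓓'(Ω, ℝ)} (h : Represents g u) (p : Exponent) :
    lpNorm p u = eLpNorm g (ENNReal.ofReal p) (volume.restrict (Ω : Set (Rn n))) :=
  le_antisymm (iInf₂_le g h) (le_iInf₂ fun _ hg' => (eLpNorm_congr_ae (h.ae_eq hg')).le)

lemma gagliardo_congr {g g' : Rn n → ℝ} (h : g =ᵐ[volume.restrict (Ω : Set (Rn n))] g') (θ : ℝ)
    (p : Exponent) : gagliardo Ω θ p g = gagliardo Ω θ p g' := by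
  unfold gagliardo
  congr 1
  refine lintegral_congr_ae ?_
  filter_upwards [Measure.quasiMeasurePreserving_fst.ae h,
    Measure.quasiMeasurePreserving_snd.ae h] with z h1 h2
  rw [h1, h2]

lemma slobodeckij_eq {g : Rn n → ℝ} {u : 𝓓'(Ω, ℝ)} (h : Represents g u) (θ : ℝ) (p : Exponent) :
    slobodeckij θ p u = gagliardo Ω θ p g :=
  le_antisymm (iInf₂_le g h) (le_iInf₂ fun _ hg' => (gagliardo_congr (h.ae_eq hg') θ p).le)

lemma exists_represents {u : 𝓓'(Ω, ℝ)} {p : Exponent} (h : lpNorm p u < ∞) :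
    ∃ g, Represents g u ∧ MemLp g (ENNReal.ofReal p) (volume.restrict (Ω : Set (Rn n))) := by
  obtain ⟨g, hg⟩ := iInf_lt_iff.1 h
  obtain ⟨hr, hg⟩ := iInf_lt_iff.1 hg
  exact ⟨g, hr, aestronglyMeasurable_of_locallyIntegrableOn hr.1, hg⟩

lemma lpNorm_deriv_le {s : ℝ} {p : Exponent} {ν : Fin n → ℕ} {j : ℕ}
    (hν : ν ∈ Finset.univ.piAntidiag j) (hj : j ≤ ⌊s⌋₊) (u : 𝓓'(Ω, ℝ)) :
    lpNorm p (deriv ν u) ≤ nonnegNorm s p u := by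
  refine le_trans ?_ le_self_add
  refine le_trans ?_ (Finset.single_le_sum
    (f := fun j => ∑ ν ∈ Finset.univ.piAntidiag j, lpNorm p (deriv ν u)) (fun _ _ => zero_le)
    (Finset.mem_range.2 (Nat.lt_succ_of_le hj)))
  exact Finset.single_le_sum (f := fun ν => lpNorm p (deriv ν u)) (fun _ _ => zero_le) hν

lemma slobodeckij_deriv_le {s : ℝ} {p : Exponent} {ν : Fin n → ℕ}
    (hν : ν ∈ Finset.univ.piAntidiag ⌊s⌋₊) (hs : Int.fract s ≠ 0) (u : 𝓓'(Ω, ℝ)) :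
    slobodeckij (Int.fract s) p (deriv ν u) ≤ nonnegNorm s p u := by
  refine le_trans ?_ le_add_self
  rw [if_neg hs]
  exact Finset.single_le_sum (f := fun ν => slobodeckij (Int.fract s) p (deriv ν u))
    (fun _ _ => zero_le) hν

lemma deriv_zero (u : 𝓓'(Ω, ℝ)) : deriv 0 u = u := by
  have : (deriv (0 : Fin n → ℕ) : Module.End ℝ 𝓓'(Ω, ℝ)) = 1 := by
    refine List.prod_eq_one fun T hT => ?_
    obtain ⟨i, rfl⟩ := (List.mem_ofFn' _ _).1 hT
    exact pow_zero _
  rw [this]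
  rfl

lemma lpNorm_le (s : ℝ) (p : Exponent) (u : 𝓓'(Ω, ℝ)) : lpNorm p u ≤ nonnegNorm s p u := by
  have := lpNorm_deriv_le (p := p) (s := s) (ν := 0) (j := 0) (by simp) (Nat.zero_le _) u
  rwa [deriv_zero] at this

lemma ofFun_apply_eq_setIntegral {g : Rn n → ℝ} {u : 𝓓'(Ω, ℝ)} (h : Represents g u)
    (φ : 𝓓(Ω, ℝ)) : u φ = ∫ x in (Ω : Set (Rn n)), φ x * g x := by
  rw [h.2, ofFun_apply h.1, setIntegral_eq_integral_of_forall_compl_eq_zero]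
  intro x hx
  rw [image_eq_zero_of_notMem_tsupport fun h => hx (φ.tsupport_subset h), zero_mul]

lemma memLp_test (φ : 𝓓(Ω, ℝ)) (q : ℝ≥0∞) (μ : Measure (Rn n)) [IsFiniteMeasureOnCompacts μ] :
    MemLp φ q μ :=
  φ.continuous.memLp_of_hasCompactSupport φ.hasCompactSupport

/-- Evaluation at a test function is bounded in the `L^p` norm. -/
lemma exists_apply_le_lpNorm (p : Exponent) (φ : 𝓓(Ω, ℝ)) :
    ∃ C : ℝ, 0 ≤ C ∧ ∀ u : 𝓓'(Ω, ℝ), lpNorm p u < ∞ → ‖u φ‖ ≤ C * (lpNorm p u).toReal := by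
  set μ := volume.restrict (Ω : Set (Rn n))
  set Φ := (memLp_test φ (ENNReal.ofReal p.conj) μ).toLp
  refine ⟨‖Lp.conjPairing μ (ENNReal.ofReal p.conj) (ENNReal.ofReal p) Φ‖, norm_nonneg _,
    fun u hu => ?_⟩
  obtain ⟨g, hg, hgm⟩ := exists_represents hu
  have h1 := (Lp.conjPairing μ (ENNReal.ofReal p.conj) (ENNReal.ofReal p) Φ).le_opNorm hgm.toLp
  rw [Lp.norm_toLp, ← lpNorm_eq hg, Lp.conjPairing_apply] at h1
  refine le_trans (le_of_eq ?_) h1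
  rw [ofFun_apply_eq_setIntegral hg]
  congr 1
  refine integral_congr_ae ?_
  filter_upwards [hgm.coeFn_toLp, (memLp_test φ (ENNReal.ofReal p.conj) μ).coeFn_toLp] with x h1 h2
  rw [h1, h2]

/-! ### Test functions belong to the Sobolev-Slobodeckij spaces -/

/-- The supremum norm of a test function and its derivative. -/
def supNorm (φ : 𝓓(Ω, ℝ)) : ℝ :=
  ‖TestFunction.toBoundedContinuousFunctionCLM ℝ φ‖ +
    ‖TestFunction.toBoundedContinuousFunctionCLM ℝ
      (TestFunction.fderivCLM ℝ ⊤ ⊤ φ : 𝓓(Ω, Rn n →L[ℝ] ℝ))‖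

lemma continuous_supNorm : Continuous (supNorm : 𝓓(Ω, ℝ) → ℝ) := by
  unfold supNorm
  fun_prop

lemma supNorm_nonneg (φ : 𝓓(Ω, ℝ)) : 0 ≤ supNorm φ := by
  unfold supNorm
  positivity

lemma supNorm_zero : supNorm (0 : 𝓓(Ω, ℝ)) = 0 := by
  unfold supNorm
  rw [map_zero, map_zero, map_zero, norm_zero, norm_zero, add_zero]

lemma norm_apply_le_supNorm (φ : 𝓓(Ω, ℝ)) (x : Rn n) : ‖φ x‖ ≤ supNorm φ :=
  ((TestFunction.toBoundedContinuousFunctionCLM ℝ φ).norm_coe_le_norm x).trans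
    (le_add_of_nonneg_right (norm_nonneg _))

/-- The triangle inequality gives the bound for distant points, the mean value inequality for close
ones. The shape `min 1 ‖x - y‖` matches the kernel of `lintegral_min_kernel_lt_top`. -/
lemma norm_sub_le_supNorm (φ : 𝓓(Ω, ℝ)) (x y : Rn n) :
    ‖φ x - φ y‖ ≤ 2 * supNorm φ * min 1 ‖x - y‖ := by
  have h0 := supNorm_nonneg φ
  rw [mul_min_of_nonneg _ _ (by positivity), mul_one]
  refine le_min ?_ ?_
  · calc ‖φ x - φ y‖ ≤ ‖φ x‖ + ‖φ y‖ := norm_sub_le _ _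
      _ ≤ supNorm φ + supNorm φ :=
        add_le_add (norm_apply_le_supNorm _ _) (norm_apply_le_supNorm _ _)
      _ = _ := by ring
  · have h1 : ∀ z ∈ Set.univ, ‖fderiv ℝ φ z‖ ≤ supNorm φ := by
      intro z _
      have h2 := (TestFunction.toBoundedContinuousFunctionCLM ℝ
        (TestFunction.fderivCLM ℝ ⊤ ⊤ φ : 𝓓(Ω, Rn n →L[ℝ] ℝ))).norm_coe_le_norm z
      have h3 : (TestFunction.toBoundedContinuousFunctionCLM ℝ
        (TestFunction.fderivCLM ℝ ⊤ ⊤ φ : 𝓓(Ω, Rn n →L[ℝ] ℝ))) z = fderiv ℝ φ z := by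
        change (TestFunction.fderivCLM ℝ ⊤ ⊤ φ : 𝓓(Ω, Rn n →L[ℝ] ℝ)) z = _
        rw [TestFunction.fderivCLM_apply_of_le _ (by simp)]
      rw [h3] at h2
      exact h2.trans (le_add_of_nonneg_left (norm_nonneg _))
    have h2 := convex_univ.norm_image_sub_le_of_norm_fderiv_le
      (fun z _ => (φ.contDiff.differentiable (by simp)).differentiableAt) h1
      (Set.mem_univ y) (Set.mem_univ x)
    refine h2.trans ?_
    gcongr
    linarith

lemma lpNorm_test_le (p : Exponent) {K : Set (Rn n)} (hK : IsCompact K) (φ : 𝓓(Ω, ℝ))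
    (hφ : tsupport φ ⊆ K) :
    lpNorm p (ofFun Ω φ) ≤
      volume K ^ (1 / (p : ℝ)) * ENNReal.ofReal (supNorm φ) := by
  rw [lpNorm_eq (represents_test φ)]
  refine (eLpNorm_mono_measure _ Measure.restrict_le_self).trans ?_
  have h : K.indicator φ = φ := by
    refine Set.indicator_eq_self.2 ((subset_tsupport φ).trans hφ)
  rw [← h, eLpNorm_indicator_eq_eLpNorm_restrict hK.measurableSet]
  refine (eLpNorm_le_of_ae_bound
    (Filter.Eventually.of_forall fun x => norm_apply_le_supNorm φ x)).trans ?_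
  rw [Measure.restrict_apply_univ, p.toReal_ofReal, one_div]

/-- The integrand vanishes unless one of the two points lies in `K`, and is otherwise at most `(2
supNorm φ)^p` times the kernel. -/
lemma slobodeckij_test_le {θ : ℝ} (p : Exponent)
    {K : Set (Rn n)} (hK : IsCompact K) (φ : 𝓓(Ω, ℝ)) (hφ : tsupport φ ⊆ K) :
    slobodeckij θ p (ofFun Ω φ) ≤
      (2 * volume K * ∫⁻ z : Rn n, min 1 ‖z‖ₑ ^ (p : ℝ) / ‖z‖ₑ ^ ((n : ℝ) + θ * p)) ^
        (1 / (p : ℝ)) * ENNReal.ofReal (2 * supNorm φ) := by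
  have hp := p.pos
  have hB : ENNReal.ofReal (2 * supNorm φ) =
      (ENNReal.ofReal (2 * supNorm φ) ^ (p : ℝ)) ^ (1 / (p : ℝ)) := by
    rw [← ENNReal.rpow_mul, mul_one_div_cancel hp.ne', ENNReal.rpow_one]
  rw [slobodeckij_eq (represents_test φ), hB, ← ENNReal.mul_rpow_of_nonneg _ _ (by positivity)]
  unfold gagliardo
  gcongr
  rw [← lintegral_indicator_add_mul K hK.measurableSet (by fun_prop), Measure.prod_restrict,
    ← lintegral_mul_const' _ _ (ENNReal.rpow_ne_top_of_nonneg hp.le ENNReal.ofReal_ne_top)]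
  refine (lintegral_mono' Measure.restrict_le_self le_rfl).trans (lintegral_mono fun z => ?_)
  have hle : ‖φ z.1 - φ z.2‖ₑ ≤ ENNReal.ofReal (2 * supNorm φ) * min 1 ‖z.1 - z.2‖ₑ := by
    rw [← ofReal_norm, ← ofReal_norm (z.1 - z.2), ← ENNReal.ofReal_one, ← ENNReal.ofReal_min,
      ← ENNReal.ofReal_mul (by have := supNorm_nonneg φ; positivity)]
    exact ENNReal.ofReal_le_ofReal (norm_sub_le_supNorm φ _ _)
  by_cases hz : z.1 ∈ K ∨ z.2 ∈ K
  · have h1 : (1 : ℝ≥0∞) ≤ K.indicator 1 z.1 + K.indicator 1 z.2 := by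
      rcases hz with hz | hz <;> simp [hz]
    calc ‖φ z.1 - φ z.2‖ₑ ^ (p : ℝ) / ‖z.1 - z.2‖ₑ ^ ((n : ℝ) + θ * p)
        ≤ (ENNReal.ofReal (2 * supNorm φ) * min 1 ‖z.1 - z.2‖ₑ) ^ (p : ℝ) /
          ‖z.1 - z.2‖ₑ ^ ((n : ℝ) + θ * p) := by gcongr
      _ = 1 * (min 1 ‖z.1 - z.2‖ₑ ^ (p : ℝ) / ‖z.1 - z.2‖ₑ ^ ((n : ℝ) + θ * p)) *
          ENNReal.ofReal (2 * supNorm φ) ^ (p : ℝ) := by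
        rw [ENNReal.mul_rpow_of_nonneg _ _ hp.le, mul_div_assoc, mul_comm, one_mul]
      _ ≤ _ := by gcongr
  · push Not at hz
    have h0 : ∀ x ∉ K, φ x = 0 := fun x hx =>
      image_eq_zero_of_notMem_tsupport fun h => hx (hφ h)
    rw [h0 _ hz.1, h0 _ hz.2]
    simp [hp]

/-- A bound by a function `q` that is continuous and zero at `0` makes the inclusion of test
functions supported in `K` continuous at `0`. -/
lemma nonnegNorm_test_le (hn : 0 < n) (s : ℝ) (p : Exponent) {K : Set (Rn n)} (hK : IsCompact K) :
    ∃ q : 𝓓(Ω, ℝ) → ℝ, Continuous q ∧ q 0 = 0 ∧ ∀ φ : 𝓓(Ω, ℝ), tsupport φ ⊆ K →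
      nonnegNorm s p (ofFun Ω φ) ≤ ENNReal.ofReal (q φ) := by
  have h1 : ∀ ν : Fin n → ℕ, ∃ q : 𝓓(Ω, ℝ) → ℝ, Continuous q ∧ q 0 = 0 ∧ (∀ φ, 0 ≤ q φ) ∧
      ∀ φ : 𝓓(Ω, ℝ), tsupport φ ⊆ K →
        lpNorm p (deriv ν (ofFun Ω φ)) ≤ ENNReal.ofReal (q φ) := by
    intro ν
    obtain ⟨A, hA⟩ := exists_deriv_ofFun (Ω := Ω) ν
    refine ⟨fun φ => (volume K ^ (1 / (p : ℝ))).toReal * supNorm (A φ),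
      continuous_const.mul (continuous_supNorm.comp A.continuous), by simp [supNorm_zero],
      fun φ => mul_nonneg ENNReal.toReal_nonneg (supNorm_nonneg _), fun φ hφ => ?_⟩
    rw [(hA φ).1]
    refine (lpNorm_test_le p hK (A φ) ((hA φ).2.trans hφ)).trans_eq ?_
    rw [ENNReal.ofReal_mul ENNReal.toReal_nonneg, ENNReal.ofReal_toReal]
    exact ENNReal.rpow_ne_top_of_nonneg (by have := p.pos; positivity) hK.measure_lt_top.ne
  have h2 : ∀ ν : Fin n → ℕ, ∃ q : 𝓓(Ω, ℝ) → ℝ, Continuous q ∧ q 0 = 0 ∧ (∀ φ, 0 ≤ q φ) ∧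
      (Int.fract s ≠ 0 → ∀ φ : 𝓓(Ω, ℝ), tsupport φ ⊆ K →
        slobodeckij (Int.fract s) p (deriv ν (ofFun Ω φ)) ≤ ENNReal.ofReal (q φ)) := by
    intro ν
    by_cases hs : Int.fract s = 0
    · exact ⟨0, continuous_const, rfl, fun _ => le_rfl, fun h => absurd hs h⟩
    obtain ⟨A, hA⟩ := exists_deriv_ofFun (Ω := Ω) ν
    refine ⟨fun φ => ((2 * volume K * ∫⁻ z : Rn n, min 1 ‖z‖ₑ ^ (p : ℝ) /
        ‖z‖ₑ ^ ((n : ℝ) + Int.fract s * p)) ^ (1 / (p : ℝ))).toReal * (2 * supNorm (A φ)),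
      continuous_const.mul (continuous_const.mul (continuous_supNorm.comp A.continuous)),
      by simp [supNorm_zero],
      fun φ => mul_nonneg ENNReal.toReal_nonneg (mul_nonneg zero_le_two (supNorm_nonneg _)),
      fun _ φ hφ => ?_⟩
    rw [(hA φ).1]
    refine (slobodeckij_test_le p hK (A φ) ((hA φ).2.trans hφ)).trans_eq ?_
    rw [ENNReal.ofReal_mul ENNReal.toReal_nonneg, ENNReal.ofReal_toReal]
    refine ENNReal.rpow_ne_top_of_nonneg (by have := p.pos; positivity) ?_
    refine ENNReal.mul_ne_top (ENNReal.mul_ne_top (by simp) hK.measure_lt_top.ne) ?_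
    exact (lintegral_min_kernel_lt_top hn ((Int.fract_nonneg s).lt_of_ne' hs)
      (Int.fract_lt_one s) p).ne
  choose q₁ hc₁ hz₁ hp₁ hq₁ using h1
  choose q₂ hc₂ hz₂ hp₂ hq₂ using h2
  refine ⟨fun φ => (∑ j ∈ Finset.range (⌊s⌋₊ + 1), ∑ ν ∈ Finset.univ.piAntidiag j, q₁ ν φ) +
    ∑ ν ∈ Finset.univ.piAntidiag ⌊s⌋₊, q₂ ν φ, ?_, ?_, fun φ hφ => ?_⟩
  · fun_prop
  · simp [hz₁, hz₂]
  · have e1 := fun j : ℕ => Finset.sum_nonneg fun (ν : Fin n → ℕ)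
      (_ : ν ∈ Finset.univ.piAntidiag j) => hp₁ ν φ
    rw [ENNReal.ofReal_add (Finset.sum_nonneg fun j _ => e1 j)
      (Finset.sum_nonneg fun ν _ => hp₂ ν φ), ENNReal.ofReal_sum_of_nonneg fun j _ => e1 j]
    unfold nonnegNorm
    gcongr with j hj
    · rw [ENNReal.ofReal_sum_of_nonneg fun ν _ => hp₁ ν φ]
      exact Finset.sum_le_sum fun ν _ => hq₁ ν φ hφ
    · split_ifs with hs
      · exact zero_le
      · rw [ENNReal.ofReal_sum_of_nonneg fun ν _ => hp₂ ν φ]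
        exact Finset.sum_le_sum fun ν _ => hq₂ ν hs φ hφ

lemma test_mem_nonneg (hn : 0 < n) (s : ℝ) (p : Exponent) (φ : 𝓓(Ω, ℝ)) :
    ofFun Ω φ ∈ (nonneg Ω s p).finite := by
  obtain ⟨q, -, -, hq⟩ := nonnegNorm_test_le (Ω := Ω) hn s p φ.hasCompactSupport
  exact (hq φ subset_rfl).trans_lt ENNReal.ofReal_lt_top

/-- The inclusion of the test functions in `W^{s,p}(Ω)`, `s ≥ 0`, as a linear map. -/
def testNonnegₗ (hn : 0 < n) (s : ℝ) (p : Exponent) : 𝓓(Ω, ℝ) →ₗ[ℝ] (nonneg Ω s p).Space where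
  toFun φ := ⟨ofFun Ω φ, test_mem_nonneg hn s p φ⟩
  map_add' φ ψ := Subtype.ext (map_add (ofTest Ω) φ ψ)
  map_smul' c φ := Subtype.ext (map_smul (ofTest Ω) c φ)

/-- This continuity is what makes a functional on `W^{s,p}_0(Ω)` restrict to a distribution. For a
linear map on an LF space it suffices to work with supports in a fixed compact set. -/
lemma continuous_testNonnegₗ (hn : 0 < n) (s : ℝ) (p : Exponent) :
    Continuous (testNonnegₗ (Ω := Ω) hn s p) := by
  rw [TestFunction.continuous_iff_continuous_comp]
  intro K hK
  obtain ⟨q, hqc, hq0, hq⟩ := nonnegNorm_test_le (Ω := Ω) hn s p K.isCompact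
  have hι := TestFunction.continuous_ofSupportedIn (n := ⊤) (F := ℝ) hK
  let f := testNonnegₗ (Ω := Ω) hn s p ∘ₗ
    (TestFunction.ofSupportedInCLM (n := ⊤) (F := ℝ) ℝ hK).toLinearMap
  change Continuous f
  refine continuous_of_continuousAt_zero f ?_
  rw [ContinuousAt, map_zero, tendsto_zero_iff_norm_tendsto_zero]
  have h1 : Filter.Tendsto (fun φ => max (q (TestFunction.ofSupportedIn hK φ)) 0)
      (nhds 0) (nhds 0) := by
    have h2 := ((hqc.comp hι).max (continuous_const (y := (0 : ℝ)))).tendsto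
      (0 : 𝓓^{⊤}_{K}(Rn n, ℝ))
    have h3 : TestFunction.ofSupportedIn hK (0 : 𝓓^{⊤}_{K}(Rn n, ℝ)) = (0 : 𝓓(Ω, ℝ)) := rfl
    simpa [h3, hq0] using h2
  refine squeeze_zero (fun _ => norm_nonneg _) (fun φ => ?_) h1
  rw [ExtNorm.norm_def, ← ENNReal.toReal_ofReal']
  exact ENNReal.toReal_mono ENNReal.ofReal_ne_top
    (hq (TestFunction.ofSupportedIn hK φ) φ.tsupport_subset)

/-- The inclusion of the test functions in `W^{s,p}(Ω)`, `s ≥ 0`. -/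
def testNonneg (hn : 0 < n) (s : ℝ) (p : Exponent) : 𝓓(Ω, ℝ) →L[ℝ] (nonneg Ω s p).Space :=
  ⟨testNonnegₗ hn s p, continuous_testNonnegₗ hn s p⟩

/-- Evaluation at a test function is continuous on `W^{s,p}(Ω)`, `s ≥ 0`. -/
lemma exists_apply_le_nonneg (s : ℝ) (p : Exponent) (φ : 𝓓(Ω, ℝ)) :
    ∃ C : ℝ, 0 ≤ C ∧ ∀ u : (nonneg Ω s p).Space, ‖u.dist φ‖ ≤ C * ‖u‖ := by
  obtain ⟨C, hC0, hC⟩ := exists_apply_le_lpNorm p φ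
  refine ⟨C, hC0, fun u => ?_⟩
  have h : nonnegNorm s p u.dist < ∞ := u.2
  have h1 := lpNorm_le s p u.dist
  refine (hC u.dist (h1.trans_lt h)).trans ?_
  gcongr
  exact ENNReal.toReal_mono h.ne h1

end SobolevSlobodeckij
end

noncomputable section

namespace SobolevSlobodeckij

variable {n : ℕ} {Ω : Opens (Rn n)}

/-! ### Reflexivity of `W^{s,p}(Ω)`, `s ≥ 0` -/

/-- The difference quotient `(g(x) - g(y)) / |x - y|^{n / p + θ}`. -/
def diffQuot (θ : ℝ) (p : Exponent) (g : Rn n → ℝ) (z : Rn n × Rn n) : ℝ :=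
  (g z.1 - g z.2) / ‖z.1 - z.2‖ ^ (((n : ℝ) + θ * p) / p)

/-- Writing the Slobodeckij seminorm as an `L^p` norm on `Ω × Ω` allows `W^{s,p}(Ω)` to be embedded
in a product of `L^p` spaces. -/
lemma eLpNorm_diffQuot (θ : ℝ) (hθ : 0 ≤ θ) (p : Exponent) (g : Rn n → ℝ) :
    eLpNorm (diffQuot θ p g) (ENNReal.ofReal p)
      ((volume.restrict (Ω : Set (Rn n))).prod (volume.restrict (Ω : Set (Rn n)))) =
      gagliardo Ω θ p g := by
  have hp := p.pos
  rw [eLpNorm_eq_lintegral_rpow_enorm_toReal p.ofReal_ne_zero ENNReal.ofReal_ne_top,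
    p.toReal_ofReal, gagliardo]
  congr 1
  refine lintegral_congr fun z => ?_
  rcases eq_or_ne z.1 z.2 with h | h
  · simp [diffQuot, h, hp]
  · have hz : 0 < ‖z.1 - z.2‖ := norm_pos_iff.2 (sub_ne_zero.2 h)
    have he : 0 ≤ (n : ℝ) + θ * p := by positivity
    have h1 : ‖‖z.1 - z.2‖ ^ (((n : ℝ) + θ * p) / p)‖ₑ =
        ‖z.1 - z.2‖ₑ ^ (((n : ℝ) + θ * p) / p) := by
      rw [← ofReal_norm, Real.norm_of_nonneg (by positivity), ← ofReal_norm (z.1 - z.2),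
        ENNReal.ofReal_rpow_of_nonneg (norm_nonneg _) (by positivity)]
    rw [diffQuot, div_eq_mul_inv, enorm_mul, enorm_inv (by positivity), h1, ← div_eq_mul_inv,
      ENNReal.div_rpow_of_nonneg _ _ hp.le, ← ENNReal.rpow_mul, div_mul_cancel₀ _ hp.ne']

lemma aestronglyMeasurable_diffQuot (θ : ℝ) (p : Exponent) {μ : Measure (Rn n)} [SFinite μ]
    {g : Rn n → ℝ} (hg : AEStronglyMeasurable g μ) :
    AEStronglyMeasurable (diffQuot θ p g) (μ.prod μ) := by
  have hm : Measurable fun z : Rn n × Rn n => (‖z.1 - z.2‖ ^ (((n : ℝ) + θ * p) / p))⁻¹ := by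
    fun_prop
  exact (hg.comp_fst.sub hg.comp_snd).mul hm.aestronglyMeasurable

lemma diffQuot_congr {θ : ℝ} {p : Exponent} {μ : Measure (Rn n)} [SFinite μ] {g g' : Rn n → ℝ}
    (h : g =ᵐ[μ] g') : diffQuot θ p g =ᵐ[μ.prod μ] diffQuot θ p g' := by
  filter_upwards [Measure.quasiMeasurePreserving_fst.ae h,
    Measure.quasiMeasurePreserving_snd.ae h] with z h1 h2
  rw [diffQuot, diffQuot, h1, h2]

lemma diffQuot_add (θ : ℝ) (p : Exponent) (g g' : Rn n → ℝ) :
    diffQuot θ p (g + g') = diffQuot θ p g + diffQuot θ p g' := by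
  ext z
  simp only [diffQuot, Pi.add_apply]
  ring

lemma diffQuot_smul (θ : ℝ) (p : Exponent) (c : ℝ) (g : Rn n → ℝ) :
    diffQuot θ p (c • g) = c • diffQuot θ p g := by
  ext z
  simp only [diffQuot, Pi.smul_apply, smul_eq_mul]
  ring

/-- The difference quotient is a closed operator. -/
lemma diffQuot_ae_eq_of_tendsto {θ : ℝ} {p : Exponent} {μ : Measure (Rn n)} [SFinite μ]
    {f : ℕ → Lp ℝ (ENNReal.ofReal p) μ} {F : ℕ → Lp ℝ (ENNReal.ofReal p) (μ.prod μ)}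
    {a : Lp ℝ (ENNReal.ofReal p) μ} {b : Lp ℝ (ENNReal.ofReal p) (μ.prod μ)}
    (hF : ∀ j, F j =ᵐ[μ.prod μ] diffQuot θ p (f j))
    (hf : Filter.Tendsto f Filter.atTop (nhds a)) (hb : Filter.Tendsto F Filter.atTop (nhds b)) :
    diffQuot θ p a =ᵐ[μ.prod μ] b := by
  -- Two successive subsequences converge almost everywhere, and the difference quotient passes to
  -- pointwise limits.
  obtain ⟨i, hi, hia⟩ := (tendstoInMeasure_of_tendsto_Lp hf).exists_seq_tendsto_ae
  have hb' : Filter.Tendsto (fun j => F (i j)) Filter.atTop (nhds b) :=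
    hb.comp hi.tendsto_atTop
  obtain ⟨i', hi', hib⟩ := (tendstoInMeasure_of_tendsto_Lp hb').exists_seq_tendsto_ae
  filter_upwards [Measure.quasiMeasurePreserving_fst.ae hia,
    Measure.quasiMeasurePreserving_snd.ae hia, hib, ae_all_iff.2 hF] with z h1 h2 h3 h4
  refine tendsto_nhds_unique ?_ h3
  simp only [h4]
  exact ((h1.comp hi'.tendsto_atTop).sub (h2.comp hi'.tendsto_atTop)).div_const _

lemma locallyIntegrableOn_Lp {p : Exponent}
    (g : Lp ℝ (ENNReal.ofReal p) (volume.restrict (Ω : Set (Rn n)))) :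
    LocallyIntegrableOn g Ω := by
  have h := (Lp.memLp g).locallyIntegrable (Fact.out : 1 ≤ ENNReal.ofReal p)
  intro x _
  obtain ⟨t, ht, hgt⟩ := h x
  refine ⟨t ∩ Ω, Filter.inter_mem (mem_nhdsWithin_of_mem_nhds ht) self_mem_nhdsWithin, ?_⟩
  rwa [IntegrableOn, Measure.restrict_restrict' Ω.isOpen.measurableSet] at hgt

lemma exists_Lp_represents {u : 𝓓'(Ω, ℝ)} {p : Exponent} (h : lpNorm p u < ∞) :
    ∃ g : Lp ℝ (ENNReal.ofReal p) (volume.restrict (Ω : Set (Rn n))), Represents g u := by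
  obtain ⟨g, hg, hgm⟩ := exists_represents h
  exact ⟨hgm.toLp, hg.congr_ae hgm.coeFn_toLp.symm⟩

lemma Represents.Lp_unique {u : 𝓓'(Ω, ℝ)} {p : Exponent}
    {g g' : Lp ℝ (ENNReal.ofReal p) (volume.restrict (Ω : Set (Rn n)))} (h : Represents g u)
    (h' : Represents g' u) : g = g' :=
  Lp.ext (h.ae_eq h')

lemma represents_Lp_add {u v : 𝓓'(Ω, ℝ)} {p : Exponent}
    {g g' : Lp ℝ (ENNReal.ofReal p) (volume.restrict (Ω : Set (Rn n)))} (h : Represents g u)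
    (h' : Represents g' v) : Represents (g + g' : Lp ℝ (ENNReal.ofReal p) _) (u + v) :=
  (h.add h').congr_ae (Lp.coeFn_add g g').symm

lemma represents_Lp_smul {u : 𝓓'(Ω, ℝ)} {p : Exponent}
    {g : Lp ℝ (ENNReal.ofReal p) (volume.restrict (Ω : Set (Rn n)))} (h : Represents g u)
    (c : ℝ) : Represents (c • g : Lp ℝ (ENNReal.ofReal p) _) (c • u) :=
  (h.smul c).congr_ae (Lp.coeFn_smul c g).symm

/-- The multi-indices of order at most `⌊s⌋`. -/
def lpIndices (n : ℕ) (s : ℝ) : Finset (Fin n → ℕ) :=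
  (Finset.range (⌊s⌋₊ + 1)).biUnion fun j => Finset.univ.piAntidiag j

/-- The multi-indices of order `⌊s⌋`, if `s` is not an integer. -/
def slobodeckijIndices (n : ℕ) (s : ℝ) : Finset (Fin n → ℕ) :=
  if Int.fract s = 0 then ∅ else Finset.univ.piAntidiag ⌊s⌋₊

lemma zero_mem_lpIndices (s : ℝ) : (0 : Fin n → ℕ) ∈ lpIndices n s :=
  Finset.mem_biUnion.2 ⟨0, by simp, by simp⟩

lemma lpNorm_deriv_le_of_mem {s : ℝ} {p : Exponent} {ν : Fin n → ℕ} (hν : ν ∈ lpIndices n s)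
    (u : 𝓓'(Ω, ℝ)) : lpNorm p (deriv ν u) ≤ nonnegNorm s p u := by
  obtain ⟨j, hj, hν⟩ := Finset.mem_biUnion.1 hν
  exact lpNorm_deriv_le hν (Nat.lt_succ_iff.1 (Finset.mem_range.1 hj)) u

lemma slobodeckijIndices_subset (n : ℕ) (s : ℝ) : slobodeckijIndices n s ⊆ lpIndices n s := by
  intro ν hν
  unfold slobodeckijIndices at hν
  split_ifs at hν with h
  · simp at hν
  · exact Finset.mem_biUnion.2 ⟨⌊s⌋₊, by simp, hν⟩

lemma slobodeckij_deriv_le_of_mem {s : ℝ} {p : Exponent} {ν : Fin n → ℕ}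
    (hν : ν ∈ slobodeckijIndices n s) (u : 𝓓'(Ω, ℝ)) :
    slobodeckij (Int.fract s) p (deriv ν u) ≤ nonnegNorm s p u := by
  unfold slobodeckijIndices at hν
  split_ifs at hν with h
  · simp at hν
  · exact slobodeckij_deriv_le hν h u

/-- The constant counts the summands of the norm. It compares this sum with the maximum norm of
`LpProd`. -/
lemma nonnegNorm_le_mul {s : ℝ} {p : Exponent} {u : 𝓓'(Ω, ℝ)} {B : ℝ≥0∞}
    (h1 : ∀ ν ∈ lpIndices n s, lpNorm p (deriv ν u) ≤ B)
    (h2 : ∀ ν ∈ slobodeckijIndices n s, slobodeckij (Int.fract s) p (deriv ν u) ≤ B) :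
    nonnegNorm s p u ≤ ((∑ j ∈ Finset.range (⌊s⌋₊ + 1),
      ((Finset.univ : Finset (Fin n)).piAntidiag j).card +
        (slobodeckijIndices n s).card : ℕ) : ℝ≥0∞) * B := by
  unfold nonnegNorm
  push_cast
  rw [add_mul, Finset.sum_mul]
  gcongr with j hj
  · rw [← nsmul_eq_mul]
    exact Finset.sum_le_card_nsmul _ _ _ fun ν hν => h1 ν (Finset.mem_biUnion.2 ⟨j, hj, hν⟩)
  · unfold slobodeckijIndices at *
    split_ifs with h
    · exact zero_le
    · rw [← nsmul_eq_mul]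
      exact Finset.sum_le_card_nsmul _ _ _ fun ν hν => h2 ν (by rwa [if_neg h])

/-- The product of `L^p` spaces in which `W^{s,p}(Ω)` is embedded by its derivatives and their
difference quotients. -/
abbrev LpProd (Ω : Opens (Rn n)) (s : ℝ) (p : Exponent) : Type :=
  (lpIndices n s → Lp ℝ (ENNReal.ofReal p) (volume.restrict (Ω : Set (Rn n)))) ×
  (slobodeckijIndices n s → Lp ℝ (ENNReal.ofReal p)
    ((volume.restrict (Ω : Set (Rn n))).prod (volume.restrict (Ω : Set (Rn n)))))

/-- `e ∈ LpProd Ω s p` consists of the derivatives of `u` and their difference quotients. -/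
def IsJet {s : ℝ} {p : Exponent} (u : 𝓓'(Ω, ℝ)) (e : LpProd Ω s p) : Prop :=
  (∀ ν, Represents (e.1 ν) (deriv ν u)) ∧ ∀ ν : slobodeckijIndices n s,
    e.2 ν =ᵐ[(volume.restrict (Ω : Set (Rn n))).prod (volume.restrict (Ω : Set (Rn n)))]
      diffQuot (Int.fract s) p (e.1 ⟨ν, slobodeckijIndices_subset n s ν.2⟩)

lemma IsJet.slobodeckij_eq {s : ℝ} {p : Exponent} {u : 𝓓'(Ω, ℝ)} {e : LpProd Ω s p}
    (h : IsJet u e) (ν : slobodeckijIndices n s) :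
    slobodeckij (Int.fract s) p (deriv ν u) = ‖e.2 ν‖ₑ := by
  rw [SobolevSlobodeckij.slobodeckij_eq (h.1 ⟨ν, slobodeckijIndices_subset n s ν.2⟩),
    ← eLpNorm_diffQuot _ (Int.fract_nonneg s), ← eLpNorm_congr_ae (h.2 ν), Lp.enorm_def]

lemma IsJet.lpNorm_eq {s : ℝ} {p : Exponent} {u : 𝓓'(Ω, ℝ)} {e : LpProd Ω s p}
    (h : IsJet u e) (ν : lpIndices n s) : lpNorm p (deriv ν u) = ‖e.1 ν‖ₑ := by
  rw [SobolevSlobodeckij.lpNorm_eq (h.1 ν), Lp.enorm_def]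

lemma IsJet.enorm_le {s : ℝ} {p : Exponent} {u : 𝓓'(Ω, ℝ)} {e : LpProd Ω s p}
    (h : IsJet u e) (hu : nonnegNorm s p u < ∞) : ‖e‖ ≤ (nonnegNorm s p u).toReal := by
  have key : ∀ {x : ℝ≥0∞} {r : ℝ}, x ≤ nonnegNorm s p u → x.toReal = r →
      r ≤ (nonnegNorm s p u).toReal := by
    rintro x r hx rfl
    exact ENNReal.toReal_mono hu.ne hx
  refine norm_prod_le_iff.2 ⟨(pi_norm_le_iff_of_nonneg ENNReal.toReal_nonneg).2 fun ν => ?_,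
    (pi_norm_le_iff_of_nonneg ENNReal.toReal_nonneg).2 fun ν => ?_⟩
  · exact key (lpNorm_deriv_le_of_mem ν.2 u) (by rw [h.lpNorm_eq, toReal_enorm])
  · exact key (slobodeckij_deriv_le_of_mem ν.2 u) (by rw [h.slobodeckij_eq, toReal_enorm])

lemma IsJet.nonnegNorm_le {s : ℝ} {p : Exponent} {u : 𝓓'(Ω, ℝ)} {e : LpProd Ω s p}
    (h : IsJet u e) : nonnegNorm s p u ≤ ((∑ j ∈ Finset.range (⌊s⌋₊ + 1),
      ((Finset.univ : Finset (Fin n)).piAntidiag j).card +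
        (slobodeckijIndices n s).card : ℕ) : ℝ≥0∞) * ‖e‖ₑ := by
  have key : ∀ {x : ℝ≥0∞} {r : ℝ}, r ≤ ‖e‖ → x = ENNReal.ofReal r → x ≤ ‖e‖ₑ := by
    rintro x r hr rfl
    rw [← ofReal_norm]
    exact ENNReal.ofReal_le_ofReal hr
  refine nonnegNorm_le_mul (fun ν hν => ?_) fun ν hν => ?_
  · exact key ((norm_le_pi_norm e.1 ⟨ν, hν⟩).trans (norm_fst_le e))
      (by rw [h.lpNorm_eq ⟨ν, hν⟩, ofReal_norm])
  · exact key ((norm_le_pi_norm e.2 ⟨ν, hν⟩).trans (norm_snd_le e))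
      (by rw [h.slobodeckij_eq ⟨ν, hν⟩, ofReal_norm])

lemma IsJet.dist_eq {s : ℝ} {p : Exponent} {u : 𝓓'(Ω, ℝ)} {e : LpProd Ω s p}
    (h : IsJet u e) : u = ofFun Ω (e.1 ⟨0, zero_mem_lpIndices s⟩) := by
  have := (h.1 ⟨0, zero_mem_lpIndices s⟩).2
  rwa [deriv_zero] at this

/-- Uniqueness makes the choice of a jet for each `u` linear in `u`. -/
lemma IsJet.unique {s : ℝ} {p : Exponent} {u : 𝓓'(Ω, ℝ)} {e e' : LpProd Ω s p}
    (h : IsJet u e) (h' : IsJet u e') : e = e' := by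
  have h1 : ∀ ν, e.1 ν = e'.1 ν := fun ν => (h.1 ν).Lp_unique (h'.1 ν)
  refine Prod.ext (funext h1) (funext fun ν => Lp.ext ?_)
  refine (h.2 ν).trans (Filter.EventuallyEq.trans ?_ (h'.2 ν).symm)
  rw [h1]

lemma IsJet.add {s : ℝ} {p : Exponent} {u v : 𝓓'(Ω, ℝ)} {e e' : LpProd Ω s p}
    (h : IsJet u e) (h' : IsJet v e') : IsJet (u + v) (e + e') := by
  refine ⟨fun ν => ?_, fun ν => ?_⟩
  · rw [map_add]
    exact represents_Lp_add (h.1 ν) (h'.1 ν)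
  · refine (Lp.coeFn_add _ _).trans (((h.2 ν).add (h'.2 ν)).trans ?_)
    rw [← diffQuot_add]
    exact diffQuot_congr (Lp.coeFn_add _ _).symm

lemma IsJet.smul {s : ℝ} {p : Exponent} {u : 𝓓'(Ω, ℝ)} {e : LpProd Ω s p}
    (h : IsJet u e) (c : ℝ) : IsJet (c • u) (c • e) := by
  refine ⟨fun ν => ?_, fun ν => ?_⟩
  · rw [map_smul]
    exact represents_Lp_smul (h.1 ν) c
  · refine (Lp.coeFn_smul _ _).trans (((h.2 ν).const_smul c).trans ?_)
    rw [← diffQuot_smul]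
    exact diffQuot_congr (Lp.coeFn_smul _ _).symm

lemma exists_isJet {s : ℝ} {p : Exponent} {u : 𝓓'(Ω, ℝ)} (hu : nonnegNorm s p u < ∞) :
    ∃ e : LpProd Ω s p, IsJet u e := by
  have h1 : ∀ ν : lpIndices n s, ∃ g : Lp ℝ (ENNReal.ofReal p) (volume.restrict (Ω : Set (Rn n))),
      Represents g (deriv ν u) := fun ν =>
    exists_Lp_represents ((lpNorm_deriv_le_of_mem ν.2 u).trans_lt hu)
  choose g hg using h1
  have h2 : ∀ ν : slobodeckijIndices n s, MemLp
      (diffQuot (Int.fract s) p (g ⟨ν, slobodeckijIndices_subset n s ν.2⟩)) (ENNReal.ofReal p)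
      ((volume.restrict (Ω : Set (Rn n))).prod (volume.restrict (Ω : Set (Rn n)))) := by
    intro ν
    refine ⟨aestronglyMeasurable_diffQuot _ _ (Lp.aestronglyMeasurable _), ?_⟩
    rw [eLpNorm_diffQuot _ (Int.fract_nonneg s), ← slobodeckij_eq (hg _)]
    exact (slobodeckij_deriv_le_of_mem ν.2 u).trans_lt hu
  exact ⟨(g, fun ν => (h2 ν).toLp), hg, fun ν => (h2 ν).coeFn_toLp⟩

/-- Jets are closed under limits. -/
lemma IsJet.of_tendsto {s : ℝ} {p : Exponent} {u : ℕ → 𝓓'(Ω, ℝ)} {e : ℕ → LpProd Ω s p}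
    {e₀ : LpProd Ω s p} (h : ∀ j, IsJet (u j) (e j))
    (he : Filter.Tendsto e Filter.atTop (nhds e₀)) :
    ∃ u₀ : 𝓓'(Ω, ℝ), IsJet u₀ e₀ := by
  set μ := volume.restrict (Ω : Set (Rn n)) with hμ
  have he1 : ∀ ν, Filter.Tendsto (fun j => (e j).1 ν) Filter.atTop (nhds (e₀.1 ν)) := fun ν =>
    ((continuous_apply ν).comp continuous_fst).continuousAt.tendsto.comp he
  have he2 : ∀ ν, Filter.Tendsto (fun j => (e j).2 ν) Filter.atTop (nhds (e₀.2 ν)) := fun ν =>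
    ((continuous_apply ν).comp continuous_snd).continuousAt.tendsto.comp he
  have hr : ∀ ν, Represents (e₀.1 ν) (ofFun Ω (e₀.1 ν)) := fun ν =>
    ⟨locallyIntegrableOn_Lp _, rfl⟩
  -- Pairing with a test function is continuous on `L^p`, so the derivatives converge as
  -- distributions. Their limits are the derivatives of the limit, since `deriv ν` is the adjoint of
  -- an operator on test functions.
  have hlim : ∀ (ν : lpIndices n s) (φ : 𝓓(Ω, ℝ)), Filter.Tendsto (fun j => deriv (ν : Fin n → ℕ) (u j) φ) Filter.atTop
      (nhds (ofFun Ω (e₀.1 ν) φ)) := by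
    intro ν φ
    set Φ := (memLp_test φ (ENNReal.ofReal p.conj) μ).toLp
    have h1 : ∀ (g : Lp ℝ (ENNReal.ofReal p) μ) (v : 𝓓'(Ω, ℝ)), Represents g v →
        v φ = Lp.conjPairing μ (ENNReal.ofReal p.conj) (ENNReal.ofReal p) Φ g := by
      intro g v hg
      rw [ofFun_apply_eq_setIntegral hg, Lp.conjPairing_apply]
      refine integral_congr_ae ?_
      filter_upwards [(memLp_test φ (ENNReal.ofReal p.conj) μ).coeFn_toLp] with x h2
      rw [h2]
    rw [h1 _ _ (hr ν)]
    simp only [fun j => h1 _ _ ((h j).1 ν)]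
    exact (ContinuousLinearMap.continuous _).continuousAt.tendsto.comp (he1 ν)
  refine ⟨ofFun Ω (e₀.1 ⟨0, zero_mem_lpIndices s⟩), fun ν => ⟨(hr ν).1, ?_⟩, fun ν => ?_⟩
  · ext φ
    obtain ⟨A, hA⟩ := exists_deriv_adjoint (Ω := Ω) (ν : Fin n → ℕ)
    rw [hA]
    refine tendsto_nhds_unique (hlim _ _) ?_
    simp only [deriv_zero]
    refine (hlim ν φ).congr fun j => ?_
    rw [hA]
  · exact (diffQuot_ae_eq_of_tendsto (fun j => (h j).2 ν) (he1 _) (he2 ν)).symm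

/-- The embedding of `W^{s,p}(Ω)` in a product of `L^p` spaces, as a linear map. -/
def jetₗ (Ω : Opens (Rn n)) (s : ℝ) (p : Exponent) : (nonneg Ω s p).Space →ₗ[ℝ] LpProd Ω s p where
  toFun u := (exists_isJet u.2).choose
  map_add' u v := (exists_isJet (u + v).2).choose_spec.unique
    ((exists_isJet u.2).choose_spec.add (exists_isJet v.2).choose_spec)
  map_smul' c u := (exists_isJet (c • u).2).choose_spec.unique
    ((exists_isJet u.2).choose_spec.smul c)

lemma isJet_jetₗ {s : ℝ} {p : Exponent} (u : (nonneg Ω s p).Space) :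
    IsJet u.dist (jetₗ Ω s p u) :=
  (exists_isJet u.2).choose_spec

/-- The embedding of `W^{s,p}(Ω)` in a product of `L^p` spaces. -/
def jet (Ω : Opens (Rn n)) (s : ℝ) (p : Exponent) : (nonneg Ω s p).Space →L[ℝ] LpProd Ω s p :=
  (jetₗ Ω s p).mkContinuous 1 fun u => by
    rw [one_mul]
    exact (isJet_jetₗ u).enorm_le u.2

lemma isJet_jet {s : ℝ} {p : Exponent} (u : (nonneg Ω s p).Space) : IsJet u.dist (jet Ω s p u) :=
  isJet_jetₗ u

/-- The jet map is bounded below and has closed range in a reflexive product of `L^p` spaces. -/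
lemma bidualSurjective_nonneg (Ω : Opens (Rn n)) (s : ℝ) (p : Exponent) :
    BidualSurjective (nonneg Ω s p).Space := by
  have hE : BidualSurjective (LpProd Ω s p) :=
    .prod (.pi fun _ => bidualSurjective_Lp _ p) (.pi fun _ => bidualSurjective_Lp _ p)
  refine hE.of_closed_range (jet Ω s p) (fun u v h => ?_)
    (((∑ j ∈ Finset.range (⌊s⌋₊ + 1), ((Finset.univ : Finset (Fin n)).piAntidiag j).card +
      (slobodeckijIndices n s).card : ℕ) : ℝ≥0∞).toReal) (fun u => ?_)
    (isClosed_of_closure_subset fun e he => ?_)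
  · refine Subtype.ext ?_
    change u.dist = v.dist
    rw [(isJet_jet u).dist_eq, (isJet_jet v).dist_eq, h]
  · have h := ENNReal.toReal_mono (ENNReal.mul_ne_top (by simp) (by simp))
      (isJet_jet u).nonnegNorm_le
    rw [ENNReal.toReal_mul, toReal_enorm] at h
    exact h
  · obtain ⟨x, hx, hxe⟩ := mem_closure_iff_seq_limit.1 he
    choose u hu using hx
    have h : ∀ j, IsJet (u j).dist (x j) := fun j => hu j ▸ isJet_jet (u j)
    obtain ⟨u₀, hu₀⟩ := IsJet.of_tendsto h hxe
    have hfin : u₀ ∈ (nonneg Ω s p).finite :=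
      hu₀.nonnegNorm_le.trans_lt (ENNReal.mul_lt_top (by simp) (by simp))
    exact ⟨⟨u₀, hfin⟩, (isJet_jet (s := s) (p := p) ⟨u₀, hfin⟩).unique hu₀⟩

/-- The inclusion of `N.Space0` in `N.Space` as a continuous linear map. -/
def ExtNorm.Space0.toSpaceL {N : ExtNorm Ω} : N.Space0 →L[ℝ] N.Space := N.closureTest.subtypeL

lemma bidualSurjective_nonneg_Space0 (Ω : Opens (Rn n)) (s : ℝ) (p : Exponent) :
    BidualSurjective (nonneg Ω s p).Space0 := by
  refine (bidualSurjective_nonneg Ω s p).of_closed_range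
    (ExtNorm.Space0.toSpaceL : (nonneg Ω s p).Space0 →L[ℝ] (nonneg Ω s p).Space) Subtype.val_injective 1 (fun u => ?_) ?_
  · rw [one_mul]
    rfl
  · have : Set.range (ExtNorm.Space0.toSpaceL : (nonneg Ω s p).Space0 →L[ℝ] (nonneg Ω s p).Space) =
        ((nonneg Ω s p).closureTest : Set (nonneg Ω s p).Space) := Subtype.range_coe
    rw [this]
    exact Submodule.isClosed_topologicalClosure _

end SobolevSlobodeckij
end

/-! ### Weak limits and averages over translates -/

noncomputable section

/-- In a reflexive space a bounded sequence has a weak cluster point. -/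
lemma BidualSurjective.exists_weak_limit {E : Type*} [SeminormedAddCommGroup E] [NormedSpace ℝ E]
    (hE : BidualSurjective E) (x : ℕ → E) {B : ℝ} (hB : ∀ j, ‖x j‖ ≤ B) :
    ∃ y : E, ∀ (F : StrongDual ℝ E) (a : ℝ),
      Filter.Tendsto (fun j => F (x j)) Filter.atTop (nhds a) → F y = a := by
  let J : ℕ → WeakDual ℝ (StrongDual ℝ E) := fun j =>
    StrongDual.toWeakDual (NormedSpace.inclusionInDoubleDual ℝ E (x j))
  have hc := WeakDual.isCompact_closedBall (𝕜 := ℝ) (0 : StrongDual ℝ (StrongDual ℝ E)) B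
  have hJ : ∀ j, J j ∈ WeakDual.toStrongDual ⁻¹' Metric.closedBall
      (0 : StrongDual ℝ (StrongDual ℝ E)) B := by
    intro j
    change NormedSpace.inclusionInDoubleDual ℝ E (x j) ∈ Metric.closedBall _ _
    refine (mem_closedBall_zero_iff (E := StrongDual ℝ (StrongDual ℝ E))).2 ?_
    exact (NormedSpace.double_dual_bound ℝ E (x j)).trans (hB j)
  -- Banach-Alaoglu in the bidual gives a limit along an ultrafilter, and reflexivity turns it into
  -- a vector. Scalar sequences that converge have the same limit along the ultrafilter.
  obtain ⟨ξ, -, hξ⟩ := hc.ultrafilter_le_nhds ((Filter.hyperfilter ℕ).map J)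
    (Filter.le_principal_iff.2 (Filter.mem_map.2 (Filter.univ_mem' hJ)))
  obtain ⟨y, hy⟩ := hE (WeakDual.toStrongDual ξ)
  refine ⟨y, fun F a hF => ?_⟩
  rw [← hy F]
  have h1 : Filter.Tendsto (fun j => F (x j)) (Filter.hyperfilter ℕ) (nhds (ξ F)) :=
    ((WeakDual.eval_continuous F).tendsto ξ).comp
      (show Filter.Tendsto J (Filter.hyperfilter ℕ) (nhds ξ) from hξ)
  exact tendsto_nhds_unique h1
    (hF.mono_left (by rw [← Nat.cofinite_eq_atTop]; exact Filter.hyperfilter_le_cofinite))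

/-- Averages over translates are bounded in `L^p`. -/
lemma eLpNorm_average_le {V W : Type*} [AddGroup V] [MeasurableSpace V] [MeasurableAdd V]
    [MeasurableSub₂ V] [MeasurableSpace W] (μ : Measure V) [SFinite μ] [μ.IsAddRightInvariant]
    (m : Measure W) [IsProbabilityMeasure m] {ι : W → V} (hι : Measurable ι) {p : ℝ} (hp : 1 < p)
    {k : V → ℝ} (hk : Measurable k) :
    eLpNorm (fun z => ∫ t, k (z - ι t) ∂m) (ENNReal.ofReal p) μ ≤
      eLpNorm k (ENNReal.ofReal p) μ := by
  have hp0 : 0 < p := one_pos.trans hp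
  have hne : ENNReal.ofReal p ≠ 0 := (ENNReal.ofReal_pos.2 hp0).ne'
  rw [eLpNorm_eq_lintegral_rpow_enorm_toReal hne ENNReal.ofReal_ne_top,
    eLpNorm_eq_lintegral_rpow_enorm_toReal hne ENNReal.ofReal_ne_top, ENNReal.toReal_ofReal hp0.le]
  gcongr ?_ ^ _
  have hm : Measurable fun z : V × W => ‖k (z.1 - ι z.2)‖ₑ ^ p := by fun_prop
  -- On a probability space the `L^1` norm is at most the `L^p` norm; Tonelli and translation
  -- invariance then finish the proof.
  have jensen : ∀ z, ‖∫ t, k (z - ι t) ∂m‖ₑ ^ p ≤ ∫⁻ t, ‖k (z - ι t)‖ₑ ^ p ∂m := by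
    intro z
    have h1 : ‖∫ t, k (z - ι t) ∂m‖ₑ ≤ eLpNorm (fun t => k (z - ι t)) (ENNReal.ofReal p) m := by
      refine (enorm_integral_le_lintegral_enorm _).trans ?_
      rw [← eLpNorm_one_eq_lintegral_enorm]
      exact eLpNorm_le_eLpNorm_of_exponent_le (ENNReal.one_le_ofReal.2 hp.le)
        (by fun_prop : Measurable fun t => k (z - ι t)).aestronglyMeasurable
    rw [eLpNorm_eq_lintegral_rpow_enorm_toReal hne ENNReal.ofReal_ne_top,
      ENNReal.toReal_ofReal hp0.le] at h1
    refine (ENNReal.rpow_le_rpow h1 hp0.le).trans_eq ?_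
    rw [← ENNReal.rpow_mul, one_div_mul_cancel hp0.ne', ENNReal.rpow_one]
  refine (lintegral_mono jensen).trans ?_
  rw [lintegral_lintegral_swap hm.aemeasurable]
  simp only [lintegral_sub_right_eq_self (μ := μ) (fun z => ‖k z‖ₑ ^ p)]
  rw [lintegral_const, measure_univ, mul_one]

namespace SobolevSlobodeckij

variable {n : ℕ} {Ω : Opens (Rn n)}

/-! ### Mollification -/

/-- The convolution of `g` with a normed bump function. -/
def mollify (ρ : ContDiffBump (0 : Rn n)) (g : Rn n → ℝ) : Rn n → ℝ :=
  convolution (ρ.normed volume) g (ContinuousLinearMap.lsmul ℝ ℝ) volume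

/-- The probability measure whose density is a normed bump function. -/
def bumpMeasure (ρ : ContDiffBump (0 : Rn n)) : Measure (Rn n) :=
  volume.withDensity fun t => ENNReal.ofReal (ρ.normed volume t)

lemma mollify_apply (ρ : ContDiffBump (0 : Rn n)) (g : Rn n → ℝ) (x : Rn n) :
    mollify ρ g x = ∫ t, ρ.normed volume t * g (x - t) := rfl

lemma mollify_apply' (ρ : ContDiffBump (0 : Rn n)) (g : Rn n → ℝ) (x : Rn n) :
    mollify ρ g x = ∫ t, ρ.normed volume (x - t) * g t := by
  rw [mollify_apply, ← integral_sub_left_eq_self _ volume x]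
  simp only [sub_sub_cancel]

instance (ρ : ContDiffBump (0 : Rn n)) : IsProbabilityMeasure (bumpMeasure ρ) := by
  refine ⟨?_⟩
  rw [bumpMeasure, withDensity_apply _ MeasurableSet.univ, Measure.restrict_univ,
    ← ofReal_integral_eq_lintegral_ofReal ρ.integrable_normed
      (Filter.Eventually.of_forall ρ.nonneg_normed), ρ.integral_normed, ENNReal.ofReal_one]

lemma mollify_eq_integral_bumpMeasure (ρ : ContDiffBump (0 : Rn n)) (g : Rn n → ℝ) (x : Rn n) :
    mollify ρ g x = ∫ t, g (x - t) ∂bumpMeasure ρ := by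
  rw [bumpMeasure, integral_withDensity_eq_integral_toReal_smul
    (ρ.continuous_normed.measurable.ennreal_ofReal) (by simp), mollify_apply]
  congr 1
  ext t
  rw [ENNReal.toReal_ofReal (ρ.nonneg_normed t), smul_eq_mul]

lemma contDiff_mollify (ρ : ContDiffBump (0 : Rn n)) {g : Rn n → ℝ} (hg : LocallyIntegrable g) :
    ContDiff ℝ ((⊤ : ℕ∞) : WithTop ℕ∞) (mollify ρ g) :=
  ρ.hasCompactSupport_normed.contDiff_convolution_left _ ρ.contDiff_normed hg

lemma tsupport_mollify_subset (ρ : ContDiffBump (0 : Rn n)) {g : Rn n → ℝ} {K : Set (Rn n)}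
    (hg : Function.support g ⊆ K) :
    tsupport (mollify ρ g) ⊆ Metric.cthickening ρ.rOut K := by
  refine closure_minimal ?_ Metric.isClosed_cthickening
  refine (support_convolution_subset _).trans ?_
  rw [ρ.support_normed_eq]
  rintro _ ⟨a, ha, b, hb, rfl⟩
  refine Metric.mem_cthickening_of_dist_le _ b _ _ (hg hb) ?_
  rw [dist_eq_norm, add_sub_cancel_right]
  exact (mem_ball_zero_iff.1 ha).le

/-- Mollification is a symmetric operation. -/
lemma integral_mollify_mul (ρ : ContDiffBump (0 : Rn n)) {f g : Rn n → ℝ} (hf : Integrable f)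
    (hg : Integrable g) : ∫ x, f x * mollify ρ g x = ∫ x, mollify ρ f x * g x := by
  obtain ⟨C, hC⟩ := ρ.hasCompactSupport_normed.exists_bound_of_continuous
    (ρ.continuous_normed (μ := volume))
  have hint : Integrable (fun z : Rn n × Rn n => ρ.normed volume (z.1 - z.2) * (f z.1 * g z.2))
      (volume.prod volume) :=
    (hf.mul_prod hg).bdd_mul (c := C)
      ((ρ.continuous_normed.comp (continuous_fst.sub continuous_snd)).aestronglyMeasurable)
      (Filter.Eventually.of_forall fun z => hC _)
  have h1 : ∀ x y, ρ.normed volume (x - y) = ρ.normed volume (y - x) := fun x y => by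
    rw [← neg_sub, ρ.normed_neg]
  calc ∫ x, f x * mollify ρ g x
      = ∫ x, ∫ y, ρ.normed volume (x - y) * (f x * g y) := by
        simp only [mollify_apply', ← integral_const_mul]
        congr! 4
        ring
    _ = ∫ y, ∫ x, ρ.normed volume (x - y) * (f x * g y) := integral_integral_swap hint
    _ = _ := by
        simp only [mollify_apply', ← integral_mul_const]
        congr! 4 with y x
        rw [h1]
        ring

lemma norm_mollify_sub_le (ρ : ContDiffBump (0 : Rn n)) (φ : 𝓓(Ω, ℝ)) (x : Rn n) :
    ‖mollify ρ φ x - φ x‖ ≤ 2 * supNorm φ * ρ.rOut := by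
  rw [← dist_eq_norm]
  refine ρ.dist_normed_convolution_le φ.continuous.aestronglyMeasurable fun y hy => ?_
  rw [dist_eq_norm]
  refine (norm_sub_le_supNorm φ y x).trans ?_
  have := supNorm_nonneg φ
  gcongr
  exact (min_le_right _ _).trans (by rw [← dist_eq_norm]; exact (Metric.mem_ball.1 hy).le)

lemma integrable_test (φ : 𝓓(Ω, ℝ)) : Integrable φ :=
  φ.continuous.integrable_of_hasCompactSupport φ.hasCompactSupport

/-- The test function `χ (ρ * φ)`. -/
def cutMollify (χ : 𝓓(Ω, ℝ)) (ρ : ContDiffBump (0 : Rn n)) (φ : 𝓓(Ω, ℝ)) : 𝓓(Ω, ℝ) :=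
  ⟨fun x => χ x * mollify ρ φ x,
    χ.contDiff.mul (contDiff_mollify ρ (integrable_test φ).locallyIntegrable),
    χ.hasCompactSupport.mul_right, tsupport_mul_subset_left.trans χ.tsupport_subset⟩

lemma cutMollify_apply (χ : 𝓓(Ω, ℝ)) (ρ : ContDiffBump (0 : Rn n)) (φ : 𝓓(Ω, ℝ)) (x : Rn n) :
    cutMollify χ ρ φ x = χ x * mollify ρ φ x := rfl

lemma fderiv_mollify (ρ : ContDiffBump (0 : Rn n)) (φ : 𝓓(Ω, ℝ)) (i : Fin n) (x : Rn n) :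
    fderiv ℝ (mollify ρ φ) x (EuclideanSpace.single i (1 : ℝ)) =
      mollify ρ (testPartialDeriv Ω i φ) x := by
  have h1 : ContDiff ℝ 1 φ := φ.contDiff.of_le (by simp)
  have h := φ.hasCompactSupport.hasFDerivAt_convolution_right (ContinuousLinearMap.lsmul ℝ ℝ)
    (ρ.integrable_normed (μ := volume)).locallyIntegrable h1 x
  have h2 : (testPartialDeriv Ω i φ : Rn n → ℝ) =
      fun y => fderiv ℝ φ y (EuclideanSpace.single i (1 : ℝ)) :=
    funext fun y => testPartialDeriv_apply i φ y
  rw [mollify, h.fderiv, convolution_precompR_apply _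
    (ρ.integrable_normed (μ := volume)).locallyIntegrable (φ.hasCompactSupport.fderiv ℝ)
    (h1.continuous_fderiv one_ne_zero), mollify, h2]

/-- `v` is the mollification of the compactly supported distribution `u`. -/
def IsMollification (χ : 𝓓(Ω, ℝ)) (ρ : ContDiffBump (0 : Rn n)) (u v : 𝓓'(Ω, ℝ)) : Prop :=
  ∀ φ : 𝓓(Ω, ℝ), v φ = u (cutMollify χ ρ φ)

/-- Near the support of `u` the cutoff `χ` is `1`, so it contributes nothing to the derivative of `χ
(ρ * φ)`, and `∂_i` commutes with convolution. -/
lemma IsMollification.partialDeriv {χ : 𝓓(Ω, ℝ)} {ρ : ContDiffBump (0 : Rn n)} {u v : 𝓓'(Ω, ℝ)}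
    (h : IsMollification χ ρ u v) {U : Set (Rn n)} (hU : IsOpen U)
    (hu : Distribution.dsupport u ⊆ U) (hχ : ∀ x ∈ U, χ x = 1) (i : Fin n) :
    IsMollification χ ρ (partialDeriv Ω i u) (partialDeriv Ω i v) := by
  intro φ
  rw [partialDeriv_apply, partialDeriv_apply, h]
  congr 1
  refine apply_eq_of_eqOn hU hu fun x hx => ?_
  have h1 : (cutMollify χ ρ φ : Rn n → ℝ) =ᶠ[nhds x] mollify ρ φ := by
    filter_upwards [hU.mem_nhds hx] with y hy
    rw [cutMollify_apply, hχ y hy, one_mul]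
  rw [testPartialDeriv_apply, h1.fderiv_eq, fderiv_mollify, cutMollify_apply, hχ x hx, one_mul]

lemma IsMollification.deriv {χ : 𝓓(Ω, ℝ)} {ρ : ContDiffBump (0 : Rn n)} {u v : 𝓓'(Ω, ℝ)}
    (h : IsMollification χ ρ u v) {U : Set (Rn n)} (hU : IsOpen U)
    (hu : Distribution.dsupport u ⊆ U) (hχ : ∀ x ∈ U, χ x = 1) (ν : Fin n → ℕ) :
    IsMollification χ ρ (deriv ν u) (deriv ν v) := by
  refine (deriv_induction (fun T => ∀ u v, IsMollification χ ρ u v →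
    Distribution.dsupport u ⊆ U → IsMollification χ ρ (T u) (T v) ∧
      Distribution.dsupport (T u) ⊆ U) (fun _ _ h hu => ⟨h, hu⟩) ?_ ?_ ν u v h hu).1
  · intro S T hS hT u v h hu
    exact hS _ _ (hT u v h hu).1 (hT u v h hu).2
  · exact fun i u v h hu => ⟨h.partialDeriv hU hu hχ i, (dsupport_partialDeriv_subset i u).trans hu⟩

lemma isMollification_mollify {χ : 𝓓(Ω, ℝ)} (ρ : ContDiffBump (0 : Rn n)) {u : 𝓓'(Ω, ℝ)}
    {g : Rn n → ℝ} (hg : Represents g u) (hgi : Integrable g) {K : Set (Rn n)}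
    (hK : Function.support g ⊆ K) (hχ : ∀ x ∈ K, χ x = 1) :
    IsMollification χ ρ u (ofFun Ω (mollify ρ g)) := by
  intro φ
  rw [ofFun_apply ((contDiff_mollify ρ hgi.locallyIntegrable).continuous.locallyIntegrable
    |>.locallyIntegrableOn _), hg.2, ofFun_apply hg.1, integral_mollify_mul ρ (integrable_test φ) hgi]
  congr 1
  ext x
  rw [cutMollify_apply]
  by_cases hx : g x = 0
  · rw [hx, mul_zero, mul_zero]
  · rw [hχ x (hK hx), one_mul]

/-- Applied to `deriv ν u` and `deriv ν v`, this shows that the derivatives of a mollification are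
the mollified derivatives. -/
lemma represents_mollify {χ : 𝓓(Ω, ℝ)} {ρ : ContDiffBump (0 : Rn n)} {u v : 𝓓'(Ω, ℝ)}
    (h : IsMollification χ ρ u v)
    {g : Rn n → ℝ} (hg : Represents g u) (hgi : Integrable g) {K : Set (Rn n)}
    (hK : Function.support g ⊆ K) (hχ : ∀ x ∈ K, χ x = 1) : Represents (mollify ρ g) v := by
  refine ⟨(contDiff_mollify ρ hgi.locallyIntegrable).continuous.locallyIntegrable
    |>.locallyIntegrableOn _, ?_⟩
  ext φ
  rw [h φ, isMollification_mollify ρ hg hgi hK hχ φ]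

lemma eLpNorm_mollify_le (ρ : ContDiffBump (0 : Rn n)) {g : Rn n → ℝ} (hg : Measurable g)
    (p : Exponent) : eLpNorm (mollify ρ g) (ENNReal.ofReal p) volume ≤
      eLpNorm g (ENNReal.ofReal p) volume := by
  have := eLpNorm_average_le volume (bumpMeasure ρ) measurable_id p.2 hg
  simpa only [id, ← mollify_eq_integral_bumpMeasure] using this

/-- The diagonal translation `(x - t, y - t)` leaves `x - y` unchanged, so the difference quotient
of an average is the average of the translated difference quotients, and `eLpNorm_average_le`
applies on the product space. -/
lemma diffQuot_mollify (ρ : ContDiffBump (0 : Rn n)) {g : Rn n → ℝ} (hg : LocallyIntegrable g)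
    (θ : ℝ) (p : Exponent) (z : Rn n × Rn n) :
    diffQuot θ p (mollify ρ g) z = ∫ t, diffQuot θ p g (z - (t, t)) ∂bumpMeasure ρ := by
  have hi : ∀ x, Integrable (fun t => g (x - t)) (bumpMeasure ρ) := by
    intro x
    have h1 := ρ.hasCompactSupport_normed.convolutionExists_left
      (ContinuousLinearMap.lsmul ℝ ℝ) (ρ.continuous_normed (μ := volume)) hg x
    rw [bumpMeasure, integrable_withDensity_iff_integrable_smul'
      (ρ.continuous_normed.measurable.ennreal_ofReal) (by simp)]
    refine h1.congr (Filter.Eventually.of_forall fun t => ?_)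
    simp only [ENNReal.toReal_ofReal (ρ.nonneg_normed t)]
    rfl
  simp only [diffQuot, Prod.fst_sub, Prod.snd_sub, sub_sub_sub_cancel_right]
  rw [integral_div, integral_sub (hi _) (hi _), mollify_eq_integral_bumpMeasure,
    mollify_eq_integral_bumpMeasure]

lemma measurable_diffQuot (θ : ℝ) (p : Exponent) {g : Rn n → ℝ} (hg : Measurable g) :
    Measurable (diffQuot θ p g) := by
  unfold diffQuot
  fun_prop

lemma eLpNorm_diffQuot_mollify_le (ρ : ContDiffBump (0 : Rn n)) {g : Rn n → ℝ} (hg : Measurable g)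
    (hgl : LocallyIntegrable g) (θ : ℝ) (p : Exponent) :
    eLpNorm (diffQuot θ p (mollify ρ g)) (ENNReal.ofReal p) (volume.prod volume) ≤
      eLpNorm (diffQuot θ p g) (ENNReal.ofReal p) (volume.prod volume) := by
  have := eLpNorm_average_le (volume.prod volume) (bumpMeasure ρ)
    (measurable_id.prodMk measurable_id) p.2 (measurable_diffQuot θ p hg)
  simpa only [id, ← diffQuot_mollify ρ hgl] using this

end SobolevSlobodeckij
end

noncomputable section

namespace SobolevSlobodeckij

variable {n : ℕ} {Ω : Opens (Rn n)}

/-! ### Compactly supported elements of `W^{s,p}(Ω)`, `s ≥ 0` -/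

lemma exists_represents_support_subset {u : 𝓓'(Ω, ℝ)} {p : Exponent} (h : lpNorm p u < ∞)
    {K : Set (Rn n)} (hK : IsCompact K) (hKΩ : K ⊆ Ω) (hu : Distribution.dsupport u ⊆ K) :
    ∃ g, Represents g u ∧ Measurable g ∧ Function.support g ⊆ K ∧
      MemLp g (ENNReal.ofReal p) volume := by
  obtain ⟨g, hg, hgm⟩ := exists_represents h
  have hmk : Measurable (hgm.1.mk g) := hgm.1.stronglyMeasurable_mk.measurable
  have hae := hgm.1.ae_eq_mk
  refine ⟨K.indicator (hgm.1.mk g), hg.congr_ae ?_, hmk.indicator hK.measurableSet,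
    Set.support_indicator_subset, ?_⟩
  · rw [Filter.EventuallyEq, ae_restrict_iff' Ω.isOpen.measurableSet]
    filter_upwards [hg.ae_eq_zero hK.isClosed hu,
      (ae_restrict_iff' Ω.isOpen.measurableSet).1 hae] with x h1 h2 hx
    by_cases hxK : x ∈ K
    · rw [Set.indicator_of_mem hxK, h2 hx]
    · rw [Set.indicator_of_notMem hxK, h1 ⟨hx, hxK⟩]
  · rw [memLp_indicator_iff_restrict hK.measurableSet]
    exact ((memLp_congr_ae hae).1 hgm).mono_measure (Measure.restrict_mono_set _ hKΩ)

lemma integrable_of_support_subset {g : Rn n → ℝ} {p : Exponent} {K : Set (Rn n)}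
    (hK : IsCompact K) (hgK : Function.support g ⊆ K) (hg : MemLp g (ENNReal.ofReal p) volume) :
    Integrable g := by
  rw [← integrableOn_iff_integrable_of_support_subset hgK]
  have : IsFiniteMeasure (volume.restrict K) := ⟨by simpa using hK.measure_lt_top⟩
  exact (hg.restrict K).integrable (ENNReal.one_le_ofReal.2 p.2.le)

/-- A function that is supported in a compact subset of `Ω` and has finite Slobodeckij seminorm
on `Ω` has finite Slobodeckij seminorm on `ℝⁿ`. -/
lemma eLpNorm_diffQuot_lt_top (hn : 0 < n) {θ : ℝ} (h0 : 0 < θ) (h1 : θ < 1) {p : Exponent}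
    {g : Rn n → ℝ} {K : Set (Rn n)} {δ : ℝ} (hδ : 0 < δ) (hK : Metric.cthickening δ K ⊆ Ω)
    (hgK : Function.support g ⊆ K) (hg : Measurable g) (hgp : MemLp g (ENNReal.ofReal p) volume)
    (hgΩ : gagliardo Ω θ p g < ∞) :
    eLpNorm (diffQuot θ p g) (ENNReal.ofReal p) (volume.prod volume) < ∞ := by
  have hp := p.pos
  have htop := eLpNorm_diffQuot (Ω := ⊤) θ h0.le p g
  rw [Opens.coe_top, Measure.restrict_univ] at htop
  rw [htop]
  unfold gagliardo at hgΩ ⊢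
  rw [Opens.coe_top, Measure.restrict_univ]
  set F : Rn n × Rn n → ℝ≥0∞ := fun z =>
    ‖g z.1 - g z.2‖ₑ ^ (p : ℝ) / ‖z.1 - z.2‖ₑ ^ ((n : ℝ) + θ * p) with hF
  set k : Rn n → ℝ≥0∞ := fun z => min 1 ‖z‖ₑ ^ (p : ℝ) / ‖z‖ₑ ^ ((n : ℝ) + θ * p) with hk
  set f : Rn n → ℝ≥0∞ := fun x => ‖g x‖ₑ ^ (p : ℝ) with hf
  have hFΩ : ∫⁻ z, F z ∂((volume.restrict (Ω : Set (Rn n))).prod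
      (volume.restrict (Ω : Set (Rn n)))) < ∞ := by
    rwa [ENNReal.rpow_lt_top_iff_of_pos (by positivity)] at hgΩ
  refine ENNReal.rpow_lt_top_of_nonneg (by positivity) (ne_of_lt ?_)
  set m : ℝ≥0∞ := min 1 (ENNReal.ofReal δ) ^ (p : ℝ) with hm
  have hm0 : m ≠ 0 := by
    rw [hm]
    refine (ENNReal.rpow_pos (lt_min one_pos (ENNReal.ofReal_pos.2 hδ)) ?_).ne'
    exact ((min_le_left _ _).trans_lt ENNReal.one_lt_top).ne
  have hmt : m ≠ ∞ := ENNReal.rpow_ne_top_of_nonneg hp.le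
    ((min_le_left _ _).trans_lt ENNReal.one_lt_top).ne
  have hgz : ∀ x ∉ K, g x = 0 := fun x hx => by_contra fun h => hx (hgK h)
  have hfz : ∀ x ∉ K, f x = 0 := fun x hx => by simp [hf, hgz x hx, hp]
  -- At distance more than `δ` the number `m = min(1, δ)^p` is a lower bound for the numerator of
  -- the kernel `k`.
  have far : ∀ x y : Rn n, δ < dist x y → f x / ‖x - y‖ₑ ^ ((n : ℝ) + θ * p) ≤
      m⁻¹ * (f x * k (x - y)) := by
    intro x y hxy
    have h2 : m ≤ min 1 ‖x - y‖ₑ ^ (p : ℝ) := by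
      rw [hm]
      gcongr
      rw [← ofReal_norm, ← dist_eq_norm]
      exact ENNReal.ofReal_le_ofReal hxy.le
    calc f x / ‖x - y‖ₑ ^ ((n : ℝ) + θ * p)
        = m⁻¹ * (f x * (m / ‖x - y‖ₑ ^ ((n : ℝ) + θ * p))) := by
          rw [← mul_div_assoc, ← mul_div_assoc, mul_comm (f x) m, ← mul_assoc,
            ENNReal.inv_mul_cancel hm0 hmt, one_mul]
      _ ≤ _ := by
          rw [hk]
          dsimp only
          gcongr
  -- Outside `Ω × Ω` the integrand is nonzero only if one point lies in `K` and the other off `Ω`.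
  -- These are more than `δ` apart because the closed `δ`-neighborhood of `K` lies in `Ω`.
  have hpt : ∀ z, F z ≤ ((Ω : Set (Rn n)) ×ˢ (Ω : Set (Rn n))).indicator F z +
      m⁻¹ * ((f z.1 + f z.2) * k (z.1 - z.2)) := by
    intro z
    by_cases h2 : z.1 ∈ Ω ∧ z.2 ∈ Ω
    · rw [Set.indicator_of_mem (show z ∈ (Ω : Set (Rn n)) ×ˢ (Ω : Set (Rn n)) from h2)]
      exact le_self_add
    refine le_trans ?_ le_add_self
    have hKΩ : K ⊆ Ω := (Metric.self_subset_cthickening K).trans hK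
    have hd : ∀ x y : Rn n, x ∉ Ω → y ∈ K → δ < dist x y := fun x y hx hy => by
      by_contra hle
      exact hx (hK (Metric.mem_cthickening_of_dist_le x y δ K hy (not_lt.1 hle)))
    by_cases hz1 : z.1 ∈ K
    · have hz2 : z.2 ∉ Ω := fun h => h2 ⟨hKΩ hz1, h⟩
      have hz2' : z.2 ∉ K := fun h => hz2 (hKΩ h)
      have := far z.1 z.2 (by rw [dist_comm]; exact hd _ _ hz2 hz1)
      simpa only [hF, hgz _ hz2', hfz _ hz2', sub_zero, add_zero] using this
    · by_cases hz2 : z.2 ∈ K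
      · have hz1' : z.1 ∉ Ω := fun h => h2 ⟨h, hKΩ hz2⟩
        have h3 := far z.2 z.1 (by rw [dist_comm]; exact hd _ _ hz1' hz2)
        have h4 : ‖z.2 - z.1‖ₑ = ‖z.1 - z.2‖ₑ := by rw [← enorm_neg, neg_sub]
        simp only [hk, h4] at h3
        simpa only [hF, hgz _ hz1, hfz _ hz1, zero_sub, zero_add, enorm_neg] using h3
      · simp [hF, hgz _ hz1, hgz _ hz2, hp]
  have hfm : Measurable f := by fun_prop
  have hkm : Measurable k := by fun_prop
  have hFm : Measurable F := by fun_prop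
  refine (lintegral_mono hpt).trans_lt ?_
  rw [lintegral_add_left (hFm.indicator (Ω.isOpen.measurableSet.prod Ω.isOpen.measurableSet)),
    lintegral_indicator (Ω.isOpen.measurableSet.prod Ω.isOpen.measurableSet),
    ← Measure.prod_restrict, lintegral_const_mul _ (by fun_prop), ← Measure.volume_eq_prod,
    lintegral_fst_add_snd_mul hfm hkm]
  refine ENNReal.add_lt_top.2 ⟨hFΩ, ENNReal.mul_lt_top (ENNReal.inv_lt_top.2 hm0.bot_lt) ?_⟩
  refine ENNReal.mul_lt_top (ENNReal.mul_lt_top (by simp) ?_) (lintegral_min_kernel_lt_top hn h0 h1 p)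
  have h5 := hgp.2
  rwa [eLpNorm_eq_lintegral_rpow_enorm_toReal p.ofReal_ne_zero ENNReal.ofReal_ne_top,
    p.toReal_ofReal, ENNReal.rpow_lt_top_iff_of_pos (by positivity)] at h5

/-- Evaluation at a test function, as a functional on `W^{s,p}(Ω)`, `s ≥ 0`. -/
def evalNonneg (s : ℝ) (p : Exponent) (φ : 𝓓(Ω, ℝ)) : StrongDual ℝ (nonneg Ω s p).Space :=
  LinearMap.mkContinuousOfExistsBound
    { toFun := fun u => u.dist φ
      map_add' := fun _ _ => rfl
      map_smul' := fun _ _ => rfl }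
    ((exists_apply_le_nonneg s p φ).imp fun _ h => h.2)

lemma testNonneg_mem_closureTest (hn : 0 < n) (s : ℝ) (p : Exponent) (φ : 𝓓(Ω, ℝ)) :
    testNonneg hn s p φ ∈ (nonneg Ω s p).closureTest :=
  subset_closure (Submodule.subset_span ⟨φ, rfl⟩)

/-- The inclusion of the test functions in `W^{s,p}_0(Ω)`, `s ≥ 0`. -/
def testNonneg0 (hn : 0 < n) (s : ℝ) (p : Exponent) : 𝓓(Ω, ℝ) →L[ℝ] (nonneg Ω s p).Space0 :=
  (testNonneg hn s p).codRestrict (nonneg Ω s p).closureTest (testNonneg_mem_closureTest hn s p)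

/-- By symmetry the mollifier moves to `φ`, where it converges uniformly at the rate of its radius.
-/
lemma tendsto_integral_mul_mollify {ρ : ℕ → ContDiffBump (0 : Rn n)}
    (hρ : Filter.Tendsto (fun j => (ρ j).rOut) Filter.atTop (nhds 0)) {g : Rn n → ℝ}
    (hg : Integrable g) (φ : 𝓓(Ω, ℝ)) :
    Filter.Tendsto (fun j => ∫ x, φ x * mollify (ρ j) g x) Filter.atTop
      (nhds (∫ x, φ x * g x)) := by
  have hφ : ∀ {w : Rn n → ℝ}, Continuous w → HasCompactSupport w →
      Integrable fun x => w x * g x := by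
    intro w hw hwc
    obtain ⟨C, hC⟩ := hwc.exists_bound_of_continuous hw
    exact hg.bdd_mul hw.aestronglyMeasurable (Filter.Eventually.of_forall hC)
  have hm : ∀ j, Integrable fun x => mollify (ρ j) φ x * g x := fun j =>
    hφ (contDiff_mollify (ρ j) (integrable_test φ).locallyIntegrable).continuous
      ((ρ j).hasCompactSupport_normed.convolution _ φ.hasCompactSupport)
  rw [tendsto_iff_norm_sub_tendsto_zero]
  refine squeeze_zero (g := fun j => 2 * supNorm φ * (ρ j).rOut * ∫ x, ‖g x‖)
    (fun _ => norm_nonneg _) (fun j => ?_) ?_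
  · rw [integral_mollify_mul _ (integrable_test φ) hg,
      ← integral_sub (hm j) (hφ φ.continuous φ.hasCompactSupport), ← integral_const_mul]
    refine norm_integral_le_of_norm_le (hg.norm.const_mul _)
      (Filter.Eventually.of_forall fun x => ?_)
    rw [← sub_mul, norm_mul]
    gcongr
    exact norm_mollify_sub_le _ _ _
  · simpa using (hρ.const_mul (2 * supNorm φ)).mul_const (∫ x, ‖g x‖)

lemma exists_contDiffBump_seq {δ : ℝ} (hδ : 0 < δ) :
    ∃ ρ : ℕ → ContDiffBump (0 : Rn n), (∀ j, (ρ j).rOut ≤ δ) ∧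
      Filter.Tendsto (fun j => (ρ j).rOut) Filter.atTop (nhds 0) := by
  refine ⟨fun j => ⟨δ / (j + 1) / 2, δ / (j + 1), by positivity, half_lt_self (by positivity)⟩,
    fun j => div_le_self hδ.le (by simp), ?_⟩
  have := (tendsto_one_div_add_atTop_nhds_zero_nat (𝕜 := ℝ)).const_mul δ
  simpa [div_eq_mul_inv] using this

lemma fract_ne_zero_of_mem {s : ℝ} {ν : Fin n → ℕ} (hν : ν ∈ slobodeckijIndices n s) :
    Int.fract s ≠ 0 := by
  intro h
  rw [slobodeckijIndices, if_pos h] at hν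
  simp at hν

/-- The mollifications of a compactly supported distribution of finite norm are bounded. -/
lemma exists_bound_mollification (hn : 0 < n) {s : ℝ} {p : Exponent} {u : 𝓓'(Ω, ℝ)}
    (hfin : nonnegNorm s p u < ∞) {K : Set (Rn n)} (hK : IsCompact K) (hKΩ : K ⊆ Ω)
    (hu : Distribution.dsupport u ⊆ K) {χ : 𝓓(Ω, ℝ)} {U : Set (Rn n)} (hU : IsOpen U)
    (hKU : K ⊆ U) (hχ : ∀ x ∈ U, χ x = 1) :
    ∃ B < ∞, ∀ (ρ : ContDiffBump (0 : Rn n)) (v : 𝓓'(Ω, ℝ)), IsMollification χ ρ u v →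
      nonnegNorm s p v ≤ B := by
  obtain ⟨δ, hδ, hδΩ⟩ := hK.exists_cthickening_subset_open Ω.isOpen hKΩ
  have hg : ∀ ν : lpIndices n s, ∃ g, Represents g (deriv ν u) ∧ Measurable g ∧
      Function.support g ⊆ K ∧ MemLp g (ENNReal.ofReal p) volume := fun ν =>
    exists_represents_support_subset ((lpNorm_deriv_le_of_mem ν.2 _).trans_lt hfin) hK hKΩ
      (subset_trans (dsupport_deriv_subset (ν : Fin n → ℕ) u) hu)
  choose g hgr hgm hgK hgp using hg
  have hgi : ∀ ν, Integrable (g ν) := fun ν => integrable_of_support_subset hK (hgK ν) (hgp ν)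
  have h₁ : ∃ B < ∞, ∀ ν, eLpNorm (g ν) (ENNReal.ofReal p) volume ≤ B :=
    ⟨∑ ν, eLpNorm (g ν) (ENNReal.ofReal p) volume, ENNReal.sum_lt_top.2 fun ν _ => (hgp ν).2,
      fun ν => Finset.single_le_sum (f := fun ν => eLpNorm (g ν) (ENNReal.ofReal p) volume)
        (fun _ _ => zero_le) (Finset.mem_univ ν)⟩
  -- The bound is needed on all of `ℝⁿ × ℝⁿ`, since the translations in the averaging argument do
  -- not preserve `Ω`.
  have h₂ : ∃ B < ∞, ∀ ν : slobodeckijIndices n s, eLpNorm (diffQuot (Int.fract s) p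
      (g ⟨ν, slobodeckijIndices_subset n s ν.2⟩)) (ENNReal.ofReal p) (volume.prod volume) ≤ B := by
    refine ⟨_, ENNReal.sum_lt_top.2 fun ν _ => ?_, fun ν => Finset.single_le_sum
      (f := fun ν : slobodeckijIndices n s => eLpNorm (diffQuot (Int.fract s) p
        (g ⟨ν, slobodeckijIndices_subset n s ν.2⟩)) (ENNReal.ofReal p) (volume.prod volume))
      (fun _ _ => zero_le) (Finset.mem_univ ν)⟩
    refine eLpNorm_diffQuot_lt_top hn ((Int.fract_nonneg s).lt_of_ne' (fract_ne_zero_of_mem ν.2))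
      (Int.fract_lt_one s) hδ hδΩ (hgK _) (hgm _) (hgp _) ?_
    rw [← slobodeckij_eq (hgr _)]
    exact (slobodeckij_deriv_le_of_mem ν.2 _).trans_lt hfin
  obtain ⟨B₁, hB₁, h₁⟩ := h₁
  obtain ⟨B₂, hB₂, h₂⟩ := h₂
  refine ⟨_, ENNReal.mul_lt_top (ENNReal.natCast_lt_top _) (max_lt hB₁ hB₂), fun ρ v hv =>
    nonnegNorm_le_mul (fun ν hν => ?_) (fun ν hν => ?_)⟩
  · have hr := represents_mollify (hv.deriv hU (hu.trans hKU) hχ ν) (hgr ⟨ν, hν⟩) (hgi _) (hgK _)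
      fun x hx => hχ x (hKU hx)
    rw [lpNorm_eq hr]
    refine (eLpNorm_mono_measure _ Measure.restrict_le_self).trans ?_
    exact (eLpNorm_mollify_le _ (hgm _) p).trans ((h₁ _).trans (le_max_left _ _))
  · have hr := represents_mollify (hv.deriv hU (hu.trans hKU) hχ ν)
      (hgr ⟨ν, slobodeckijIndices_subset n s hν⟩) (hgi _) (hgK _) fun x hx => hχ x (hKU hx)
    rw [slobodeckij_eq hr, ← eLpNorm_diffQuot _ (Int.fract_nonneg s), Measure.prod_restrict]
    refine (eLpNorm_mono_measure _ Measure.restrict_le_self).trans ?_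
    exact (eLpNorm_diffQuot_mollify_le _ (hgm _) (hgi _).locallyIntegrable _ p).trans
      ((h₂ ⟨ν, hν⟩).trans (le_max_right _ _))

/-- Mollifiers of radius at most `δ` spread the support only inside a compact neighborhood of `K` in
`Ω`. Bounded norms and convergence as distributions are all that is needed; norm convergence is not.
-/
lemma exists_test_seq_nonneg (hn : 0 < n) {s : ℝ} {p : Exponent} {u : 𝓓'(Ω, ℝ)}
    (hfin : nonnegNorm s p u < ∞) {K : Set (Rn n)} (hK : IsCompact K) (hKΩ : K ⊆ Ω)
    (hu : Distribution.dsupport u ⊆ K) :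
    ∃ (v : ℕ → 𝓓(Ω, ℝ)) (B : ℝ≥0∞), B < ∞ ∧ (∀ j, nonnegNorm s p (ofFun Ω (v j)) ≤ B) ∧
      ∀ φ : 𝓓(Ω, ℝ), Filter.Tendsto (fun j => ofFun Ω (v j) φ) Filter.atTop (nhds (u φ)) := by
  obtain ⟨δ, hδ, hδΩ⟩ := hK.exists_cthickening_subset_open Ω.isOpen hKΩ
  obtain ⟨χ, U, hU, hKU, -, hχ⟩ := exists_cutoff hK hKΩ
  obtain ⟨ρ, hρδ, hρ⟩ := exists_contDiffBump_seq (n := n) hδ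
  obtain ⟨g, hgr, hgm, hgK, hgp⟩ := exists_represents_support_subset
    ((lpNorm_le s p u).trans_lt hfin) hK hKΩ hu
  have hgi := integrable_of_support_subset hK hgK hgp
  obtain ⟨B, hB, h⟩ := exists_bound_mollification hn hfin hK hKΩ hu hU hKU hχ
  have hts : ∀ j, tsupport (mollify (ρ j) g) ⊆ Metric.cthickening δ K := fun j =>
    (tsupport_mollify_subset (ρ j) hgK).trans (Metric.cthickening_mono (hρδ j) K)
  let v : ℕ → 𝓓(Ω, ℝ) := fun j => ⟨mollify (ρ j) g,
    contDiff_mollify (ρ j) hgi.locallyIntegrable,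
    hK.cthickening.of_isClosed_subset (isClosed_tsupport _) (hts j), (hts j).trans hδΩ⟩
  refine ⟨v, B, hB, fun j => h (ρ j) _
    (isMollification_mollify (ρ j) hgr hgi hgK fun x hx => hχ x (hKU hx)), fun φ => ?_⟩
  rw [hgr.2, ofFun_apply hgr.1]
  refine (tendsto_integral_mul_mollify hρ hgi φ).congr fun j => ?_
  rw [ofFun_apply (represents_test (v j)).1]
  rfl

/-- A compactly supported element of `W^{s,p}(Ω)` belongs to `W^{s,p}_0(Ω)`, `s ≥ 0`. -/
lemma mem_closureTest_nonneg (hn : 0 < n) {s : ℝ} {p : Exponent} (u : (nonneg Ω s p).Space)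
    {K : Set (Rn n)} (hK : IsCompact K) (hKΩ : K ⊆ Ω) (hu : Distribution.dsupport u.dist ⊆ K) :
    u ∈ (nonneg Ω s p).closureTest := by
  obtain ⟨v, B, hB, hbound, hv⟩ := exists_test_seq_nonneg hn u.2 hK hKΩ hu
  have hb : ∀ j, ‖testNonneg0 hn s p (v j)‖ ≤ B.toReal := fun j =>
    ENNReal.toReal_mono hB.ne (hbound j)
  -- The weak limit is taken inside the reflexive space `W^{s,p}_0(Ω)`. Evaluations at test
  -- functions are continuous there, so it is the distribution `u`.
  obtain ⟨y, hy⟩ := (bidualSurjective_nonneg_Space0 Ω s p).exists_weak_limit _ hb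
  have hyu : y.toSpace = u := by
    refine Subtype.ext ?_
    change y.toSpace.dist = u.dist
    ext φ
    exact hy (evalNonneg s p φ ∘L ExtNorm.Space0.toSpaceL) _ (hv φ)
  rw [← hyu]
  exact y.2

end SobolevSlobodeckij
end

noncomputable section

namespace SobolevSlobodeckij

variable {n : ℕ} {Ω : Opens (Rn n)}

/-! ### Dual norms -/

namespace ExtNorm

variable {N : ExtNorm Ω}

lemma Space.ext {u v : N.Space} (h : u.dist = v.dist) : u = v := Subtype.ext h

lemma Space0.ext {u v : N.Space0} (h : u.toSpace.dist = v.toSpace.dist) : u = v :=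
  Subtype.ext (Space.ext h)

/-- The test functions of finite norm already form a subspace, so the span in `closureTest` adds
nothing. -/
lemma dense_test (N : ExtNorm Ω) :
    Dense {f : N.Space0 | ∃ φ : 𝓓(Ω, ℝ), f.toSpace.dist = ofFun Ω φ} := by
  let S : Submodule ℝ N.Space :=
    { carrier := {u | ∃ φ : 𝓓(Ω, ℝ), u.dist = ofFun Ω φ}
      add_mem' := by
        rintro u v ⟨φ, hφ⟩ ⟨ψ, hψ⟩
        exact ⟨φ + ψ, (congrArg₂ (· + ·) hφ hψ).trans (map_add (ofTest Ω) φ ψ).symm⟩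
      zero_mem' := ⟨0, (map_zero (ofTest Ω)).symm⟩
      smul_mem' := by
        rintro c u ⟨φ, hφ⟩
        exact ⟨c • φ, (congrArg (c • ·) hφ).trans (map_smul (ofTest Ω) c φ).symm⟩ }
  intro f
  refine Metric.mem_closure_iff.2 fun ε hε => ?_
  have hf : f.toSpace ∈ closure (Submodule.span ℝ (S : Set N.Space) : Set N.Space) := f.2
  rw [Submodule.span_eq] at hf
  obtain ⟨b, hb, hbε⟩ := Metric.mem_closure_iff.1 hf ε hε
  exact ⟨⟨b, subset_closure (Submodule.subset_span hb)⟩, hb, hbε⟩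

lemma Extends.unique {F G : StrongDual ℝ N.Space0} {u : 𝓓'(Ω, ℝ)} (hF : N.Extends F u)
    (hG : N.Extends G u) : F = G := by
  have := Continuous.ext_on N.dense_test F.continuous G.continuous fun f hf => by
    obtain ⟨φ, hφ⟩ := hf
    rw [hF f φ hφ, hG f φ hφ]
  exact DFunLike.coe_injective this

lemma Extends.add {F G : StrongDual ℝ N.Space0} {u v : 𝓓'(Ω, ℝ)} (hF : N.Extends F u)
    (hG : N.Extends G v) : N.Extends (F + G) (u + v) := fun f φ h => by
  change F f + G f = u φ + v φ
  rw [hF f φ h, hG f φ h]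

lemma Extends.smul {F : StrongDual ℝ N.Space0} {u : 𝓓'(Ω, ℝ)} (hF : N.Extends F u) (c : ℝ) :
    N.Extends (c • F) (c • u) := fun f φ h => by
  change c • F f = c • u φ
  rw [hF f φ h]

lemma Extends.dual_eq {F : StrongDual ℝ N.Space0} {u : 𝓓'(Ω, ℝ)} (h : N.Extends F u) :
    N.dual.toFun u = ‖F‖ₑ :=
  le_antisymm (iInf₂_le F h) (le_iInf₂ fun G hG => by rw [h.unique hG])

lemma Extends.functional_eq {F : StrongDual ℝ N.Space0} {u : 𝓓'(Ω, ℝ)} (h : N.Extends F u) :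
    N.functional u = F := by
  have h' : ∃ F, N.Extends F u := ⟨F, h⟩
  rw [functional, dif_pos h']
  exact h'.choose_spec.unique h

lemma extends_functional (u : N.dual.Space) : N.Extends (N.functional u.dist) u.dist := by
  obtain ⟨F, hF⟩ := iInf_lt_iff.1 (show N.dual.toFun u.dist < ∞ from u.2)
  obtain ⟨hF, -⟩ := iInf_lt_iff.1 hF
  rwa [hF.functional_eq]

lemma norm_functional (u : N.dual.Space) : ‖N.functional u.dist‖ = ‖u‖ := by
  rw [norm_def, (extends_functional u).dual_eq, toReal_enorm]

/-- An element of the dual space as a functional. -/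
def functionalL (N : ExtNorm Ω) : N.dual.Space →L[ℝ] StrongDual ℝ N.Space0 :=
  LinearMap.mkContinuous
    { toFun := fun u => N.functional u.dist
      map_add' := fun u v =>
        Extends.functional_eq ((extends_functional u).add (extends_functional v))
      map_smul' := fun c u => Extends.functional_eq ((extends_functional u).smul c) }
    1 fun u => by
      rw [one_mul]
      exact (norm_functional u).le

end ExtNorm

open ExtNorm

variable (s : ℝ) (p : Exponent)

lemma testNonneg0_dist (hn : 0 < n) (φ : 𝓓(Ω, ℝ)) : (testNonneg0 hn s p φ).toSpace.dist = ofFun Ω φ := rfl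

/-- The restriction to test functions of a functional on `W^{s,p}_0(Ω)`, `s ≥ 0`. -/
def restrictNonneg (hn : 0 < n) (F : StrongDual ℝ (nonneg Ω s p).Space0) : 𝓓'(Ω, ℝ) :=
  (F ∘L testNonneg0 hn s p : 𝓓(Ω, ℝ) →L[ℝ] ℝ)

lemma extends_restrictNonneg (hn : 0 < n) (F : StrongDual ℝ (nonneg Ω s p).Space0) :
    (nonneg Ω s p).Extends F (restrictNonneg s p hn F) := fun f φ h => by
  change F f = F (testNonneg0 hn s p φ)
  rw [Space0.ext (h.trans (testNonneg0_dist s p hn φ).symm)]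

lemma restrictNonneg_mem (hn : 0 < n) (F : StrongDual ℝ (nonneg Ω s p).Space0) :
    restrictNonneg s p hn F ∈ (nonneg Ω s p).dual.finite := by
  change (nonneg Ω s p).dual.toFun _ < ∞
  rw [(extends_restrictNonneg s p hn F).dual_eq]
  exact enorm_lt_top

/-- Functionals on `W^{s,p}_0(Ω)`, `s ≥ 0`, as elements of the dual space. -/
def dualNonneg (hn : 0 < n) : StrongDual ℝ (nonneg Ω s p).Space0 →L[ℝ] (nonneg Ω s p).dual.Space :=
  LinearMap.mkContinuous
    { toFun := fun F => ⟨restrictNonneg s p hn F, restrictNonneg_mem s p hn F⟩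
      map_add' := fun _ _ => rfl
      map_smul' := fun _ _ => rfl }
    1 fun F => by
      rw [one_mul, ← norm_functional]
      exact (congrArg norm (extends_restrictNonneg s p hn F).functional_eq).le

lemma functional_dualNonneg (hn : 0 < n) (F : StrongDual ℝ (nonneg Ω s p).Space0) :
    (nonneg Ω s p).functional (dualNonneg s p hn F).dist = F :=
  (extends_restrictNonneg s p hn F).functional_eq

lemma norm_dualNonneg (hn : 0 < n) (F : StrongDual ℝ (nonneg Ω s p).Space0) :
    ‖dualNonneg s p hn F‖ = ‖F‖ := by
  rw [← norm_functional, functional_dualNonneg]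

lemma dualNonneg_functional (hn : 0 < n) (u : (nonneg Ω s p).dual.Space) :
    dualNonneg s p hn ((nonneg Ω s p).functional u.dist) = u := by
  refine Space.ext ?_
  ext φ
  exact extends_functional u (testNonneg0 hn s p φ) φ (testNonneg0_dist s p hn φ)

variable {s p}

/-- By the symmetry of `∫ φ ψ`, a test function regarded as an element of the dual acts as
evaluation at that test function. -/
lemma extends_eval {f : 𝓓'(Ω, ℝ)} {φ : 𝓓(Ω, ℝ)} (hf : f = ofFun Ω φ) :
    (nonneg Ω s p).Extends (evalNonneg s p φ ∘L Space0.toSpaceL) f := fun g ψ h => by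
  change g.toSpace.dist φ = f ψ
  rw [h, hf, ofFun_test_comm]

lemma test_mem_dual_finite (φ : 𝓓(Ω, ℝ)) : ofFun Ω φ ∈ (nonneg Ω s p).dual.finite := by
  change (nonneg Ω s p).dual.toFun _ < ∞
  rw [(extends_eval rfl).dual_eq]
  exact enorm_lt_top

/-- The test functions are dense in the dual space. -/
lemma mem_closureTest_dual (hn : 0 < n) (u : (nonneg Ω s p).dual.Space) :
    u ∈ (nonneg Ω s p).dual.closureTest := by
  by_contra hu
  -- By reflexivity a functional on the dual that vanishes on test functions is evaluation at some
  -- `x` in `W^{s,p}_0(Ω)`. Then `x` is zero as a distribution, so the functional vanishes.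
  obtain ⟨Ξ, hΞ, hΞu⟩ := exists_dual_eq_zero_of_notMem _
    (Submodule.isClosed_topologicalClosure _) hu
  obtain ⟨x, hx⟩ := bidualSurjective_nonneg_Space0 Ω s p (Ξ ∘L dualNonneg s p hn)
  have hx' : ∀ v : (nonneg Ω s p).dual.Space, Ξ v = (nonneg Ω s p).functional v.dist x := by
    intro v
    rw [← hx]
    change _ = Ξ (dualNonneg s p hn _)
    rw [dualNonneg_functional]
  have hx0 : x = 0 := by
    refine Space0.ext ?_
    ext φ
    let w : (nonneg Ω s p).dual.Space := ⟨ofFun Ω φ, test_mem_dual_finite φ⟩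
    have h1 : Ξ w = 0 := hΞ w (subset_closure (Submodule.subset_span ⟨φ, rfl⟩))
    rw [hx', (extends_eval (f := w.dist) (φ := φ) rfl).functional_eq] at h1
    exact h1
  apply hΞu
  rw [hx', hx0, map_zero]

/-! ### Pairs of spaces in duality -/

/-- A pair of spaces in duality. -/
structure DualPair (N M : ExtNorm Ω) where
  pair : N.Space0 →L[ℝ] StrongDual ℝ M.Space0
  test_left : ∀ φ : 𝓓(Ω, ℝ), ofFun Ω φ ∈ N.finite
  test_right : ∀ φ : 𝓓(Ω, ℝ), ofFun Ω φ ∈ M.finite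
  pair_test_left : ∀ (f : N.Space0) (v : M.Space0) (φ : 𝓓(Ω, ℝ)),
    f.toSpace.dist = ofFun Ω φ → pair f v = v.toSpace.dist φ
  pair_test_right : ∀ (f : N.Space0) (v : M.Space0) (φ : 𝓓(Ω, ℝ)),
    v.toSpace.dist = ofFun Ω φ → pair f v = f.toSpace.dist φ
  exists_repr : ∀ F : StrongDual ℝ N.Space0, ∃ v : M.Space0, (∀ f, pair f v = F f) ∧ ‖v‖ ≤ ‖F‖
  mem_left : ∀ (u : N.Space) (K : Set (Rn n)), IsCompact K → K ⊆ Ω →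
    Distribution.dsupport u.dist ⊆ K → u ∈ N.closureTest
  mem_right : ∀ (u : M.Space) (K : Set (Rn n)), IsCompact K → K ⊆ Ω →
    Distribution.dsupport u.dist ⊆ K → u ∈ M.closureTest

/-- An element of the dual space, as a functional. -/
def functional0 (N : ExtNorm Ω) : N.dual.Space0 →L[ℝ] StrongDual ℝ N.Space0 :=
  N.functionalL ∘L Space0.toSpaceL

lemma functional0_apply {N : ExtNorm Ω} (u : N.dual.Space0) :
    functional0 N u = N.functional u.toSpace.dist := rfl

/-- Functionals as elements of the closure of the test functions in the dual space. -/
def dualNonneg0 (hn : 0 < n) (s : ℝ) (p : Exponent) :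
    StrongDual ℝ (nonneg Ω s p).Space0 →L[ℝ] (nonneg Ω s p).dual.Space0 :=
  (dualNonneg s p hn).codRestrict (nonneg Ω s p).dual.closureTest
    fun _ => mem_closureTest_dual hn _

variable (s p)

/-- `W^{s,p}_0(Ω)` and its dual, `s ≥ 0`. -/
def dualPairNonneg (hn : 0 < n) : DualPair (nonneg Ω s p) (nonneg Ω s p).dual where
  pair := (functional0 (nonneg Ω s p)).flip
  test_left := test_mem_nonneg hn s p
  test_right := test_mem_dual_finite
  pair_test_left f v φ h := extends_functional v.toSpace f φ h
  pair_test_right f v φ h := by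
    change (nonneg Ω s p).functional v.toSpace.dist f = _
    rw [(extends_eval h).functional_eq]
    rfl
  exists_repr F := ⟨dualNonneg0 hn s p F, fun f =>
    congrArg (fun G : StrongDual ℝ _ => G f) (functional_dualNonneg s p hn F),
    (norm_dualNonneg s p hn F).le⟩
  mem_left u _ hK hKΩ hu := mem_closureTest_nonneg hn u hK hKΩ hu
  mem_right u _ _ _ _ := mem_closureTest_dual hn u

/-- The dual of `W^{s,p}_0(Ω)` and `W^{s,p}_0(Ω)`, `s ≥ 0`. -/
def dualPairDual (hn : 0 < n) : DualPair (nonneg Ω s p).dual (nonneg Ω s p) where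
  pair := functional0 (nonneg Ω s p)
  test_left := test_mem_dual_finite
  test_right := test_mem_nonneg hn s p
  pair_test_left f v φ h := by
    change (nonneg Ω s p).functional f.toSpace.dist v = _
    rw [(extends_eval h).functional_eq]
    rfl
  pair_test_right f v φ h := extends_functional f.toSpace v φ h
  exists_repr F := by
    obtain ⟨v, hv⟩ := bidualSurjective_nonneg_Space0 Ω s p (F ∘L dualNonneg0 hn s p)
    have hv' : ∀ G, F (dualNonneg0 hn s p G) = G v := hv
    refine ⟨v, fun f => ?_, ?_⟩
    · rw [functional0_apply, ← hv']
      congr 1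
      exact Subtype.ext (dualNonneg_functional s p hn f.toSpace)
    -- A norming functional `G` for `v`, viewed as an element of the dual, tests `F`.
    · obtain ⟨G, hG1, hG⟩ := exists_dual_vector'' ℝ v
      calc ‖v‖ = G v := hG.symm
        _ = F (dualNonneg0 hn s p G) := (hv' G).symm
        _ ≤ ‖F‖ * ‖dualNonneg0 hn s p G‖ := (le_abs_self _).trans (F.le_opNorm _)
        _ = ‖F‖ * ‖G‖ := congrArg (‖F‖ * ·) (norm_dualNonneg s p hn G)
        _ ≤ ‖F‖ := mul_le_of_le_one_right (norm_nonneg _) hG1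
  mem_left u _ _ _ _ := mem_closureTest_dual hn u
  mem_right u _ hK hKΩ hu := mem_closureTest_nonneg hn u hK hKΩ hu

/-! ### The case `s = 0` -/

lemma nonnegNorm_zero (u : 𝓓'(Ω, ℝ)) : nonnegNorm 0 p u = lpNorm p u := by
  simp [nonnegNorm, deriv_zero]

/-- The embedding of `W^{0,p}(Ω)` in `L^p(Ω)`. -/
def toLpZero (Ω : Opens (Rn n)) (p : Exponent) : (nonneg Ω 0 p).Space →L[ℝ]
    Lp ℝ (ENNReal.ofReal p) (volume.restrict (Ω : Set (Rn n))) :=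
  ContinuousLinearMap.proj (⟨0, zero_mem_lpIndices 0⟩ : lpIndices n 0) ∘L
    ContinuousLinearMap.fst ℝ _ _ ∘L jet Ω 0 p

lemma represents_toLpZero (u : (nonneg Ω 0 p).Space) : Represents (toLpZero Ω p u) u.dist := by
  have := (isJet_jet u).1 ⟨0, zero_mem_lpIndices 0⟩
  rwa [deriv_zero] at this

lemma norm_toLpZero (u : (nonneg Ω 0 p).Space) : ‖toLpZero Ω p u‖ = ‖u‖ := by
  rw [norm_def, Lp.norm_def, ← lpNorm_eq (represents_toLpZero p u)]
  exact congrArg ENNReal.toReal (nonnegNorm_zero p u.dist).symm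

/-- `L^{p'}(Ω)` is the dual of `L^p(Ω)`. -/
lemma nonneg_zero_conj (hn : 0 < n) : nonneg Ω 0 p.conj = (nonneg Ω 0 p).dual := by
  suffices h : ∀ u, (nonneg Ω 0 p.conj).toFun u = (nonneg Ω 0 p).dual.toFun u by
    have : ∀ {N M : ExtNorm Ω}, N.toFun = M.toFun → N = M := by
      rintro ⟨_, _, _⟩ ⟨_, _, _⟩ rfl
      rfl
    exact this (funext h)
  intro u
  set μ := volume.restrict (Ω : Set (Rn n))
  have key : ∀ (G : Lp ℝ (ENNReal.ofReal p.conj) μ) (f : 𝓓'(Ω, ℝ)) (φ : 𝓓(Ω, ℝ))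
      (g : Lp ℝ (ENNReal.ofReal p) μ), Represents g f → f = ofFun Ω φ →
      Lp.conjPairing μ (ENNReal.ofReal p.conj) (ENNReal.ofReal p) G g = ofFun Ω G φ := by
    intro G f φ g hg hf
    rw [Lp.conjPairing_apply, ofFun_apply_eq_setIntegral ⟨locallyIntegrableOn_Lp G, rfl⟩]
    refine integral_congr_ae ?_
    filter_upwards [hg.ae_eq (hf ▸ represents_test φ)] with x hx
    rw [hx, mul_comm]
  refine le_antisymm (le_iInf₂ fun F hF => ?_) ?_
  -- `F` extends to all of `L^p` without increase of norm, because the embedding is isometric, and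
  -- the Riesz theorem supplies the function `G`. The reverse inequality below is Hölder's.
  · obtain ⟨Φ, hΦ, hΦn⟩ := exists_dual_comp_eq (toLpZero Ω p ∘L Space0.toSpaceL)
      (fun f g h => Space0.ext (by
        rw [(represents_toLpZero p f.toSpace).2, (represents_toLpZero p g.toSpace).2]
        exact congrArg (fun e : Lp ℝ (ENNReal.ofReal p) μ => ofFun Ω e) h))
      zero_le_one (fun f => by
        rw [one_mul]
        exact (norm_toLpZero p f.toSpace).ge) F
    obtain ⟨G, hG, hGn⟩ := Lp.exists_conjPairing_eq p.toReal_holderConjugate Φ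
    have hu : u = ofFun Ω G := by
      ext φ
      rw [← hF (testNonneg0 hn 0 p φ) φ rfl, ← hΦ, ← hG]
      exact key G _ φ _ (represents_toLpZero p _) rfl
    change nonnegNorm 0 p.conj u ≤ _
    rw [nonnegNorm_zero, lpNorm_eq ⟨locallyIntegrableOn_Lp G, hu⟩, ← Lp.enorm_def, ← ofReal_norm,
      ← ofReal_norm]
    refine ENNReal.ofReal_le_ofReal (hGn.trans ?_)
    rwa [mul_one] at hΦn
  · change _ ≤ nonnegNorm 0 p.conj u
    rw [nonnegNorm_zero]
    by_cases hu : lpNorm p.conj u < ∞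
    · obtain ⟨G, hG⟩ := exists_Lp_represents hu
      have hext : (nonneg Ω 0 p).Extends (Lp.conjPairing μ (ENNReal.ofReal p.conj)
          (ENNReal.ofReal p) G ∘L toLpZero Ω p ∘L Space0.toSpaceL) u := by
        intro f φ hf
        rw [hG.2]
        exact key G _ φ _ (represents_toLpZero p f.toSpace) hf
      rw [hext.dual_eq, lpNorm_eq hG, ← Lp.enorm_def, ← ofReal_norm, ← ofReal_norm]
      refine ENNReal.ofReal_le_ofReal (ContinuousLinearMap.opNorm_le_bound _ (norm_nonneg _)
        fun f => ?_)
      have h1 := Lp.norm_conjPairing_apply_le (p := ENNReal.ofReal p.conj) (q := ENNReal.ofReal p)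
        G (toLpZero Ω p f.toSpace)
      rw [norm_toLpZero] at h1
      exact h1
    · rw [not_lt.1 hu |> top_le_iff.1]
      exact le_top

/-! ### The duality of `W^{s,p}_0(Ω)` and `W^{-s,p'}_0(Ω)` -/

/-- `A` and `B` are variables so that the outcome of the case distinction in `sobolev` can be
substituted into the types that depend on them. For `s = 0` neither norm is a dual by definition;
`nonneg_zero_conj` rewrites the second as the dual of the first. -/
lemma exists_dualPair (hn : 0 < n) (A B : ExtNorm Ω) (hA : A = sobolev Ω s p) (hB : B = sobolev Ω (-s) p.conj) :
    ∃ P : DualPair A B, ∀ f u, P.pair f u =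
      if 0 ≤ s then A.functional u.toSpace.dist f else B.functional f.toSpace.dist u := by
  unfold sobolev at hA hB
  rcases lt_trichotomy s 0 with hs | rfl | hs
  · rw [if_neg hs.not_ge] at hA
    rw [if_pos (neg_nonneg.2 hs.le)] at hB
    subst hA hB
    exact ⟨dualPairDual _ _ hn, fun f u => by rw [if_neg hs.not_ge]; rfl⟩
  · rw [if_pos le_rfl] at hA
    rw [neg_zero, if_pos le_rfl, nonneg_zero_conj _ hn] at hB
    subst hA hB
    exact ⟨dualPairNonneg _ _ hn, fun f u => by rw [if_pos le_rfl]; rfl⟩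
  · rw [if_pos hs.le] at hA
    rw [if_neg (by linarith), neg_neg, Exponent.conj_conj] at hB
    subst hA hB
    exact ⟨dualPairNonneg _ _ hn, fun f u => by rw [if_pos hs.le]; rfl⟩

end SobolevSlobodeckij
end

noncomputable section

namespace SobolevSlobodeckij

variable {n : ℕ} {Ω : Opens (Rn n)}

open ExtNorm

/-! ### Continuous linear maps and bounded sets in `W^{s,p}_comp(Ω)` -/

namespace WComp

variable {s : ℝ} {p : Exponent}

lemma continuous_ofWK {K : Compacts (Rn n)} (hK : (K : Set (Rn n)) ⊆ Ω) :
    Continuous (ofWK hK : WK s p Ω K → WComp s p Ω) :=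
  continuous_sInf_rng.2 fun _ ht => ht.1 K hK

/-- A linear map on the inductive limit is continuous if its restrictions are. -/
lemma continuous_of_continuous_comp {E : Type*} [AddCommGroup E] [Module ℝ E]
    [TopologicalSpace E] [IsTopologicalAddGroup E] [ContinuousSMul ℝ E] [LocallyConvexSpace ℝ E]
    (L : WComp s p Ω →ₗ[ℝ] E)
    (hL : ∀ (K : Compacts (Rn n)) (hK : (K : Set (Rn n)) ⊆ Ω), Continuous fun u => L (ofWK hK u)) :
    Continuous L := by
  -- The topology induced by `L` is one of the locally convex topologies over which the infimum is
  -- taken.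
  refine continuous_iff_le_induced.2 (sInf_le ⟨fun K hK => ?_, ?_, ?_, ?_⟩)
  · exact continuous_induced_rng.2 (hL K hK)
  · exact topologicalAddGroup_induced L
  · exact continuousSMul_induced L
  · exact LocallyConvexSpace.induced L

/-- The inclusion of `W^{s,p}_comp(Ω)` in `W^{s,p}(Ω)`. -/
def toWL (s : ℝ) (p : Exponent) (Ω : Opens (Rn n)) : WComp s p Ω →L[ℝ] W s p Ω :=
  ⟨(compactSupport s p Ω).subtype, continuous_of_continuous_comp
    (E := W s p Ω) (compactSupport s p Ω).subtype fun _ _ => continuous_subtype_val⟩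

lemma exists_compact (f : WComp s p Ω) : ∃ K : Compacts (Rn n), (K : Set (Rn n)) ⊆ Ω ∧
    Distribution.dsupport f.toW.dist ⊆ K := f.2

end WComp

/-- A sequence of compact subsets of `Ω` that contain every compact subset of `Ω`. -/
lemma exists_compact_exhaustion (Ω : Opens (Rn n)) : ∃ K : ℕ → Compacts (Rn n), Monotone K ∧
    (∀ j, (K j : Set (Rn n)) ⊆ Ω) ∧
    ∀ L : Set (Rn n), IsCompact L → L ⊆ Ω → ∃ j, L ⊆ K j := by
  have : LocallyCompactSpace Ω := Ω.isOpen.locallyCompactSpace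
  let E : CompactExhaustion Ω := default
  refine ⟨fun j => ⟨Subtype.val '' E j, (E.isCompact j).image continuous_subtype_val⟩,
    fun i j h => Set.image_mono (E.subset h), fun j => Set.image_subset_iff.2 fun x _ => x.2, fun L hL hLΩ => ?_⟩
  have hL' : IsCompact (Subtype.val ⁻¹' L : Set Ω) := by
    rwa [Subtype.isCompact_iff, Set.image_preimage_eq_of_subset]
    exact fun x hx => ⟨⟨x, hLΩ hx⟩, rfl⟩
  obtain ⟨j, hj⟩ := E.exists_superset_of_isCompact hL'
  exact ⟨j, fun x hx => ⟨⟨x, hLΩ hx⟩, hj hx, rfl⟩⟩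

/-- A pair of spaces in duality on which the test functions act by multiplication. -/
structure LocalDuality (s : ℝ) (p : Exponent) (Ω : Opens (Rn n)) extends
    DualPair (sobolev Ω s p) (sobolev Ω (-s) p.conj) where
  mulLeft : 𝓓(Ω, ℝ) → W s p Ω →L[ℝ] W0 s p Ω
  mulRight : 𝓓(Ω, ℝ) → W (-s) p.conj Ω →L[ℝ] W0 (-s) p.conj Ω
  mulLeft_dist : ∀ φ u, (mulLeft φ u).toSpace.dist = mulDist φ u.dist
  mulRight_dist : ∀ φ u, (mulRight φ u).toSpace.dist = mulDist φ u.dist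

/-- Multiplication by a test function maps to the closure of the test functions. -/
lemma exists_mul_Space0 {N : ExtNorm Ω}
    (hN : ∀ (u : N.Space) (K : Set (Rn n)), IsCompact K → K ⊆ Ω →
      Distribution.dsupport u.dist ⊆ K → u ∈ N.closureTest) (φ : 𝓓(Ω, ℝ))
    (h : ∃ m : N.Space →L[ℝ] N.Space, ∀ u, (m u).dist = mulDist φ u.dist) :
    ∃ m : N.Space →L[ℝ] N.Space0, ∀ u, (m u).toSpace.dist = mulDist φ u.dist := by
  obtain ⟨m, hm⟩ := h
  exact ⟨m.codRestrict N.closureTest fun u => hN _ (tsupport φ) φ.hasCompactSupport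
    φ.tsupport_subset (by rw [hm]; exact dsupport_mulDist_subset φ u.dist), hm⟩

lemma DualPair.exists_localDuality {s : ℝ} {p : Exponent}
    (P : DualPair (sobolev Ω s p) (sobolev Ω (-s) p.conj))
    (h₁ : IsSmoothMultiplicationTriple s p Ω) (h₂ : IsSmoothMultiplicationTriple (-s) p.conj Ω) :
    ∃ Q : LocalDuality s p Ω, Q.pair = P.pair := by
  choose m hm using fun φ => exists_mul_Space0 P.mem_left φ (h₁ φ)
  choose m' hm' using fun φ => exists_mul_Space0 P.mem_right φ (h₂ φ)
  exact ⟨{ P with mulLeft := m, mulRight := m', mulLeft_dist := hm, mulRight_dist := hm' }, rfl⟩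

/-! ### Independence of the cutoff and continuity of `T(u)` -/

namespace LocalDuality

variable {s : ℝ} {p : Exponent} (P : LocalDuality s p Ω)

/-- Multiplication by a test function is self-adjoint. -/
lemma pair_mulLeft (η : 𝓓(Ω, ℝ)) (f : W0 s p Ω) (v : W0 (-s) p.conj Ω) :
    P.pair (P.mulLeft η f.toSpace) v = P.pair f (P.mulRight η v.toSpace) := by
  -- Both sides are continuous in `f`, and for a test function `f = φ` both equal `v(η φ)`.
  have h := Continuous.ext_on (dense_test (sobolev Ω s p))
    (f := fun f => P.pair (P.mulLeft η f.toSpace) v)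
    (g := fun f => P.pair f (P.mulRight η v.toSpace))
    (((P.pair.flip v).comp ((P.mulLeft η).comp Space0.toSpaceL)).continuous)
    (P.pair.flip (P.mulRight η v.toSpace)).continuous fun f hf => by
      obtain ⟨φ, hφ⟩ := hf
      dsimp only
      rw [P.pair_test_left f _ φ hφ, P.mulRight_dist,
        P.pair_test_left _ v (mulTest η φ) (by rw [P.mulLeft_dist, hφ, mulDist_ofFun])]
      rfl
  exact congrFun h f

lemma memW0_left (P : LocalDuality s p Ω) (f : WComp s p Ω) : MemW0 f.toW := by
  obtain ⟨K, hK, hf⟩ := f.exists_compact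
  exact P.mem_left _ K K.isCompact hK hf

lemma memW0_right (P : LocalDuality s p Ω) (ψ : 𝓓(Ω, ℝ)) (u : WLoc (-s) p.conj Ω) : MemW0 (u.mul ψ) :=
  P.mem_right _ (tsupport ψ) ψ.hasCompactSupport ψ.tsupport_subset (dsupport_mulDist_subset ψ _)

/-- The pairing of `ψ u` and `f`. -/
def form (ψ : 𝓓(Ω, ℝ)) (u : WLoc (-s) p.conj Ω) (f : WComp s p Ω) : ℝ :=
  P.pair (P.memW0_left f).toW0 (P.memW0_right ψ u).toW0

lemma mulLeft_eq_self {ψ : 𝓓(Ω, ℝ)} {f : WComp s p Ω} (h : IsCutoff ψ f.toW.dist) :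
    P.mulLeft ψ f.toW = (P.memW0_left f).toW0 :=
  Space0.ext (by rw [P.mulLeft_dist, mulDist_eq_self h]; rfl)

/-- `⟨ψ u, f⟩ = ⟨ψ η u, f⟩ = ⟨η u, ψ f⟩ = ⟨η u, f⟩`, since `ψ η = ψ` and `ψ f = f`. -/
lemma form_eq_of_eq_one {ψ η : 𝓓(Ω, ℝ)} {u : WLoc (-s) p.conj Ω} {f : WComp s p Ω}
    (hψ : IsCutoff ψ f.toW.dist) (hη : ∀ x ∈ tsupport ψ, η x = 1) :
    P.form ψ u f = P.form η u f := by
  have h : (P.memW0_right ψ u).toW0 = P.mulRight ψ (P.memW0_right η u).toW0.toSpace := by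
    refine Space0.ext ?_
    rw [P.mulRight_dist]
    change mulDist ψ u.dist = mulDist ψ (mulDist η u.dist)
    rw [mulDist_mulDist, mulTest_comm, mulTest_eq_self hη]
  rw [form, h, ← P.pair_mulLeft]
  change P.pair (P.mulLeft ψ f.toW) _ = _
  rw [P.mulLeft_eq_self hψ]
  rfl

/-- Both cutoffs are compared with a third one that is `1` on both of their supports. -/
lemma form_eq {ψ χ : 𝓓(Ω, ℝ)} {u : WLoc (-s) p.conj Ω} {f : WComp s p Ω}
    (hψ : IsCutoff ψ f.toW.dist) (hχ : IsCutoff χ f.toW.dist) : P.form ψ u f = P.form χ u f := by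
  obtain ⟨η, U, -, hU, -, hη⟩ := exists_cutoff
    (ψ.hasCompactSupport.isCompact.union χ.hasCompactSupport.isCompact)
    (Set.union_subset ψ.tsupport_subset χ.tsupport_subset)
  rw [P.form_eq_of_eq_one hψ fun x hx => hη x (hU (Or.inl hx)),
    P.form_eq_of_eq_one hχ fun x hx => hη x (hU (Or.inr hx))]

/-- A test function that is a cutoff for all distributions supported in `K`. -/
lemma exists_isCutoff {K : Set (Rn n)} (hK : IsCompact K) (hKΩ : K ⊆ Ω) :
    ∃ ψ : 𝓓(Ω, ℝ), ∀ u : 𝓓'(Ω, ℝ), Distribution.dsupport u ⊆ K → IsCutoff ψ u := by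
  obtain ⟨ψ, U, hU, hKU, -, h⟩ := exists_cutoff hK hKΩ
  exact ⟨ψ, fun u hu => ⟨U, hU, hu.trans hKU, h⟩⟩

lemma exists_isCutoff_comp (f : WComp s p Ω) : ∃ ψ : 𝓓(Ω, ℝ), IsCutoff ψ f.toW.dist := by
  obtain ⟨K, hK, hf⟩ := f.exists_compact
  obtain ⟨ψ, hψ⟩ := exists_isCutoff K.isCompact hK
  exact ⟨ψ, hψ _ hf⟩

lemma form_add_left (ψ : 𝓓(Ω, ℝ)) (u v : WLoc (-s) p.conj Ω) (f : WComp s p Ω) :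
    P.form ψ (u + v) f = P.form ψ u f + P.form ψ v f := by
  have : (P.memW0_right ψ (u + v)).toW0 =
      (P.memW0_right ψ u).toW0 + (P.memW0_right ψ v).toW0 :=
    Subtype.ext ((WLoc.mulL ψ).map_add u v)
  rw [form, this, map_add]
  rfl

lemma form_smul_left (ψ : 𝓓(Ω, ℝ)) (c : ℝ) (u : WLoc (-s) p.conj Ω) (f : WComp s p Ω) :
    P.form ψ (c • u) f = c * P.form ψ u f := by
  have : (P.memW0_right ψ (c • u)).toW0 = c • (P.memW0_right ψ u).toW0 :=
    Subtype.ext ((WLoc.mulL ψ).map_smul c u)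
  rw [form, this, map_smul]
  rfl

lemma form_add_right (ψ : 𝓓(Ω, ℝ)) (u : WLoc (-s) p.conj Ω) (f g : WComp s p Ω) :
    P.form ψ u (f + g) = P.form ψ u f + P.form ψ u g := by
  have : (P.memW0_left (f + g)).toW0 = (P.memW0_left f).toW0 + (P.memW0_left g).toW0 := rfl
  rw [form, this, map_add]
  rfl

lemma form_smul_right (ψ : 𝓓(Ω, ℝ)) (u : WLoc (-s) p.conj Ω) (c : ℝ) (f : WComp s p Ω) :
    P.form ψ u (c • f) = c * P.form ψ u f := by
  have : (P.memW0_left (c • f)).toW0 = c • (P.memW0_left f).toW0 := rfl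
  rw [form, this, map_smul]
  rfl

/-- The functional `f ↦ ⟨ψ_f u, f⟩` as a linear map. -/
def toDualₗ (u : WLoc (-s) p.conj Ω) : WComp s p Ω →ₗ[ℝ] ℝ where
  toFun f := P.form (exists_isCutoff_comp f).choose u f
  map_add' f g := by
    obtain ⟨K, hK, hf⟩ := f.exists_compact
    obtain ⟨L, hL, hg⟩ := g.exists_compact
    obtain ⟨ψ, hψ⟩ := exists_isCutoff (K.isCompact.union L.isCompact) (Set.union_subset hK hL)
    have hf' := hf.trans (Set.subset_union_left (t := (L : Set (Rn n))))
    have hg' := hg.trans (Set.subset_union_right (s := (K : Set (Rn n))))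
    rw [P.form_eq (exists_isCutoff_comp f).choose_spec (hψ _ hf'),
      P.form_eq (exists_isCutoff_comp g).choose_spec (hψ _ hg'),
      P.form_eq (exists_isCutoff_comp (f + g)).choose_spec
        (hψ _ (dsupport_add_subset (u := f.toW.dist) (v := g.toW.dist) hf' hg')), form_add_right]
  map_smul' c f := by
    obtain ⟨K, hK, hf⟩ := f.exists_compact
    obtain ⟨ψ, hψ⟩ := exists_isCutoff K.isCompact hK
    rw [P.form_eq (exists_isCutoff_comp f).choose_spec (hψ _ hf),
      P.form_eq (exists_isCutoff_comp (c • f)).choose_spec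
        (hψ _ ((dsupport_smul_subset c f.toW.dist).trans hf)), form_smul_right]
    rfl

lemma toDualₗ_apply {ψ : 𝓓(Ω, ℝ)} {f : WComp s p Ω} (h : IsCutoff ψ f.toW.dist)
    (u : WLoc (-s) p.conj Ω) : P.toDualₗ u f = P.form ψ u f :=
  P.form_eq (exists_isCutoff_comp f).choose_spec h

lemma form_eq_pair {ψ : 𝓓(Ω, ℝ)} {f : WComp s p Ω} (h : IsCutoff ψ f.toW.dist)
    (χ : 𝓓(Ω, ℝ)) (u : WLoc (-s) p.conj Ω) :
    P.form χ u f = P.pair (P.mulLeft ψ f.toW) (P.memW0_right χ u).toW0 := by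
  rw [P.mulLeft_eq_self h]
  rfl

/-- On `W^{s,p}_K(Ω)` one cutoff `ψ` serves all elements. There `f = ψ f`, so bounded multiplication
by `ψ` provides a continuous map into `W^{s,p}_0(Ω)`, where the pairing is continuous. -/
lemma continuous_toDualₗ (u : WLoc (-s) p.conj Ω) : Continuous (P.toDualₗ u) := by
  refine WComp.continuous_of_continuous_comp _ fun K hK => ?_
  obtain ⟨ψ, hψ⟩ := exists_isCutoff K.isCompact hK
  have h : (fun f => P.toDualₗ u (WComp.ofWK hK f)) = (P.pair.flip (P.memW0_right ψ u).toW0 ∘L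
      P.mulLeft ψ ∘L (WK s p Ω K).subtypeL) := by
    ext f
    have hf : IsCutoff ψ (WComp.ofWK hK f).toW.dist := hψ _ f.2
    rw [P.toDualₗ_apply hf, P.form_eq_pair hf]
    rfl
  rw [h]
  exact ContinuousLinearMap.continuous _

/-- The map `T`, as a linear map. -/
def toDual : WLoc (-s) p.conj Ω →ₗ[ℝ] StrongDual ℝ (WComp s p Ω) where
  toFun u := ⟨P.toDualₗ u, P.continuous_toDualₗ u⟩
  map_add' u v := by
    ext f
    exact P.form_add_left (exists_isCutoff_comp f).choose u v f
  map_smul' c u := by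
    ext f
    exact P.form_smul_left (exists_isCutoff_comp f).choose c u f

lemma toDual_apply {ψ : 𝓓(Ω, ℝ)} {f : WComp s p Ω} (h : IsCutoff ψ f.toW.dist)
    (u : WLoc (-s) p.conj Ω) : P.toDual u f = P.form ψ u f :=
  P.toDualₗ_apply h u

/-! ### Bijectivity of `T` and continuity of its inverse -/

/-- The inclusion of the test functions in `W^{s,p}_comp(Ω)`. -/
def testComp : 𝓓(Ω, ℝ) →ₗ[ℝ] WComp s p Ω where
  toFun φ := ⟨⟨ofFun Ω φ, P.test_left φ⟩, ⟨tsupport φ, φ.hasCompactSupport⟩, φ.tsupport_subset,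
    dsupport_ofFun_subset φ⟩
  map_add' φ ψ := Subtype.ext (Space.ext (map_add (ofTest Ω) φ ψ))
  map_smul' c φ := Subtype.ext (Space.ext (map_smul (ofTest Ω) c φ))

lemma testComp_dist (φ : 𝓓(Ω, ℝ)) : (P.testComp φ).toW.dist = ofFun Ω φ := rfl

/-- `⟨ψ u, φ⟩ = u(ψ φ) = u(φ)`. Thus `u` can be recovered from `T(u)`, and the only candidate for
the preimage of a functional is its restriction to test functions. -/
lemma toDual_testComp (u : WLoc (-s) p.conj Ω) (φ : 𝓓(Ω, ℝ)) :
    P.toDual u (P.testComp φ) = u.dist φ := by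
  obtain ⟨ψ, U, hU, hφU, -, hψ⟩ := exists_cutoff φ.hasCompactSupport φ.tsupport_subset
  have hsub : Distribution.dsupport (P.testComp φ).toW.dist ⊆ U :=
    subset_trans (dsupport_ofFun_subset φ) hφU
  rw [P.toDual_apply ⟨U, hU, hsub, hψ⟩, form,
    P.pair_test_left (P.memW0_left (P.testComp φ)).toW0 _ φ (P.testComp_dist φ)]
  change u.dist (mulTest ψ φ) = _
  rw [mulTest_eq_self fun x hx => hψ x (hφU hx)]

lemma injective_toDual : Function.Injective P.toDual := by
  intro u v h
  refine Subtype.ext ?_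
  change u.dist = v.dist
  ext φ
  rw [← P.toDual_testComp, h, P.toDual_testComp]

/-- Multiplication by a test function, as a map to `W^{s,p}_comp(Ω)`. -/
def mulComp (ψ : 𝓓(Ω, ℝ)) : W0 s p Ω →L[ℝ] WComp s p Ω where
  toFun f := ⟨(P.mulLeft ψ f.toSpace).toSpace, ⟨tsupport ψ, ψ.hasCompactSupport⟩,
    ψ.tsupport_subset, by
      change Distribution.dsupport (P.mulLeft ψ f.toSpace).toSpace.dist ⊆ _
      rw [P.mulLeft_dist]
      exact dsupport_mulDist_subset ψ _⟩
  map_add' f g := Subtype.ext (congrArg Space0.toSpace (map_add (P.mulLeft ψ) f.toSpace g.toSpace))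
  map_smul' c f := Subtype.ext (congrArg Space0.toSpace (map_smul (P.mulLeft ψ) c f.toSpace))
  cont := by
    -- The map factors through the normed space `W^{s,p}_K(Ω)` with `K` the support of `ψ`.
    refine (WComp.continuous_ofWK (K := ⟨tsupport ψ, ψ.hasCompactSupport⟩)
      ψ.tsupport_subset).comp (Continuous.subtype_mk
        (Space0.toSpaceL ∘L P.mulLeft ψ ∘L Space0.toSpaceL).continuous fun f => ?_)
    change Distribution.dsupport (P.mulLeft ψ f.toSpace).toSpace.dist ⊆ _
    rw [P.mulLeft_dist]
    exact dsupport_mulDist_subset ψ _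

lemma mulComp_dist (ψ : 𝓓(Ω, ℝ)) (f : W0 s p Ω) :
    (P.mulComp ψ f).toW.dist = mulDist ψ f.toSpace.dist := P.mulLeft_dist ψ f.toSpace

lemma mulComp_eq_self {ψ : 𝓓(Ω, ℝ)} {f : WComp s p Ω} (h : IsCutoff ψ f.toW.dist) :
    P.mulComp ψ (P.memW0_left f).toW0 = f := by
  refine Subtype.ext (Space.ext ?_)
  exact (P.mulComp_dist ψ _).trans (mulDist_eq_self h)

/-- A continuous functional is represented by a distribution, locally in `W^{-s,p'}(Ω)`. -/
lemma exists_local_repr (L : StrongDual ℝ (WComp s p Ω)) (ψ : 𝓓(Ω, ℝ)) :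
    ∃ v : W0 (-s) p.conj Ω, (∀ f, P.pair f v = L (P.mulComp ψ f)) ∧
      (∀ φ, v.toSpace.dist φ = L (P.testComp (mulTest ψ φ))) ∧ ‖v‖ ≤ ‖L ∘L P.mulComp ψ‖ := by
  obtain ⟨v, hv, hvn⟩ := P.exists_repr (L ∘L P.mulComp ψ)
  refine ⟨v, hv, fun φ => ?_, hvn⟩
  let f : W0 s p Ω := (P.memW0_left (P.testComp φ)).toW0
  rw [← P.pair_test_left f v φ (P.testComp_dist φ), hv]
  change L _ = L _
  congr 1
  refine Subtype.ext (Space.ext ?_)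
  exact (P.mulComp_dist ψ f).trans (mulDist_ofFun ψ φ)

/-- On test functions supported in `K`, with `ψ = 1` near `K`, one has `L(φ) = L(ψ φ) = v(φ)` for
the distribution `v` that represents `L` locally. -/
lemma continuous_testComp (L : StrongDual ℝ (WComp s p Ω)) :
    Continuous (L.toLinearMap ∘ₗ P.testComp) := by
  rw [TestFunction.continuous_iff_continuous_comp]
  intro K hK
  obtain ⟨ψ, U, -, hKU, -, hψ⟩ := exists_cutoff K.isCompact hK
  obtain ⟨v, -, hv, -⟩ := P.exists_local_repr L ψ
  have h : ((L.toLinearMap ∘ₗ P.testComp) ∘ TestFunction.ofSupportedIn hK) =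
      fun φ => v.toSpace.dist (TestFunction.ofSupportedIn hK φ) := by
    ext φ
    rw [hv, mulTest_eq_self fun x hx => hψ x (hKU (φ.tsupport_subset hx))]
    rfl
  rw [h]
  exact v.toSpace.dist.continuous.comp (TestFunction.continuous_ofSupportedIn hK)

/-- The distribution that represents a continuous functional. -/
def ofDual (L : StrongDual ℝ (WComp s p Ω)) : 𝓓'(Ω, ℝ) :=
  (⟨L.toLinearMap ∘ₗ P.testComp, P.continuous_testComp L⟩ : 𝓓(Ω, ℝ) →L[ℝ] ℝ)

lemma exists_mulDist_ofDual (L : StrongDual ℝ (WComp s p Ω)) (ψ : 𝓓(Ω, ℝ)) :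
    ∃ v : W0 (-s) p.conj Ω, (∀ f, P.pair f v = L (P.mulComp ψ f)) ∧
      v.toSpace.dist = mulDist ψ (P.ofDual L) ∧ ‖v‖ ≤ ‖L ∘L P.mulComp ψ‖ := by
  obtain ⟨v, h1, h2, h3⟩ := P.exists_local_repr L ψ
  refine ⟨v, h1, ?_, h3⟩
  ext φ
  exact h2 φ

/-- The element of `W^{-s,p'}_loc(Ω)` that represents a continuous functional. -/
def locOfDual (L : StrongDual ℝ (WComp s p Ω)) : WLoc (-s) p.conj Ω :=
  ⟨P.ofDual L, fun ψ => by
    obtain ⟨v, -, h, -⟩ := P.exists_mulDist_ofDual L ψ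
    rw [← h]
    exact v.toSpace.2⟩

/-- With `u` the restriction of `L` to test functions and `ψ` a cutoff for `f`, `⟨ψ u, f⟩ = L(ψ f) =
L(f)`. -/
lemma toDual_locOfDual (L : StrongDual ℝ (WComp s p Ω)) : P.toDual (P.locOfDual L) = L := by
  ext f
  obtain ⟨ψ, hψ⟩ := exists_isCutoff_comp f
  obtain ⟨v, h1, h2, -⟩ := P.exists_mulDist_ofDual L ψ
  have hv : (P.memW0_right ψ (P.locOfDual L)).toW0 = v := Space0.ext h2.symm
  rw [P.toDual_apply hψ, form, hv, h1, P.mulComp_eq_self hψ]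

lemma norm_mul_locOfDual_le (L : StrongDual ℝ (WComp s p Ω)) (ψ : 𝓓(Ω, ℝ)) :
    ‖(P.locOfDual L).mul ψ‖ ≤ ‖L ∘L P.mulComp ψ‖ := by
  obtain ⟨v, -, h2, h3⟩ := P.exists_mulDist_ofDual L ψ
  have hv : (P.locOfDual L).mul ψ = v.toSpace := Space.ext h2.symm
  rw [hv]
  exact h3

/-- The map `T`, as a linear equivalence. -/
def toDualEquiv : WLoc (-s) p.conj Ω ≃ₗ[ℝ] StrongDual ℝ (WComp s p Ω) :=
  LinearEquiv.ofBijective P.toDual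
    ⟨P.injective_toDual, fun L => ⟨P.locOfDual L, P.toDual_locOfDual L⟩⟩

lemma toDualEquiv_apply (u : WLoc (-s) p.conj Ω) : P.toDualEquiv u = P.toDual u := rfl

lemma toDualEquiv_symm_apply (L : StrongDual ℝ (WComp s p Ω)) :
    P.toDualEquiv.symm L = P.locOfDual L := by
  rw [LinearEquiv.symm_apply_eq, toDualEquiv_apply, toDual_locOfDual]

/-- The seminorm of the preimage of `L` at `ψ` is at most the norm of `f ↦ L(ψ f)` on
`W^{s,p}_0(Ω)`. That norm is a strongly continuous seminorm of `L`, since precomposition with a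
continuous linear map is continuous for the strong topologies. -/
lemma continuous_toDualEquiv_symm : Continuous P.toDualEquiv.symm := by
  refine WithSeminorms.continuous_of_continuous_comp WLoc.withSeminorms
    P.toDualEquiv.symm.toLinearMap fun ψ => ?_
  refine Seminorm.continuous_of_le (q := (normSeminorm ℝ (StrongDual ℝ (W0 s p Ω))).comp
    (ContinuousLinearMap.precomp ℝ (P.mulComp ψ)).toLinearMap) ?_ fun L => ?_
  · exact (continuous_norm (E := StrongDual ℝ (W0 s p Ω))).comp
      (ContinuousLinearMap.precomp ℝ (P.mulComp ψ)).continuous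
  · change ‖(P.toDualEquiv.symm L).mul ψ‖ ≤ ‖L ∘L P.mulComp ψ‖
    rw [toDualEquiv_symm_apply]
    exact P.norm_mul_locOfDual_le L ψ

/-! ### Bounded sets and continuity of `T` -/

/-- Evaluation at a test function is continuous. -/
lemma exists_apply_le (P : LocalDuality s p Ω) (φ : 𝓓(Ω, ℝ)) :
    ∃ C : ℝ, 0 ≤ C ∧ ∀ f : W0 s p Ω, ‖f.toSpace.dist φ‖ ≤ C * ‖f‖ := by
  let v : W0 (-s) p.conj Ω := ⟨⟨ofFun Ω φ, P.test_right φ⟩,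
    subset_closure (Submodule.subset_span ⟨φ, rfl⟩)⟩
  refine ⟨‖P.pair.flip v‖, norm_nonneg _, fun f => ?_⟩
  have h : P.pair.flip v f = f.toSpace.dist φ := P.pair_test_right f v φ rfl
  rw [← h]
  exact ContinuousLinearMap.le_opNorm _ _

/-- Evaluation at a sequence of test functions that leaves every compact set. -/
lemma exists_eval_seq (P : LocalDuality s p Ω) {φ : ℕ → 𝓓(Ω, ℝ)}
    (hφ : ∀ L : Set (Rn n), IsCompact L → L ⊆ Ω → ∃ m, ∀ u : 𝓓'(Ω, ℝ),
      Distribution.dsupport u ⊆ L → ∀ j, m ≤ j → u (φ j) = 0) :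
    ∃ E : WComp s p Ω →L[ℝ] BoundedContinuousFunction ℕ ℝ, ∀ f j, E f j = f.toW.dist (φ j) := by
  -- For distributions supported in `L` only the first `m` values can be nonzero, so a finite sum
  -- bounds the whole sequence. This gives continuity into the bounded sequences on each
  -- `W^{s,p}_K(Ω)`.
  have hb : ∀ L : Set (Rn n), IsCompact L → L ⊆ Ω → ∃ m, ∀ u : 𝓓'(Ω, ℝ),
      Distribution.dsupport u ⊆ L → ∀ j, ‖u (φ j)‖ ≤ ∑ i ∈ Finset.range m, ‖u (φ i)‖ := by
    intro L hL hLΩ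
    obtain ⟨m, hm⟩ := hφ L hL hLΩ
    refine ⟨m, fun u hu j => ?_⟩
    rcases lt_or_ge j m with h | h
    · exact Finset.single_le_sum (f := fun i => ‖u (φ i)‖) (fun _ _ => norm_nonneg _)
        (Finset.mem_range.2 h)
    · rw [hm u hu j h, norm_zero]
      exact Finset.sum_nonneg fun _ _ => norm_nonneg _
  have hf : ∀ f : WComp s p Ω, ∃ C, ∀ j, ‖f.toW.dist (φ j)‖ ≤ C := by
    intro f
    obtain ⟨K, hK, hf⟩ := f.exists_compact
    obtain ⟨m, hm⟩ := hb K K.isCompact hK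
    exact ⟨_, hm _ hf⟩
  let E : WComp s p Ω →ₗ[ℝ] BoundedContinuousFunction ℕ ℝ :=
    { toFun := fun f => BoundedContinuousFunction.ofNormedAddCommGroupDiscrete
        (fun j => f.toW.dist (φ j)) (hf f).choose (hf f).choose_spec
      map_add' := fun _ _ => by ext j; rfl
      map_smul' := fun _ _ => by ext j; rfl }
  refine ⟨⟨E, WComp.continuous_of_continuous_comp E fun K hK => ?_⟩, fun _ _ => rfl⟩
  obtain ⟨m, hm⟩ := hb K K.isCompact hK
  choose C hC0 hC using fun i => P.exists_apply_le (φ i)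
  let EK : WK s p Ω K →ₗ[ℝ] BoundedContinuousFunction ℕ ℝ :=
    { toFun := fun u => E (WComp.ofWK hK u)
      map_add' := fun u v => E.map_add (WComp.ofWK hK u) (WComp.ofWK hK v)
      map_smul' := fun c u => E.map_smul c (WComp.ofWK hK u) }
  refine (EK.mkContinuous (∑ i ∈ Finset.range m, C i) fun u => ?_).continuous
  refine (BoundedContinuousFunction.norm_le (mul_nonneg (Finset.sum_nonneg fun i _ => hC0 i)
    (norm_nonneg u))).2 fun j => (hm _ u.2 j).trans ?_
  rw [Finset.sum_mul]
  exact Finset.sum_le_sum fun i _ => hC i (P.memW0_left (WComp.ofWK hK u)).toW0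

/-- The elements of a bounded subset of `W^{s,p}_comp(Ω)` are supported in a compact subset
of `Ω`. -/
lemma exists_compact_of_isVonNBounded (P : LocalDuality s p Ω) {B : Set (WComp s p Ω)}
    (hB : Bornology.IsVonNBounded ℝ B) : ∃ K : Compacts (Rn n), (K : Set (Rn n)) ⊆ Ω ∧
      ∀ f ∈ B, Distribution.dsupport f.toW.dist ⊆ K := by
  by_contra! hcon
  obtain ⟨K, hKm, hKΩ, hK⟩ := exists_compact_exhaustion Ω
  -- If no compact set works, some `f_j ∈ B` is detected by a test function `φ_j` supported off the
  -- `j`-th set of the exhaustion, scaled so that `f_j(φ_j) = j`. The continuous map `f ↦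
  -- (f(φ_j))_j` into the bounded sequences would then have an unbounded image of `B`.
  have h1 : ∀ j : ℕ, ∃ f ∈ B, ∃ φ : 𝓓(Ω, ℝ), tsupport φ ⊆ (K j : Set (Rn n))ᶜ ∧
      f.toW.dist φ = j := by
    intro j
    obtain ⟨f, hf, hfK⟩ := hcon (K j) (hKΩ j)
    obtain ⟨x, hx, hxK⟩ := Set.not_subset.1 hfK
    have h2 : ∃ φ : 𝓓(Ω, ℝ), tsupport φ ⊆ (K j : Set (Rn n))ᶜ ∧ f.toW.dist φ ≠ 0 := by
      by_contra! h
      exact (Distribution.notMem_dsupport_iff x).2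
        ⟨_, h, (K j).isCompact.isClosed.isOpen_compl, hxK⟩ hx
    obtain ⟨φ, hφ, h0⟩ := h2
    refine ⟨f, hf, ((j : ℝ) / f.toW.dist φ) • φ,
      subset_trans (closure_mono (Function.support_const_smul_subset _ _)) hφ, ?_⟩
    rw [map_smul, smul_eq_mul, div_mul_cancel₀ _ h0]
  choose f hf φ hφ hfφ using h1
  obtain ⟨E, hE⟩ := P.exists_eval_seq (φ := φ) fun L hL hLΩ => by
    obtain ⟨m, hm⟩ := hK L hL hLΩ
    refine ⟨m, fun u hu j hj => apply_eq_zero_of_disjoint u _ ?_⟩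
    exact Set.disjoint_of_subset (hφ j) (subset_trans hu (subset_trans hm (hKm hj)))
      disjoint_compl_left
  obtain ⟨R, hR⟩ := NormedSpace.image_isVonNBounded_iff ℝ |>.1 (hB.image E)
  obtain ⟨j, hj⟩ := exists_nat_gt R
  have h2 := ((E (f j)).norm_coe_le_norm j).trans (hR (f j) (hf j))
  rw [hE, hfφ, Real.norm_natCast] at h2
  exact h2.not_gt hj

/-- For a bounded set `B` with common support in `K`, a cutoff `ψ` for `K` and a norm bound `R` give
`|T(u)(f)| ≤ ‖P.pair‖ * max R 0 * ‖ψ u‖` for all `f ∈ B`. The right side is a multiple of one of the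
seminorms of `u`. -/
lemma continuous_toDual : Continuous P.toDual := by
  have := (WLoc.withSeminorms (s := -s) (p := p.conj) (Ω := Ω)).topologicalAddGroup
  refine continuous_of_continuousAt_zero P.toDual ?_
  rw [ContinuousAt, map_zero,
    (ContinuousLinearMap.hasBasis_nhds_zero_of_basis Metric.nhds_basis_ball).tendsto_right_iff]
  rintro ⟨B, ε⟩ ⟨hB, hε⟩
  obtain ⟨K, hK, hBK⟩ := P.exists_compact_of_isVonNBounded hB
  obtain ⟨ψ, hψ⟩ := exists_isCutoff K.isCompact hK
  obtain ⟨R, hR⟩ := NormedSpace.image_isVonNBounded_iff ℝ |>.1 (hB.image (WComp.toWL s p Ω))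
  have hc : Continuous fun u : WLoc (-s) p.conj Ω => ‖P.pair‖ * max R 0 * ‖u.mul ψ‖ :=
    continuous_const.mul (WLoc.withSeminorms.continuous_seminorm ψ)
  have h0 : ‖P.pair‖ * max R 0 * ‖(0 : WLoc (-s) p.conj Ω).mul ψ‖ = 0 := by
    have : (0 : WLoc (-s) p.conj Ω).mul ψ = 0 := (WLoc.mulL ψ).map_zero
    rw [this, norm_zero, mul_zero]
  have h1 : ∀ᶠ u in nhds (0 : WLoc (-s) p.conj Ω), ‖P.pair‖ * max R 0 * ‖u.mul ψ‖ < ε :=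
    hc.continuousAt.eventually (gt_mem_nhds (h0.trans_lt hε))
  filter_upwards [h1] with u hu f hf
  rw [mem_ball_zero_iff, P.toDual_apply (hψ _ (hBK f hf))]
  refine lt_of_le_of_lt ?_ hu
  calc ‖P.form ψ u f‖ ≤ ‖P.pair (P.memW0_left f).toW0‖ * ‖(P.memW0_right ψ u).toW0‖ :=
        ContinuousLinearMap.le_opNorm _ _
    _ ≤ ‖P.pair‖ * ‖(P.memW0_left f).toW0‖ * ‖(P.memW0_right ψ u).toW0‖ := by
        gcongr
        exact ContinuousLinearMap.le_opNorm _ _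
    _ ≤ ‖P.pair‖ * max R 0 * ‖(P.memW0_right ψ u).toW0‖ := by
        gcongr
        exact (hR f hf).trans (le_max_left _ _)

/-- The map `T`, as a topological isomorphism. -/
def toDualL : WLoc (-s) p.conj Ω ≃L[ℝ] StrongDual ℝ (WComp s p Ω) where
  toLinearEquiv := P.toDualEquiv
  continuous_toFun := P.continuous_toDual
  continuous_invFun := P.continuous_toDualEquiv_symm

end LocalDuality

end SobolevSlobodeckij
end

theorem mainTheorem2 {n : ℕ} (hn : 0 < n) (s : ℝ) (p : SobolevSlobodeckij.Exponent)
    (Ω : Opens (SobolevSlobodeckij.Rn n)) (hΩ : (Ω : Set (SobolevSlobodeckij.Rn n)).Nonempty)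
    (h₁ : SobolevSlobodeckij.IsSmoothMultiplicationTriple s p Ω)
    (h₂ : SobolevSlobodeckij.IsSmoothMultiplicationTriple (-s) p.conj Ω) :
    ∃ (hf : ∀ f : SobolevSlobodeckij.WComp s p Ω, SobolevSlobodeckij.MemW0 f.toW)
      (hu : ∀ (ψ : 𝓓(Ω, ℝ)) (u : SobolevSlobodeckij.WLoc (-s) p.conj Ω),
        SobolevSlobodeckij.MemW0 (u.mul ψ)),
      (∀ f : SobolevSlobodeckij.WComp s p Ω,
        ∃ ψ : 𝓓(Ω, ℝ), SobolevSlobodeckij.IsCutoff ψ f.toW.dist) ∧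
      (∀ (u : SobolevSlobodeckij.WLoc (-s) p.conj Ω) (f : SobolevSlobodeckij.WComp s p Ω)
        (ψ χ : 𝓓(Ω, ℝ)), SobolevSlobodeckij.IsCutoff ψ f.toW.dist →
          SobolevSlobodeckij.IsCutoff χ f.toW.dist →
          SobolevSlobodeckij.pairing (hu ψ u).toW0 (hf f).toW0 =
            SobolevSlobodeckij.pairing (hu χ u).toW0 (hf f).toW0) ∧
      ∃ T : SobolevSlobodeckij.WLoc (-s) p.conj Ω ≃L[ℝ]
          StrongDual ℝ (SobolevSlobodeckij.WComp s p Ω),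
        ∀ (u : SobolevSlobodeckij.WLoc (-s) p.conj Ω) (f : SobolevSlobodeckij.WComp s p Ω)
          (ψ : 𝓓(Ω, ℝ)), SobolevSlobodeckij.IsCutoff ψ f.toW.dist →
          T u f = SobolevSlobodeckij.pairing (hu ψ u).toW0 (hf f).toW0 := by
  obtain ⟨P₀, hP₀⟩ := SobolevSlobodeckij.exists_dualPair s p hn (SobolevSlobodeckij.sobolev Ω s p)
    (SobolevSlobodeckij.sobolev Ω (-s) p.conj) rfl rfl
  obtain ⟨P, hP⟩ := P₀.exists_localDuality h₁ h₂
  -- The abstract form is the concrete duality pairing, by the formula for `pair` in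
  -- `exists_dualPair`.
  have hform : ∀ ψ u f, P.form ψ u f =
      SobolevSlobodeckij.pairing (P.memW0_right ψ u).toW0 (P.memW0_left f).toW0 := fun ψ u f => by
    rw [SobolevSlobodeckij.LocalDuality.form, hP, hP₀]
    rfl
  refine ⟨P.memW0_left, P.memW0_right,
    SobolevSlobodeckij.LocalDuality.exists_isCutoff_comp, fun u f ψ χ hψ hχ => ?_, P.toDualL, fun u f ψ hψ => ?_⟩
  · rw [← hform, ← hform, P.form_eq hψ hχ]
  · rw [← hform]
    exact P.toDual_apply hψ u
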